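/- **Conventions.** Let $n\ge 1$ and ${\bf a}=(a_1,\dots,a_n)$ with all $a_i\ge 1$. Tuples are compared entrywise, $[m]=\{1,\dots,m\}$, $\boldsymbol\delta_i$ is the $i$-th unit vector, and $x^{[t]}$ is the $t$-th entry of an $n$-tuple $x$. For ${\bf x}\in\mathbb N^n$, ${\bf y}\in\mathbb Z^n$ put $\binom{\bf x}{\bf y}=\prod_i\binom{x_i}{y_i}$, where $\binom{x_i}{y_i}=0$ if $y_i<0$. For distinct finite sets $A,B$ of the same size in a linearly ordered set, $A<_{c\ell}B$ (colex order) means that the largest element of the symmetric difference of $A$ and $B$ lies in $B$. **Complexes.** A simplicial complex $\Delta$ on a finite non-empty vertex set $V$ is a collection of subsets of $V$ (faces), closed under taking subsets and containing $\{v\}$ for each $v\in V$. It is pure if all its inclusion-maximal faces have the same size. Let $(V_1,\dots,V_n)$ be an ordered partition of $V$ into non-empty, linearly ordered sets. Then $(\Delta,(V_1,\dots,V_n))$ is *${\bf a}$-balanced* if $|F\cap V_i|\le a_i$ for all faces $F$ and all $i$, and the largest size of a face is $a_1+\dots+a_n$. It is *color-compressed* if for all $F\in\Delta$ and $t\in[n]$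 the set $\{F'\cap V_t: F'\in\Delta,\ |F'\cap V_t|=|F\cap V_t|,\ F'\setminus V_t=F\setminus V_t\}$ is an initial segment, in colex order, of the set of all $|F\cap V_t|$-subsets of $V_t$. Its *fine $f$-vector* is $\{f_{\bf b}\}_{{\bf b}\le{\bf a}}$, where, for ${\bf b}\in\mathbb Z^n$, $f_{\bf b}$ is the number of faces $F$ with $|F\cap V_i|=b_i$ for all $i$. **Trees.** Consider a planar rooted tree $T$ (up to isomorphism) whose root $r_0$ has exactly one child $r_1$ and in which every vertex other than $r_0$ either has a left child $y_{\rm left}$ and a right child $y_{\rm right}$ (set $Y$ of such vertices $y$) or has no children (set $L$). Let $\varphi$ be a labeling of its vertices with $\varphi(r_0)={\bf a}$, $\varphi(y)\in[n]$ for $y\in Y$, and $\varphi(u)\in\mathbb Z_{>0}^n$ for $u\in L$. Every vertex counts as an ancestor and as a descendant of itself. The left (right) relative sequence of $v\in Y\cup L$ starts at $v$ and passes to left (right) children until it ends in $L$. The depth-first order is the linear order on the vertices in which each vertex comes first, then all descendants of its left child, then all descendants of its right child. * The *left-weight* of $v\in Y\cup L$ is $\omega(v)=\varphi(v_m)+\sum_{i<m}\boldsymbol\delta_{\varphi(v_i)}$,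 where $v_1,\dots,v_m$ is the left relative sequence of $v$. * Define $\nu$ by $\nu(r_1)={\bf a}$, $\nu(y_{\rm left})=\nu(y)$, $\nu(y_{\rm right})=\nu(y)-\boldsymbol\delta_{\varphi(y)}$ for $y\in Y$. * For $0\le t\le n$, a vertex $x\in Y\cup L$ is *$t$-leading* if $\varphi(x)\le t$ in case $x\in Y$, and $\varphi(\tilde x)>t$ for the parent $\tilde x$ of $x$ in case $\tilde x\ne r_0$. For $t\in[n]$ and $x\in Y\cup L$ let $x_1,\dots,x_\ell$ be the right relative sequence of $x$; the *$t$-end* of $x$ is $x_k$, where $k$ is the smallest index with $x_k\in L$ or $\varphi(x_k)\ne t$. Let $\psi^{(t)}(x)$ be the set of all $\omega^{[t]}(v)$ such that $v\in Y$, $\varphi(v)=t$, and both $v$ and $v_{\rm right}$ are ancestors of $x$. The *$t$-signature* $\xi^{(t)}(x)$ is the union of $\psi^{(t)}(x)$, of $\{\omega^{[t]}(x_i): 1\le i<k\}$, and of the $a_t-|\psi^{(t)}(x)|-(k-1)$ largest elements of $[\omega^{[t]}(x_k)]$. For $0\le j<i\le n$ and a $j$-leading vertex $x$ with $({\bf a}-\nu(x))^{[i]}>0$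 define $\zeta^i_j(x)$ as follows. If $j=i-1$, it is the immediate predecessor of $x$ among the $j$-leading vertices in depth-first order. If $j<i-1$, let $\tilde x$ be the unique $(j+1)$-leading ancestor of $x$, and let $\zeta^i_j(x)$ be the first, in depth-first order, among the $j$-leading descendants $z$ of $\zeta^i_{j+1}(\tilde x)$ with $\xi^{(j+1)}(x)\le_{c\ell}\xi^{(j+1)}(z)$. **Representations.** $\alpha=(T,\varphi)$ as above is a *generalized ${\bf a}$-Macaulay representation* of the positive integer $N$ if the following hold. 1. (Macaulay tree of $N$) (a) $\varphi(y)\ge\varphi(y')$ whenever $y,y'\in Y$ and $y'$ is a descendant of $y$; (b) if $y\in Y$ and $t>\varphi(y)$, then $\varphi^{[t]}$ is constant on the descendants of $y$ in $L$; (c) $\omega(y_{\rm left})\ge\omega(y_{\rm right})$ for all $y\in Y$; (d) $\varphi(u)\ge\nu(u)\ge{\bf 0}$ and $\nu(u)\ne{\bf 0}$ for all $u\in L$; (e) if $y\in Y$ and $\nu^{[\varphi(y)]}(y)=1$, then $\omega^{[\varphi(y)]}(x)=\omega^{[\varphi(y)]}(y)-1$ for all descendants $x$ of $y_{\rm right}$;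 (f) $N=\sum_{u\in L}\binom{\varphi(u)}{\nu(u)}$. 2. (Condensed) There is no $y\in Y$ such that the trees of descendants of $y_{\rm left}$ and of $y_{\rm right}$ are isomorphic as planar labeled trees and both $y_{\rm left}$ and $y_{\rm right}$ are $(\varphi(y)-1)$-leading. 3. (Compressed-like) For all $t\in[n]$ and $y\in Y$ with $\varphi(y)=t$: (a) if $x\in Y$, $\varphi(x)=t$, $y$ is a descendant of $x_{\rm left}$, and $x=x_0,x_1,\dots,x_\ell=y_{\rm right}$ is the path from $x$ to $y_{\rm right}$, then $\omega^{[t]}(x_i)=\omega^{[t]}(x)-i$ for all $i\in[\ell]$; (b) if $z$ is the $t$-end of $y_{\rm left}$, then $\omega^{[t']}(z)\ge\omega^{[t']}(y_{\rm right})$ for all $t'\ne t$. 4. (Compatible) For all $1\le t<i\le n$ and every $t$-leading $x$ with $({\bf a}-\nu(x))^{[i]}>0$, the vertex $\zeta^i_t(x)$ is defined and $\xi^{(t)}(x)\le_{c\ell}\xi^{(t)}(\zeta^i_t(x))$. For ${\bf x}\in\mathbb Z^n$ put $\partial_{[{\bf x}]}(\alpha)=\sum_{u\in L}\binom{\varphi(u)}{\nu(u)+{\bf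 x}}$. **Theorem.** Let $n\ge1$, let ${\bf a}$ be an $n$-tuple of positive integers, and let $f=\{f_{\bf b}\}_{{\bf b}\le{\bf a}}$ (${\bf b}\in\mathbb Z^n$) be an array of integers. The following are equivalent: (i) $f$ is the fine $f$-vector of a pure color-compressed ${\bf a}$-balanced complex; (ii) $f_{\bf a}>0$, and there is a generalized ${\bf a}$-Macaulay representation $\alpha$ of $f_{\bf a}$ such that $f_{\bf b}=\partial_{[{\bf b}-{\bf a}]}(\alpha)$ for all ${\bf b}\le{\bf a}$. -/

import Mathlib

/-! ### Colored simplicial complexes and their fine f-vectors -/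

/-- A simplicial complex on the finite vertex set `V` (the empty face is a face, and every `{v}` is
a face) together with an ordered partition of `V` into `n` non-empty classes, given by a surjective
map `color : V → Fin n`; the `i`-th class is `color ⁻¹ {i}`. The linear order of `V` serves only to
order each of the classes. -/
structure ColoredComplex (n : ℕ) (V : Type) [Fintype V] [LinearOrder V] where
  faces : Finset (Finset V)
  empty_mem : ∅ ∈ faces
  down_closed : ∀ F ∈ faces, ∀ G, G ⊆ F → G ∈ faces
  singleton_mem : ∀ v : V, {v} ∈ faces
  color : V → Fin n
  color_surjective : Function.Surjective color

/-- `S` is an initial segment, in the colexicographic order, of the set of all `k`-subsets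
of `W`. -/
def IsColexInitialSegment {V : Type} [LinearOrder V] (W : Finset V) (k : ℕ)
    (S : Set (Finset V)) : Prop :=
  (∀ A ∈ S, A ∈ Finset.powersetCard k W) ∧
    ∀ A ∈ S, ∀ B ∈ Finset.powersetCard k W, toColex B ≤ toColex A → B ∈ S

namespace ColoredComplex

/-- The `i`-th class `V_i` of the ordered partition. -/
def part {n : ℕ} {V : Type} [Fintype V] [LinearOrder V] (K : ColoredComplex n V) (i : Fin n) :
    Finset V :=
  Finset.univ.filter fun v => K.color v = i

/-- All facets (inclusion-maximal faces) have the same dimension. -/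
def IsPure {n : ℕ} {V : Type} [Fintype V] [LinearOrder V] (K : ColoredComplex n V) : Prop :=
  ∀ F G : Finset V, Maximal (· ∈ K.faces) F → Maximal (· ∈ K.faces) G → F.card = G.card

/-- The complex is colored of type `a`. -/
def IsColored {n : ℕ} {V : Type} [Fintype V] [LinearOrder V] (K : ColoredComplex n V)
    (a : Fin n → ℕ) : Prop :=
  ∀ F ∈ K.faces, ∀ i, (F ∩ K.part i).card ≤ a i

/-- The complex is balanced of type `a`: colored of type `a`, and of dimension `|a| - 1`. -/
def IsBalanced {n : ℕ} {V : Type} [Fintype V] [LinearOrder V] (K : ColoredComplex n V)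
    (a : Fin n → ℕ) : Prop :=
  K.IsColored a ∧ IsGreatest {m : ℕ | ∃ F ∈ K.faces, F.card = m} (∑ i, a i)

/-- Color-compressed: for every face `F` and color `t`, the traces on `V_t` of the faces that agree
with `F` outside `V_t` and have as many vertices as `F` in `V_t` form a colex initial segment. -/
def IsColorCompressed {n : ℕ} {V : Type} [Fintype V] [LinearOrder V] (K : ColoredComplex n V) :
    Prop :=
  ∀ F ∈ K.faces, ∀ t : Fin n,
    IsColexInitialSegment (K.part t) (F ∩ K.part t).card
      {A | ∃ F' ∈ K.faces, (F' ∩ K.part t).card = (F ∩ K.part t).card ∧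
        F' \ K.part t = F \ K.part t ∧ A = F' ∩ K.part t}

/-- The number `f_b` of faces with exactly `b i` vertices in `V_i` for every `i`. -/
def fineF {n : ℕ} {V : Type} [Fintype V] [LinearOrder V] (K : ColoredComplex n V)
    (b : Fin n → ℤ) : ℕ :=
  (K.faces.filter fun F => ∀ i, ((F ∩ K.part i).card : ℤ) = b i).card

end ColoredComplex

/-! ### Labeled trivalent planted binary trees -/

/-- A planar trivalent planted binary tree, up to isomorphism, with its labels other than the label
of the root: the root `r₀` is left implicit and the term describes the tree hanging from its unique
child `r₁`. Trivalent vertices (`node`) carry a color and have a left and a right child; terminal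
vertices (`leaf`) carry an `n`-tuple. Colors `1, …, n` are the elements `0, …, n - 1` of `Fin n`. -/
inductive ColorTree (n : ℕ) : Type
  | leaf (w : Fin n → ℕ) : ColorTree n
  | node (t : Fin n) (l r : ColorTree n) : ColorTree n

/-- `binom x y` for tuples: the product of the binomial coefficients of the entries, with the
convention that a binomial coefficient with negative lower entry is zero. -/
def tupleChoose {n : ℕ} (x : Fin n → ℕ) (y : Fin n → ℤ) : ℕ :=
  ∏ i, if y i < 0 then 0 else (x i).choose (y i).toNat

namespace ColorTree

/-- The vertices other than the root `r₀`, in depth-first order. A vertex is addressed by the path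
from `r₁` to it: `false` is a step to the left child and `true` a step to the right child. So `x` is
an ancestor of `y` if and only if `x <+: y`. -/
def verts {n : ℕ} : ColorTree n → List (List Bool)
  | leaf _ => [[]]
  | node _ l r => [] :: (l.verts.map (List.cons false) ++ r.verts.map (List.cons true))

/-- The terminal vertices, in depth-first order. -/
def leaves {n : ℕ} : ColorTree n → List (List Bool)
  | leaf _ => [[]]
  | node _ l r => l.leaves.map (List.cons false) ++ r.leaves.map (List.cons true)

/-- The labeled subtree formed by all descendants of a vertex. -/
def subtree {n : ℕ} : ColorTree n → List Bool → Option (ColorTree n)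
  | T, [] => some T
  | leaf _, _ :: _ => none
  | node _ l _, false :: p => l.subtree p
  | node _ _ r, true :: p => r.subtree p

/-- The label of a trivalent vertex (`none` at terminal vertices). -/
def label {n : ℕ} (T : ColorTree n) (x : List Bool) : Option (Fin n) :=
  match T.subtree x with
  | some (node t _ _) => some t
  | _ => none

/-- The left-weight of the top vertex: the label of its left-most relative, plus one unit vector
for the color of each trivalent vertex in its left relative sequence. -/
def topWeight {n : ℕ} : ColorTree n → Fin n → ℕ
  | leaf w => w
  | node t l _ => l.topWeight + Pi.single t 1

/-- The left-weight labeling `ω`; at a terminal vertex it is the label of that vertex. -/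
def leftWeight {n : ℕ} (T : ColorTree n) (x : List Bool) : Fin n → ℕ :=
  match T.subtree x with
  | some S => S.topWeight
  | none => 0

/-- The labeling `ν` of the splitting tree: `ν r₁ = c`, a left child inherits the value of its
parent `y`, and at a right child the entry of the color of `y` drops by one. -/
def split {n : ℕ} : ColorTree n → (Fin n → ℤ) → List Bool → (Fin n → ℤ)
  | _, c, [] => c
  | leaf _, c, _ :: _ => c
  | node _ l _, c, false :: p => l.split c p
  | node t _ r, c, true :: p => r.split (c - Pi.single t 1) p

/-- The labeling `ν` of the splitting tree of type `a`. -/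
def nu {n : ℕ} (T : ColorTree n) (a : Fin n → ℕ) (x : List Bool) : Fin n → ℤ :=
  T.split (fun i => (a i : ℤ)) x

/-- `∂_[c] T = ∑_u binom (φ u) (ν u + c)`, the sum being over all terminal vertices `u`. -/
def differential {n : ℕ} (T : ColorTree n) (a : Fin n → ℕ) (c : Fin n → ℤ) : ℕ :=
  (T.leaves.map fun u => tupleChoose (T.leftWeight u) (T.nu a u + c)).sum

/-- `T`, with root label `a`, is an `a`-Macaulay tree of `N`. -/
structure IsMacaulayTree {n : ℕ} (T : ColorTree n) (a : Fin n → ℕ) (N : ℕ) : Prop where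
  leaf_pos : ∀ u ∈ T.leaves, ∀ i, 0 < T.leftWeight u i
  label_antitone : ∀ y ∈ T.verts, ∀ y' ∈ T.verts, ∀ s s', T.label y = some s →
    T.label y' = some s' → y <+: y' → s' ≤ s
  leaf_eq : ∀ y ∈ T.verts, ∀ s, T.label y = some s → ∀ u ∈ T.leaves, ∀ u' ∈ T.leaves,
    y <+: u → y <+: u' → ∀ t, s < t → T.leftWeight u t = T.leftWeight u' t
  proper : ∀ y ∈ T.verts, ∀ s, T.label y = some s →
    T.leftWeight (y ++ [true]) ≤ T.leftWeight (y ++ [false])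
  nu_le : ∀ u ∈ T.leaves, ∀ i, T.nu a u i ≤ T.leftWeight u i
  nu_pos : ∀ u ∈ T.leaves, 0 ≤ T.nu a u ∧ T.nu a u ≠ 0
  exhausted : ∀ y ∈ T.verts, ∀ s, T.label y = some s → T.nu a y s = 1 →
    ∀ x ∈ T.verts, y ++ [true] <+: x → (T.leftWeight x s : ℤ) = T.leftWeight y s - 1
  sum_eq : N = (T.leaves.map fun u => tupleChoose (T.leftWeight u) (T.nu a u)).sum

/-- The `t`-leading vertices (`0 ≤ t ≤ n`), in depth-first order: those whose label, if they are
trivalent, is among the first `t` colors, and whose parent, unless it is `r₀`, has a label that is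
not among the first `t` colors. -/
def leading {n : ℕ} (T : ColorTree n) (t : ℕ) : List (List Bool) :=
  T.verts.filter fun x =>
    (∀ s : Fin n, T.label x = some s → s.val < t) ∧
      (x ≠ [] → ∀ s : Fin n, T.label x.dropLast = some s → t ≤ s.val)

/-- Condensed: there is no cloning vertex, i.e. no trivalent vertex `y` whose two children have
isomorphic labeled subtrees and are both `(φ y - 1)`-leading. -/
def IsCondensed {n : ℕ} (T : ColorTree n) : Prop :=
  ∀ y ∈ T.verts, ∀ s : Fin n, T.label y = some s →
    ¬ (T.subtree (y ++ [false]) = T.subtree (y ++ [true]) ∧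
      y ++ [false] ∈ T.leading s.val ∧ y ++ [true] ∈ T.leading s.val)

/-- If `S` has top vertex `x` with right relative sequence `x₁ = x, …, x_m`, and `k` is the smallest
index such that `x_k` is terminal or has a label other than `t`, then this is `k - 1`. -/
def topRun {n : ℕ} (t : Fin n) : ColorTree n → ℕ
  | leaf _ => 0
  | node s _ r => if s = t then topRun t r + 1 else 0

/-- The number `k - 1` of `topRun` for the vertex `x` of `T`. -/
def run {n : ℕ} (T : ColorTree n) (t : Fin n) (x : List Bool) : ℕ :=
  match T.subtree x with
  | some S => S.topRun t
  | none => 0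

/-- The vertex `x_k` of `topRun` for the vertex `x` of `T`. -/
def runEnd {n : ℕ} (T : ColorTree n) (t : Fin n) (x : List Bool) : List Bool :=
  x ++ List.replicate (T.run t x) true

/-- Compressed-like trees. In the first condition the vertices `z` with `x <+: z` and
`z <+: y ++ [true]` are those on the path from `x` to the right child of `y`. -/
structure IsCompressedLike {n : ℕ} (T : ColorTree n) : Prop where
  path : ∀ t : Fin n, ∀ y ∈ T.verts, T.label y = some t →
    ∀ x ∈ T.verts, T.label x = some t → x ++ [false] <+: y →
      ∀ z ∈ T.verts, x <+: z → z <+: y ++ [true] →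
        (T.leftWeight z t : ℤ) = T.leftWeight x t - ((z.length : ℤ) - x.length)
  runEnd_ge : ∀ t : Fin n, ∀ y ∈ T.verts, T.label y = some t →
    ∀ t' : Fin n, t' ≠ t →
      T.leftWeight (y ++ [true]) t' ≤ T.leftWeight (T.runEnd t (y ++ [false])) t'

/-- `ψ^(t)(x)`: the `t`-th entries of the left-weights of the vertices of color `t` such that they
and their right children are ancestors of `x`. -/
def psi {n : ℕ} (T : ColorTree n) (t : Fin n) (x : List Bool) : Finset ℕ :=
  ((T.verts.filter fun v => T.label v = some t ∧ v ++ [true] <+: x).map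
    fun v => T.leftWeight v t).toFinset

/-- The `t`-signature `ξ^(t)(x)`, a set of `a t` positive integers. With `x₁, …, x_k` as in `topRun`,
it consists of `ψ^(t)(x)`, of the `t`-th entries of `ω` at `x₁, …, x_{k-1}`, and of the
`m = a t - |ψ^(t)(x)| - (k - 1)` largest elements of `{1, …, w}`, where `w` is the `t`-th entry of
`ω` at `x_k`. (If `m ≥ 1`, then these elements are `w` and the colex-largest `(m - 1)`-subset of
`{1, …, w - 1}`.) -/
def signature {n : ℕ} (T : ColorTree n) (a : Fin n → ℕ) (t : Fin n) (x : List Bool) : Finset ℕ :=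
  T.psi t x ∪
    (Finset.range (T.run t x)).image (fun i => T.leftWeight (x ++ List.replicate i true) t) ∪
    Finset.Ioc
      (T.leftWeight (T.runEnd t x) t - (a t - (T.psi t x).card - T.run t x))
      (T.leftWeight (T.runEnd t x) t)

/-- For the color `i` (color number `i.val + 1`), `zeta T a i d x` is `ζ^{i.val+1}_j(x)` for
`j = i.val - d` (where `d ≤ i.val`) and a `j`-leading vertex `x`, and `none` if this is undefined.
For `d = 0` it is the predecessor of `x` in the depth-first enumeration of the `j`-leading
vertices. Otherwise, let `x'` be the `(j+1)`-leading ancestor of `x`, and `y'` the value at `x'` one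
level up; it is then the first `j`-leading descendant `z` of `y'` such that
`ξ^(j+1)(x) ≤ ξ^(j+1)(z)` in colex order (color number `j + 1` is the element `j` of `Fin n`). -/
def zeta {n : ℕ} (T : ColorTree n) (a : Fin n → ℕ) (i : Fin n) :
    ℕ → List Bool → Option (List Bool)
  | 0, x => ((T.leading i.val).takeWhile fun z => z ≠ x).getLast?
  | d + 1, x =>
    ((T.leading (i.val - d)).find? fun x' => x' <+: x).bind fun x' =>
      (zeta T a i d x').bind fun y' =>
        (T.leading (i.val - (d + 1))).find? fun z =>
          y' <+: z ∧
            toColex (T.signature a ⟨i.val - (d + 1), lt_of_le_of_lt (Nat.sub_le _ _) i.isLt⟩ x) ≤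
              toColex (T.signature a ⟨i.val - (d + 1), lt_of_le_of_lt (Nat.sub_le _ _) i.isLt⟩ z)

/-- Compatible: `ξ^(t)(x) ≤ ξ^(t)(ζ^i_t(x))` in colex order for all colors `t < i` and every
`t`-leading vertex `x` at which the `i`-th entry of `a - ν(x)` is positive. The element `t` of
`Fin n` is the color number `t.val + 1`, so the `t`-leading vertices are `T.leading (t.val + 1)`. -/
def IsCompatible {n : ℕ} (T : ColorTree n) (a : Fin n → ℕ) : Prop :=
  ∀ i t : Fin n, t < i → ∀ x ∈ T.leading (t.val + 1), 0 < (a i : ℤ) - T.nu a x i →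
    ∃ z ∈ T.leading (t.val + 1), T.zeta a i (i.val - (t.val + 1)) x = some z ∧
      toColex (T.signature a t x) ≤ toColex (T.signature a t z)

/-- `T` is a generalized `a`-Macaulay representation of the positive integer `N`: a condensed,
compressed-like, compatible `a`-Macaulay tree of `N`. -/
structure IsGenMacaulayRep {n : ℕ} (T : ColorTree n) (a : Fin n → ℕ) (N : ℕ) : Prop where
  macaulay : T.IsMacaulayTree a N
  condensed : T.IsCondensed
  compressedLike : T.IsCompressedLike
  compatible : T.IsCompatible a

end ColorTree

/-!
Number the vertices of each color class `V_i` in increasing order by `0, 1, …`. A set of vertices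
becomes an `n`-tuple of finite sets of natural numbers. Since the complex is pure, it is determined
by its facets, the faces of type `a`. Color-compressedness says that the family of these tuples is
closed under replacing one entry by an earlier set, in colex order, of the same size; conversely, a
non-empty finite family of tuples of type `a` with this closure property generates a
color-compressed complex, because shadows of colex initial segments are initial segments
(`Finset.Colex.exists_superset_le`). So the theorem compares two descriptions of such families.

A tree describes a family of tuples (`ColorTree.HasFace`): a tuple travels down from the top, and
at a vertex of color `t` with left subtree `l` it turns right, and the number `l.topWeight t` is
removed from its `t`-th entry, if the entry contains this number; otherwise it turns left. At a
terminal vertex with label `w` what is left of each entry `A i` has to lie in `{0, …, w i - 1}`.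
Counting the tuples of type `b` gives the sum of products of binomial coefficients which defines
the differential (`ColorTree.card_tuples_eq_differential`). If the family of facets is closed under
colex descent, the tuples of type `b ≤ a` which are described are exactly the subtuples of facets
(`ColorTree.mem_tuples_iff_exists`), so the differential is the fine `f`-vector.

It remains to match the conditions on representations with closure under colex descent. Colors do
not increase downwards, so the tree decomposes into levels: below each `(t + 1)`-leading vertex,
the vertices of color `t` at the top form one level, which ends in `t`-leading vertices. Along a
level the possible sets of color `t` form a colex initial segment, cut into intervals, the cells,
one for each `t`-leading vertex at the end, in depth-first order (`ColorTree.InLevel.mono`). The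
signature of the end of a cell is the largest set of the cell, and the signature of the start of a
level is the largest set of the whole level (`ColorTree.signature_of_lead`,
`ColorTree.signature_of_lead_succ`). The local conditions on trees amount to the recursive property
`ColorTree.Core`.

The family is closed under colex descent if and only if, along every level, the families of tuples
in the lower colors decrease from cell to cell. The vertex `ζ` assigned to `x` is found by stepping
back one cell in a level of color `i` above `x`, and then following, level by level, the cells that
contain the largest sets of the cells leading to `x`; the compatibility condition says that the
next level below `ζ` reaches at least as far as the one below `x`. By induction on the colors this
is equivalent to the inclusion of families (`ColorTree.isDown_of_isCompatible`,
`ColorTree.isCompatible_of_isDown`).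

Finally, every family closed under colex descent is described by a tree (`ColorTree.describable`):
split off the largest vertex of the highest color until the family no longer depends on the set of
that color, and go on with the next lower color. Splitting only when necessary makes the tree
condensed and fixes the weights of exhausted colors, and closure under colex descent gives the
inequalities between weights.
-/

/-! ### Colexicographic comparisons of finite sets of natural numbers -/

namespace Finset.Colex

theorem erase_mono_of_mem {α : Type*} [LinearOrder α] {s t : Finset α} {v : α} (hs : v ∈ s)
    (ht : v ∈ t) (h : toColex s ≤ toColex t) : toColex (s.erase v) ≤ toColex (t.erase v) := by
  rw [← sdiff_singleton_eq_erase, ← sdiff_singleton_eq_erase]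
  exact (toColex_sdiff_le_toColex_sdiff (by simpa using hs) (by simpa using ht)).2 h

theorem insert_mono_of_notMem {α : Type*} [LinearOrder α] {s t : Finset α} {v : α} (hs : v ∉ s)
    (ht : v ∉ t) (h : toColex s ≤ toColex t) : toColex (insert v s) ≤ toColex (insert v t) := by
  rw [← toColex_sdiff_le_toColex_sdiff (u := {v}) (by simp) (by simp)]
  simpa [sdiff_singleton_eq_erase, hs, ht] using h

theorem lt_of_subset_range_of_mem {s t : Finset ℕ} {v : ℕ} (hs : s ⊆ range v) (ht : v ∈ t) :
    toColex s < toColex t := by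
  rw [toColex_lt_toColex_iff_exists_forall_lt]
  refine ⟨v, ht, fun h => ?_, fun b hb _ => mem_range.1 (hs hb)⟩
  exact lt_irrefl _ (mem_range.1 (hs h))

theorem subset_range_of_le {s t : Finset ℕ} {w : ℕ} (h : toColex s ≤ toColex t)
    (ht : t ⊆ range w) : s ⊆ range w := fun b hb =>
  mem_range.2 (forall_lt_mono h (fun _ hc => mem_range.1 (ht hc)) b hb)

theorem le_Ico_of_subset_range {s : Finset ℕ} {w : ℕ} (hs : s ⊆ range w) :
    toColex s ≤ toColex (Ico (w - s.card) w) := by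
  rw [toColex_le_toColex]
  intro a ha ha'
  have haw := mem_range.1 (hs ha)
  have hlt : a < w - s.card := by
    by_contra h
    exact ha' (mem_Ico.2 ⟨not_lt.1 h, haw⟩)
  by_contra! hcon
  have hsub : insert a (Ico (w - s.card) w) ⊆ s := by
    intro b hb
    rcases mem_insert.1 hb with rfl | hb
    · exact ha
    · by_contra hbs
      have := hcon b hb hbs
      have := (mem_Ico.1 hb).1
      omega
  have := card_le_card hsub
  rw [card_insert_of_notMem ha', Nat.card_Ico] at this
  omega

/-- A set that precedes `t` can be enlarged along with `t` by one element, staying in colex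
order. -/
theorem exists_insert_le {s t : Finset ℕ} {x : ℕ} (h : toColex s ≤ toColex t)
    (hc : s.card = t.card) (hx : x ∉ t) :
    ∃ y ∉ s, toColex (insert y s) ≤ toColex (insert x t) := by
  by_cases hxs : x ∉ s
  · exact ⟨x, hxs, insert_mono_of_notMem hxs hx h⟩
  rw [not_not] at hxs
  have hne : s ≠ t := fun h => hx (h ▸ hxs)
  obtain ⟨d, hd, hgt⟩ :=
    lt_iff_exists_filter_lt.1 (lt_of_le_of_ne h (fun e => hne (toColex_inj.1 e)))
  obtain ⟨hdt, hds⟩ := mem_sdiff.1 hd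
  have hgt' : ∀ z, d < z → (z ∈ s ↔ z ∈ t) := fun z hz => by
    have := Finset.ext_iff.1 hgt z
    simpa [hz] using this
  have hlt : ∀ z ∈ s, z ∉ t → z < d := fun z hz hzt => by
    rcases lt_trichotomy z d with h | h | h
    · exact h
    · exact absurd (h ▸ hz) hds
    · exact absurd ((hgt' z h).1 hz) hzt
  -- the least element missing from `s` is the cheapest one to add
  have hex : ∃ y, y ∉ s := ⟨d, hds⟩
  refine ⟨Nat.find hex, Nat.find_spec hex, ?_⟩
  have hyd : Nat.find hex ≤ d := Nat.find_min' hex hds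
  have hymin : ∀ z < Nat.find hex, z ∈ s := fun z hz => not_not.1 (Nat.find_min hex hz)
  rw [toColex_le_toColex]
  intro a ha hat
  rw [mem_insert, not_or] at hat
  rcases hyd.lt_or_eq with hyd' | heq
  · refine ⟨d, mem_insert_of_mem hdt, by simp [hds, hyd'.ne'], ?_⟩
    rcases mem_insert.1 ha with rfl | ha
    · exact hyd
    · exact (hlt a ha hat.2).le
  · -- here `s` contains everything below `d`, so `t` would have fewer elements than `s`
    exfalso
    have has : a ∈ s := by
      rcases mem_insert.1 ha with rfl | ha
      · exact absurd (heq ▸ hdt) hat.2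
      · exact ha
    have hsub : t ⊆ insert d ((s.erase a).erase x) := by
      intro z hz
      rw [mem_insert, mem_erase, mem_erase]
      rcases lt_trichotomy z d with h | h | h
      · exact Or.inr ⟨fun e => hx (e ▸ hz), fun e => hat.2 (e ▸ hz), hymin z (heq ▸ h)⟩
      · exact Or.inl h
      · exact Or.inr ⟨fun e => hx (e ▸ hz), fun e => hat.2 (e ▸ hz), (hgt' z h).2 hz⟩
    have h1 := card_le_card hsub
    have h2 := card_insert_le d ((s.erase a).erase x)
    have hxa : x ∈ s.erase a := mem_erase.2 ⟨fun e => hat.1 e.symm, hxs⟩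
    have h3 := card_erase_add_one hxa
    have h4 := card_erase_add_one has
    omega

/-- Shadows of colex initial segments are initial segments: if `s` precedes a subset `t` of `u`,
then some superset of `s` of the size of `u` precedes `u`. -/
theorem exists_superset_le {s t u : Finset ℕ} (h : toColex s ≤ toColex t)
    (hc : s.card = t.card) (hu : t ⊆ u) :
    ∃ r, s ⊆ r ∧ r.card = u.card ∧ toColex r ≤ toColex u := by
  induction hk : (u \ t).card generalizing s t with
  | zero =>
    have : t = u := by
      refine hu.antisymm ?_
      rwa [card_eq_zero, sdiff_eq_empty_iff_subset] at hk
    subst this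
    exact ⟨s, Subset.rfl, hc, h⟩
  | succ k ih =>
    obtain ⟨x, hx⟩ : (u \ t).Nonempty := card_pos.1 (by omega)
    obtain ⟨hxu, hxt⟩ := mem_sdiff.1 hx
    obtain ⟨y, hy, hle⟩ := exists_insert_le h hc hxt
    obtain ⟨r, hr, hr'⟩ := ih hle (by rw [card_insert_of_notMem hy, card_insert_of_notMem hxt, hc])
      (insert_subset hxu hu) (by
        rw [sdiff_insert, card_erase_of_mem hx, hk]; rfl)
    exact ⟨r, (subset_insert _ _).trans hr, hr'⟩

end Finset.Colex

/-! ### Recursive descriptions of levels in a color tree -/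

namespace ColorTree

open Finset Colex Function

section Levels

variable {n : ℕ}

/-- All labels of trivalent vertices are among the first `j` colors. -/
def Below (j : ℕ) : ColorTree n → Prop
  | leaf _ => True
  | node s l r => s.val < j ∧ l.Below j ∧ r.Below j

/-- All terminal labels have `i`-th entry `m`. -/
def ConstAt (i : Fin n) (m : ℕ) : ColorTree n → Prop
  | leaf w => w i = m
  | node _ l r => l.ConstAt i m ∧ r.ConstAt i m

/-- The part of the tree formed by the topmost vertices of color `t` describes all subsets of
`{0, …, w - 1}` of the given size, where `w` is the `t`-th entry of the top weight: no weight is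
lost on passing to right children. -/
def Full (t : Fin n) : ColorTree n → Prop
  | leaf _ => True
  | node s l r => s = t → l.Full t ∧ r.Full t ∧ r.topWeight t = l.topWeight t

/-- Recursive form of the local conditions on Macaulay trees and compressed-like trees, for a tree
whose top vertex has splitting label `c`. -/
def Core : ColorTree n → (Fin n → ℤ) → Prop
  | leaf w, c => (∀ i, 0 < w i) ∧ 0 ≤ c ∧ c ≠ 0 ∧ ∀ i, c i ≤ w i
  | node t l r, c => l.Core c ∧ r.Core (c - Pi.single t 1) ∧ r.topWeight ≤ l.topWeight ∧
      l.Below (t + 1) ∧ r.Below (t + 1) ∧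
      (∀ i, t < i → l.ConstAt i (l.topWeight i) ∧ r.ConstAt i (l.topWeight i)) ∧ l.Full t

/-- The address `p` is the first vertex on its path whose label, if any, is among the first `j`
colors. -/
def Lead (j : ℕ) : ColorTree n → List Bool → Prop
  | leaf _, p => p = []
  | node s _ _, [] => s.val < j
  | node s l _, false :: p => j ≤ s.val ∧ l.Lead j p
  | node s _ r, true :: p => j ≤ s.val ∧ r.Lead j p

/-- The address where a set `B` of vertices of color `t` leaves the topmost vertices of color `t`:
the path turns right at a vertex of weight `v + 1` if and only if `v` belongs to `B`. -/
def cell (t : Fin n) : ColorTree n → Finset ℕ → List Bool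
  | leaf _, _ => []
  | node s l r, B =>
    if s = t then
      if l.topWeight t ∈ B then true :: r.cell t (B.erase (l.topWeight t)) else false :: l.cell t B
    else []

/-- The subtree at the address `cell t S B`. -/
def cellTree (t : Fin n) : ColorTree n → Finset ℕ → ColorTree n
  | leaf w, _ => leaf w
  | node s l r, B =>
    if s = t then
      if l.topWeight t ∈ B then r.cellTree t (B.erase (l.topWeight t)) else l.cellTree t B
    else node s l r

/-- The set `B` of vertices of color `t` is described by the topmost vertices of color `t`: what
is left of `B` at the end of its path lies in `{0, …, w - 1}`, with `w` the weight there. -/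
def InLevel (t : Fin n) : ColorTree n → Finset ℕ → Prop
  | leaf w, B => B ⊆ range (w t)
  | node s l r, B =>
    if s = t then
      if l.topWeight t ∈ B then r.InLevel t (B.erase (l.topWeight t)) else l.InLevel t B
    else B ⊆ range ((node s l r).topWeight t)

/-- The tuple `A` of vertex sets, restricted to the first `j` colors, is described by the tree. -/
def HasFace (j : ℕ) : ColorTree n → (Fin n → Finset ℕ) → Prop
  | leaf w, A => ∀ i : Fin n, i.val < j → A i ⊆ range (w i)
  | node t l r, A =>
    if l.topWeight t ∈ A t then r.HasFace j (update A t ((A t).erase (l.topWeight t)))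
    else l.HasFace j A

/-- The colex largest set with `k` elements among those of color `t` leaving the topmost vertices
of color `t` at the address `p`. -/
def cellMax (t : Fin n) : ColorTree n → ℕ → List Bool → Finset ℕ
  | S, k, [] => Ico (S.topWeight t - k) (S.topWeight t)
  | leaf _, _, _ :: _ => ∅
  | node _ l _, k, false :: p => l.cellMax t k p
  | node _ l r, k, true :: p => insert (l.topWeight t) (r.cellMax t (k - 1) p)

theorem Below.mono {j k : ℕ} (h : j ≤ k) {S : ColorTree n} (hS : S.Below j) : S.Below k := by
  induction S with
  | leaf => trivial
  | node s l r ihl ihr => exact ⟨hS.1.trans_le h, ihl hS.2.1, ihr hS.2.2⟩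

theorem ConstAt.topWeight_eq {i : Fin n} {m j : ℕ} {S : ColorTree n} (hS : S.ConstAt i m)
    (hB : S.Below j) (hj : j ≤ i.val) : S.topWeight i = m := by
  induction S with
  | leaf => exact hS
  | node s l r ihl ihr =>
    have hne : i ≠ s := fun e => by have := hB.1; subst e; omega
    simp [topWeight, hne, ihl hS.1 hB.2.1]

@[simp] theorem topWeight_node_self (t : Fin n) (l r : ColorTree n) :
    (node t l r).topWeight t = l.topWeight t + 1 := by simp [topWeight]

theorem topWeight_node_of_ne {t i : Fin n} (h : i ≠ t) (l r : ColorTree n) :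
    (node t l r).topWeight i = l.topWeight i := by simp [topWeight, h]

theorem topWeight_le_node (t : Fin n) (l r : ColorTree n) :
    l.topWeight ≤ (node t l r).topWeight := by
  intro i; simp [topWeight]

theorem Core.nonneg {S : ColorTree n} {c : Fin n → ℤ} (h : S.Core c) : 0 ≤ c := by
  induction S generalizing c with
  | leaf => exact h.2.1
  | node s l r ihl ihr => exact ihl h.1

theorem Core.le_topWeight {S : ColorTree n} {c : Fin n → ℤ} (h : S.Core c) (i : Fin n) :
    c i ≤ S.topWeight i := by
  induction S generalizing c with
  | leaf => exact h.2.2.2 i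
  | node s l r ihl ihr =>
    refine (ihl h.1).trans ?_
    exact_mod_cast topWeight_le_node s l r i

theorem Core.below_node {s : Fin n} {l r : ColorTree n} {c : Fin n → ℤ}
    (h : (node s l r).Core c) : (node s l r).Below (s + 1) :=
  ⟨Nat.lt_succ_self _, h.2.2.2.1, h.2.2.2.2.1⟩

theorem Core.pos {S : ColorTree n} {c : Fin n → ℤ} (h : S.Core c) (i : Fin n) :
    0 < S.topWeight i := by
  induction S generalizing c with
  | leaf => exact h.1 i
  | node s l r ihl ihr => exact (ihl h.1).trans_le (topWeight_le_node s l r i)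

theorem Core.one_le {t : Fin n} {l r : ColorTree n} {c : Fin n → ℤ}
    (h : (node t l r).Core c) : 1 ≤ c t := by
  have := h.2.1.nonneg t
  simp at this; exact this

theorem Core.le_left {t : Fin n} {l r : ColorTree n} {c : Fin n → ℤ}
    (h : (node t l r).Core c) : c t ≤ l.topWeight t := h.1.le_topWeight t

/-! ### Sets described by one level -/

theorem InLevel.subset_range {t : Fin n} {S : ColorTree n} {c : Fin n → ℤ} {B : Finset ℕ}
    (hS : S.Core c) (h : S.InLevel t B) : B ⊆ range (S.topWeight t) := by
  induction S generalizing c B with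
  | leaf => exact h
  | node s l r ihl ihr =>
    by_cases hs : s = t
    · subst hs
      simp only [InLevel, if_true] at h
      rw [topWeight_node_self]
      split_ifs at h with hv
      · have h1 := ihr hS.2.1 h
        intro b hb
        by_cases hbv : b = l.topWeight s
        · simp [hbv]
        · have := mem_range.1 (h1 (mem_erase.2 ⟨hbv, hb⟩))
          have : r.topWeight s ≤ l.topWeight s := hS.2.2.1 s
          rw [mem_range]; omega
      · exact (ihl hS.1 h).trans (range_mono (Nat.le_succ _))
    · simpa [InLevel, hs] using h

/-- A full level describes every set of vertices of color `t` below its top weight. -/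
theorem Full.inLevel {t : Fin n} {S : ColorTree n} {c : Fin n → ℤ} {B : Finset ℕ}
    (hS : S.Core c) (hF : S.Full t) (h : B ⊆ range (S.topWeight t)) : S.InLevel t B := by
  induction S generalizing c B with
  | leaf => exact h
  | node s l r ihl ihr =>
    by_cases hs : s = t
    · subst hs
      obtain ⟨h1, h2, h3⟩ := hF rfl
      rw [topWeight_node_self] at h
      simp only [InLevel, if_true]
      split_ifs with hv
      · refine ihr hS.2.1 h2 ?_
        intro b hb
        rw [mem_erase] at hb
        have := mem_range.1 (h hb.2)
        rw [mem_range]; omega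
      · refine ihl hS.1 h1 ?_
        intro b hb
        have := mem_range.1 (h hb)
        have : b ≠ l.topWeight s := fun e => hv (e ▸ hb)
        rw [mem_range]; omega
    · simpa [InLevel, hs] using h

/-- One level describes an initial segment in colex order, in depth-first order of the cells. -/
theorem InLevel.mono {t : Fin n} {S : ColorTree n} {c : Fin n → ℤ} {B B' : Finset ℕ}
    (hS : S.Core c) (h : S.InLevel t B) (hle : toColex B' ≤ toColex B)
    (hc : B'.card = B.card) : S.InLevel t B' ∧ ¬ S.cell t B < S.cell t B' := by
  induction S generalizing c B B' with
  | leaf w => exact ⟨subset_range_of_le hle h, by simp [cell]⟩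
  | node s l r ihl ihr =>
    by_cases hs : s = t
    · subst hs
      have hr := h.subset_range hS
      have hr' := subset_range_of_le hle hr
      have hfull : ∀ C ⊆ range (l.topWeight s + 1), l.topWeight s ∉ C → l.InLevel s C := by
        intro C hC hv
        refine hS.2.2.2.2.2.2.inLevel hS.1 fun b hb => ?_
        have := mem_range.1 (hC hb)
        have : b ≠ l.topWeight s := fun e => hv (e ▸ hb)
        rw [mem_range]; omega
      rw [topWeight_node_self] at hr hr'
      by_cases hv : l.topWeight s ∈ B
      · by_cases hv' : l.topWeight s ∈ B'
        · have h1 := ihr hS.2.1 (B := B.erase (l.topWeight s)) (B' := B'.erase (l.topWeight s))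
            (by simpa [InLevel, hv] using h) (erase_mono_of_mem hv' hv hle)
            (by rw [card_erase_of_mem hv, card_erase_of_mem hv', hc])
          simpa [InLevel, cell, hv, hv', List.cons_lt_cons_iff] using h1
        · simp only [InLevel, cell, hv, hv', if_true, if_false]
          exact ⟨hfull _ hr' hv', by simp [List.cons_lt_cons_iff]⟩
      · have hv' : l.topWeight s ∉ B' := fun hv' => by
          refine absurd hle (not_le.2 (lt_of_subset_range_of_mem (v := l.topWeight s) ?_ hv'))
          intro b hb
          have := mem_range.1 (hr hb)
          have : b ≠ l.topWeight s := fun e => hv (e ▸ hb)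
          rw [mem_range]; omega
        have h1 := ihl hS.1 (B := B) (B' := B') (by simpa [InLevel, hv] using h) hle hc
        simpa [InLevel, cell, hv, hv', List.cons_lt_cons_iff] using h1
    · refine ⟨?_, by simp [cell, hs]⟩
      have h' : B ⊆ range ((node s l r).topWeight t) := by simpa [InLevel, hs] using h
      simpa [InLevel, hs] using subset_range_of_le hle h'

theorem lead_cell {t : Fin n} {S : ColorTree n} (hB : S.Below (t + 1)) (B : Finset ℕ) :
    S.Lead t (S.cell t B) := by
  induction S generalizing B with
  | leaf => rfl
  | node s l r ihl ihr =>
    by_cases hs : s = t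
    · subst hs
      simp only [cell, if_true]
      split_ifs
      · exact ⟨le_rfl, ihr hB.2.2 _⟩
      · exact ⟨le_rfl, ihl hB.2.1 _⟩
    · simp only [cell, hs, if_false, Lead]
      have := hB.1
      have : s.val ≠ t.val := fun e => hs (Fin.ext e)
      omega

theorem subtree_cell (t : Fin n) (S : ColorTree n) (B : Finset ℕ) :
    S.subtree (S.cell t B) = some (S.cellTree t B) := by
  induction S generalizing B with
  | leaf => rfl
  | node s l r ihl ihr =>
    simp only [cell, cellTree]
    split_ifs
    · exact ihr _
    · exact ihl _
    · rfl

theorem cellMax_subset_range {t : Fin n} {S : ColorTree n} {c : Fin n → ℤ} (hS : S.Core c)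
    (hB : S.Below (t + 1)) (k : ℕ) {p : List Bool} (hp : S.Lead t p) :
    S.cellMax t k p ⊆ range (S.topWeight t) := by
  induction S generalizing c k p with
  | leaf w =>
    obtain rfl : p = [] := hp
    intro b hb
    exact mem_range.2 (mem_Ico.1 hb).2
  | node s l r ihl ihr =>
    rcases p with _ | ⟨_ | _, p⟩
    · intro b hb
      exact mem_range.2 (mem_Ico.1 hb).2
    · exact (ihl hS.1 hB.2.1 k hp.2).trans (range_mono (topWeight_le_node s l r t))
    · have hst : s = t := by
        have h1 := hB.1; have h2 := hp.1; exact Fin.ext (by omega)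
      subst hst
      rw [cellMax, topWeight_node_self]
      refine insert_subset (by simp) ((ihr hS.2.1 hB.2.2 _ hp.2).trans (range_mono ?_))
      exact (hS.2.2.1 s).trans (Nat.le_succ _)

/-- The largest set of a cell belongs to that cell. -/
theorem cellMax_spec {t : Fin n} {S : ColorTree n} {c : Fin n → ℤ} (hS : S.Core c)
    (hB : S.Below (t + 1)) {k : ℕ} (hk : c t = k) {p : List Bool} (hp : S.Lead t p) :
    (S.cellMax t k p).card = k ∧ S.InLevel t (S.cellMax t k p) ∧
      S.cell t (S.cellMax t k p) = p := by
  induction S generalizing c k p with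
  | leaf w =>
    obtain rfl : p = [] := hp
    have := hS.2.2.2 t
    refine ⟨?_, ?_, rfl⟩
    · simp [cellMax, topWeight]; omega
    · exact cellMax_subset_range hS hB k (t := t) (p := []) rfl
  | node s l r ihl ihr =>
    rcases p with _ | ⟨_ | _, p⟩
    · have hne : s ≠ t := by rintro rfl; exact lt_irrefl _ hp
      have := hS.le_topWeight t
      refine ⟨?_, ?_, ?_⟩
      · simp [cellMax]; omega
      · simp only [InLevel, hne, if_false]
        exact cellMax_subset_range hS hB k hp
      · simp [cell, hne]
    · have hst : s = t := by
        have h1 := hB.1; have h2 := hp.1; exact Fin.ext (by omega)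
      subst hst
      obtain ⟨h1, h2, h3⟩ := ihl hS.1 hB.2.1 hk hp.2
      have hv : l.topWeight s ∉ l.cellMax s k p := fun h => by
        simpa using h2.subset_range hS.1 h
      refine ⟨h1, ?_, ?_⟩
      · simpa [InLevel, cellMax, hv] using h2
      · simpa [cell, cellMax, hv] using h3
    · have hst : s = t := by
        have h1 := hB.1; have h2 := hp.1; exact Fin.ext (by omega)
      subst hst
      have hk1 := hS.one_le
      obtain ⟨h1, h2, h3⟩ := ihr hS.2.1 hB.2.2 (k := k - 1) (by simp; omega) hp.2
      have hv : l.topWeight s ∉ r.cellMax s (k - 1) p := fun h => by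
        have h4 := mem_range.1 (h2.subset_range hS.2.1 h)
        have h5 : r.topWeight s ≤ l.topWeight s := hS.2.2.1 s
        omega
      refine ⟨?_, ?_, ?_⟩
      · rw [cellMax, card_insert_of_notMem hv, h1]; omega
      · simpa [InLevel, cellMax, erase_insert hv] using h2
      · simpa [cell, cellMax, erase_insert hv] using h3

/-- `cellMax` is the colex largest of the sets in its cell. -/
theorem InLevel.le_cellMax {t : Fin n} {S : ColorTree n} {c : Fin n → ℤ} {B : Finset ℕ}
    (hS : S.Core c) (hB : S.Below (t + 1)) (h : S.InLevel t B) :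
    toColex B ≤ toColex (S.cellMax t B.card (S.cell t B)) := by
  induction S generalizing c B with
  | leaf w => exact le_Ico_of_subset_range h
  | node s l r ihl ihr =>
    by_cases hs : s = t
    · subst hs
      by_cases hv : l.topWeight s ∈ B
      · have h1 := ihr hS.2.1 hB.2.2 (B := B.erase (l.topWeight s)) (by simpa [InLevel, hv] using h)
        simp only [cell, hv, if_true, cellMax]
        rw [card_erase_of_mem hv] at h1
        have hm : l.topWeight s ∉
            r.cellMax s (B.card - 1) (r.cell s (B.erase (l.topWeight s))) := fun hm => by
          have h4 := mem_range.1 (cellMax_subset_range hS.2.1 hB.2.2 _ (lead_cell hB.2.2 _) hm)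
          have h5 : r.topWeight s ≤ l.topWeight s := hS.2.2.1 s
          omega
        have := insert_mono_of_notMem (notMem_erase _ _) hm h1
        rwa [insert_erase hv] at this
      · simpa [cell, cellMax, hv] using
          ihl hS.1 hB.2.1 (B := B) (by simpa [InLevel, hv] using h)
    · have h' : B ⊆ range ((node s l r).topWeight t) := by simpa [InLevel, hs] using h
      simpa [cell, hs, cellMax] using le_Ico_of_subset_range h'

/-- The last cell of a level is reached by right turns only. -/
theorem lead_replicate_topRun {t : Fin n} {S : ColorTree n} (hB : S.Below (t + 1)) :
    S.Lead t (List.replicate (S.topRun t) true) := by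
  induction S with
  | leaf => rfl
  | node s l r ihl ihr =>
    by_cases hs : s = t
    · simp only [topRun, hs, if_true, List.replicate_succ]
      exact ⟨le_rfl, ihr hB.2.2⟩
    · have := hB.1
      have : s.val ≠ t.val := fun e => hs (Fin.ext e)
      simp only [topRun, hs, if_false, List.replicate_zero, Lead]
      omega

/-- The largest set of the last cell is the largest set described by the level. -/
theorem InLevel.le_cellMax_topRun {t : Fin n} {S : ColorTree n} {c : Fin n → ℤ} {B : Finset ℕ}
    (hS : S.Core c) (hB : S.Below (t + 1)) (h : S.InLevel t B) :
    toColex B ≤ toColex (S.cellMax t B.card (List.replicate (S.topRun t) true)) := by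
  induction S generalizing c B with
  | leaf w => exact le_Ico_of_subset_range h
  | node s l r ihl ihr =>
    by_cases hs : s = t
    · subst hs
      simp only [topRun, if_true, List.replicate_succ, cellMax]
      by_cases hv : l.topWeight s ∈ B
      · have h1 := ihr hS.2.1 hB.2.2 (B := B.erase (l.topWeight s)) (by simpa [InLevel, hv] using h)
        rw [card_erase_of_mem hv] at h1
        have hm : l.topWeight s ∉
            r.cellMax s (B.card - 1) (List.replicate (r.topRun s) true) := fun hm => by
          have h4 := mem_range.1
            (cellMax_subset_range hS.2.1 hB.2.2 _ (lead_replicate_topRun hB.2.2) hm)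
          have h5 : r.topWeight s ≤ l.topWeight s := hS.2.2.1 s
          omega
        have := insert_mono_of_notMem (notMem_erase _ _) hm h1
        rwa [insert_erase hv] at this
      · have h1 : l.InLevel s B := by simpa [InLevel, hv] using h
        exact (lt_of_subset_range_of_mem (h1.subset_range hS.1) (mem_insert_self _ _)).le
    · have h' : B ⊆ range ((node s l r).topWeight t) := by simpa [InLevel, hs] using h
      simpa [topRun, hs, cellMax] using le_Ico_of_subset_range h'

/-! ### Tuples described by a tree -/

theorem hasFace_congr {j : ℕ} {S : ColorTree n} (hB : S.Below j) {A A' : Fin n → Finset ℕ}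
    (h : ∀ i : Fin n, i.val < j → A i = A' i) : S.HasFace j A ↔ S.HasFace j A' := by
  induction S generalizing A A' with
  | leaf w => exact forall_congr' fun i => forall_congr' fun hi => by rw [h i hi]
  | node s l r ihl ihr =>
    simp only [HasFace, h s hB.1]
    split_ifs
    · refine ihr hB.2.2 fun i hi => ?_
      by_cases his : i = s
      · subst his; simp
      · simp [his, h i hi]
    · exact ihl hB.2.1 h

theorem hasFace_succ_of_below {t : Fin n} {S : ColorTree n} (hB : S.Below t) {m : ℕ}
    (hC : S.ConstAt t m) {A : Fin n → Finset ℕ} :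
    S.HasFace (t + 1) A ↔ A t ⊆ range m ∧ S.HasFace t A := by
  induction S generalizing A with
  | leaf w =>
    have hC' : w t = m := hC
    simp only [HasFace, Nat.lt_succ_iff_lt_or_eq, or_imp, forall_and]
    rw [and_comm, ← hC']
    refine and_congr ⟨fun h => h t rfl, fun h i hi => ?_⟩ Iff.rfl
    obtain rfl : i = t := Fin.ext hi
    exact h
  | node s l r ihl ihr =>
    have hne : t ≠ s := by rintro rfl; exact lt_irrefl _ hB.1
    simp only [HasFace]
    split_ifs
    · rw [ihr hB.2.2 hC.2]; simp [hne]
    · exact ihl hB.2.1 hC.1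

theorem Core.subtree {S : ColorTree n} {c : Fin n → ℤ} (hS : S.Core c) {p : List Bool}
    {S' : ColorTree n} (h : S.subtree p = some S') : S'.Core (S.split c p) := by
  induction S generalizing c p with
  | leaf w =>
    rcases p with _ | ⟨_, p⟩
    · cases h; exact hS
    · cases h
  | node s l r ihl ihr =>
    rcases p with _ | ⟨_ | _, p⟩
    · cases h; exact hS
    · exact ihl hS.1 h
    · exact ihr hS.2.1 h

theorem Lead.below {j : ℕ} {S S' : ColorTree n} {c : Fin n → ℤ} (hS : S.Core c) {p : List Bool}
    (hp : S.Lead j p) (h : S.subtree p = some S') : S'.Below j := by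
  induction S generalizing c p with
  | leaf w =>
    obtain rfl : p = [] := hp
    cases h; trivial
  | node s l r ihl ihr =>
    rcases p with _ | ⟨_ | _, p⟩
    · cases h; exact hS.below_node.mono hp
    · exact ihl hS.1 hp.2 h
    · exact ihr hS.2.1 hp.2 h

/-- Membership of a tuple is decided level by level. -/
theorem hasFace_succ {t : Fin n} {S : ColorTree n} {c : Fin n → ℤ} (hS : S.Core c)
    (hB : S.Below (t + 1)) {A : Fin n → Finset ℕ} :
    S.HasFace (t + 1) A ↔ S.InLevel t (A t) ∧ (S.cellTree t (A t)).HasFace t A := by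
  induction S generalizing c A with
  | leaf w => exact hasFace_succ_of_below (S := leaf w) trivial rfl
  | node s l r ihl ihr =>
    by_cases hs : s = t
    · subst hs
      simp only [HasFace, InLevel, cellTree, if_true]
      split_ifs
      · rw [ihr hS.2.1 hB.2.2, update_self]
        refine and_congr Iff.rfl ?_
        exact hasFace_congr ((lead_cell hB.2.2 _).below hS.2.1 (subtree_cell _ _ _)) fun i hi => by
          simp [Fin.ne_of_lt hi]
      · exact ihl hS.1 hB.2.1
    · have hlt : s.val < t.val := by
        have := hB.1
        have : s.val ≠ t.val := fun e => hs (Fin.ext e)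
        omega
      obtain ⟨h1, h2⟩ := hS.2.2.2.2.2.1 t hlt
      have hB' : (node s l r).Below t := hS.below_node.mono hlt
      rw [hasFace_succ_of_below hB' ⟨h1, h2⟩]
      simp only [InLevel, cellTree, hs, if_false]
      rw [topWeight_node_of_ne (fun e => hs e.symm)]

end Levels

/-! ### Addresses of vertices -/

section Addresses

variable {n : ℕ}

@[simp] theorem subtree_nil (S : ColorTree n) : S.subtree [] = some S := by cases S <;> rfl

theorem subtree_append (S : ColorTree n) (p q : List Bool) :
    S.subtree (p ++ q) = (S.subtree p).bind fun S' => S'.subtree q := by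
  induction S generalizing p with
  | leaf w =>
    rcases p with _ | ⟨_, p⟩ <;> rfl
  | node s l r ihl ihr =>
    rcases p with _ | ⟨_ | _, p⟩
    · rfl
    · exact ihl p
    · exact ihr p

theorem subtree_append_of_eq {S S' : ColorTree n} {p : List Bool} (h : S.subtree p = some S')
    (q : List Bool) : S.subtree (p ++ q) = S'.subtree q := by
  rw [subtree_append, h]; rfl

theorem split_append {S S' : ColorTree n} {p : List Bool} (h : S.subtree p = some S')
    (c : Fin n → ℤ) (q : List Bool) : S.split c (p ++ q) = S'.split (S.split c p) q := by
  induction S generalizing p c with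
  | leaf w =>
    rcases p with _ | ⟨_, p⟩
    · cases h; rfl
    · cases h
  | node s l r ihl ihr =>
    rcases p with _ | ⟨_ | _, p⟩
    · cases h; rfl
    · exact ihl h c
    · exact ihr h _

theorem mem_verts {S : ColorTree n} {p : List Bool} :
    p ∈ S.verts ↔ ∃ S', S.subtree p = some S' := by
  induction S generalizing p with
  | leaf w =>
    rcases p with _ | ⟨_, p⟩ <;> simp [verts, subtree]
  | node s l r ihl ihr =>
    rcases p with _ | ⟨_ | _, p⟩
    · simp [verts, subtree]
    · simp [verts, subtree, ihl]
    · simp [verts, subtree, ihr]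

theorem mem_leaves {S : ColorTree n} {p : List Bool} :
    p ∈ S.leaves ↔ ∃ w, S.subtree p = some (leaf w) := by
  induction S generalizing p with
  | leaf w =>
    rcases p with _ | ⟨_, p⟩ <;> simp [leaves, subtree]
  | node s l r ihl ihr =>
    rcases p with _ | ⟨_ | _, p⟩
    · simp [leaves, subtree]
    · simp [leaves, subtree, ihl]
    · simp [leaves, subtree, ihr]

theorem verts_sorted (S : ColorTree n) : S.verts.Pairwise (· < ·) := by
  induction S with
  | leaf w => simp [verts]
  | node s l r ihl ihr =>
    rw [verts, List.pairwise_cons, List.pairwise_append]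
    refine ⟨fun a ha => ?_, ?_, ?_, ?_⟩
    · rcases a with _ | ⟨_, a⟩
      · simp at ha
      · exact List.Lex.nil
    · rw [List.pairwise_map]
      exact ihl.imp fun h => by simpa [List.cons_lt_cons_iff] using h
    · rw [List.pairwise_map]
      exact ihr.imp fun h => by simpa [List.cons_lt_cons_iff] using h
    · intro a ha b hb
      simp only [List.mem_map] at ha hb
      obtain ⟨a, -, rfl⟩ := ha
      obtain ⟨b, -, rfl⟩ := hb
      simp [List.cons_lt_cons_iff]

theorem leading_sorted (S : ColorTree n) (j : ℕ) : (S.leading j).Pairwise (· < ·) :=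
  S.verts_sorted.filter _

theorem subtree_eq_some_of_prefix {S S' : ColorTree n} {p q : List Bool}
    (h : S.subtree q = some S') (hpq : p <+: q) : ∃ S'', S.subtree p = some S'' := by
  obtain ⟨r, rfl⟩ := hpq
  rw [subtree_append] at h
  rcases hp : S.subtree p with _ | S''
  · rw [hp] at h; cases h
  · exact ⟨_, rfl⟩

theorem label_eq_some {S : ColorTree n} {p : List Bool} {t : Fin n} :
    S.label p = some t ↔ ∃ l r, S.subtree p = some (node t l r) := by
  rw [label]
  rcases S.subtree p with _ | ⟨w⟩ | ⟨t', l, r⟩ <;> simp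

theorem label_append {S S' : ColorTree n} {p : List Bool} (h : S.subtree p = some S')
    (q : List Bool) : S.label (p ++ q) = S'.label q := by
  rw [label, label, subtree_append_of_eq h]

theorem leftWeight_of_subtree {S S' : ColorTree n} {p : List Bool} (h : S.subtree p = some S') :
    S.leftWeight p = S'.topWeight := by rw [leftWeight, h]

theorem leftWeight_append {S S' : ColorTree n} {p : List Bool} (h : S.subtree p = some S')
    (q : List Bool) : S.leftWeight (p ++ q) = S'.leftWeight q := by
  rw [leftWeight, leftWeight, subtree_append_of_eq h]

theorem Below.label_lt {j : ℕ} {S : ColorTree n} (hS : S.Below j) {p : List Bool} {t : Fin n}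
    (h : S.label p = some t) : t.val < j := by
  induction S generalizing p with
  | leaf w =>
    rcases p with _ | ⟨_, p⟩ <;> simp [label, subtree] at h
  | node s l r ihl ihr =>
    rcases p with _ | ⟨_ | _, p⟩
    · simp [label, subtree] at h; exact h ▸ hS.1
    · exact ihl hS.2.1 h
    · exact ihr hS.2.2 h

theorem Lead.subtree {j : ℕ} {S : ColorTree n} {p : List Bool} (h : S.Lead j p) :
    ∃ S', S.subtree p = some S' := by
  induction S generalizing p with
  | leaf w => obtain rfl : p = [] := h; exact ⟨_, rfl⟩
  | node s l r ihl ihr =>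
    rcases p with _ | ⟨_ | _, p⟩
    · exact ⟨_, rfl⟩
    · exact ihl h.2
    · exact ihr h.2

theorem Below.lead_iff {j : ℕ} {S : ColorTree n} (hS : S.Below j) {p : List Bool} :
    S.Lead j p ↔ p = [] := by
  rcases S with w | ⟨s, l, r⟩
  · rfl
  · have := hS.1
    rcases p with _ | ⟨_ | _, p⟩ <;> simp [Lead] <;> omega

/-- In a tree with the local properties labels do not increase downwards, so the definition of
leading vertices through labels of parents agrees with `Lead`. -/
theorem mem_leading {j : ℕ} {S : ColorTree n} {c : Fin n → ℤ} (hS : S.Core c) {p : List Bool} :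
    p ∈ S.leading j ↔ S.Lead j p := by
  rw [leading, List.mem_filter]
  simp only [Bool.decide_and, Bool.and_eq_true, decide_eq_true_eq]
  induction S generalizing c p with
  | leaf w =>
    rcases p with _ | ⟨_, p⟩ <;> simp [verts, Lead, label, subtree]
  | node s l r ihl ihr =>
    have key : ∀ (S' : ColorTree n) (b : Bool), S'.Below (s + 1) →
        (∀ q, (node s l r).subtree (b :: q) = S'.subtree q) → ∀ q,
        (q ∈ S'.verts ∧ (∀ s', S'.label q = some s' → s'.val < j) ∧
          (q ≠ [] → ∀ s', S'.label q.dropLast = some s' → j ≤ s'.val) ↔ S'.Lead j q) →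
        ((b :: q) ∈ (node s l r).verts ∧
          (∀ s', (node s l r).label (b :: q) = some s' → s'.val < j) ∧
          ((b :: q) ≠ [] → ∀ s', (node s l r).label (b :: q).dropLast = some s' → j ≤ s'.val) ↔
          j ≤ s.val ∧ S'.Lead j q) := by
      intro S' b hB hsub q hq
      rw [mem_verts, hsub, ← mem_verts, ← hq]
      have hlab : ∀ q, (node s l r).label (b :: q) = S'.label q := fun q => by
        rw [label, label, hsub]
      rw [hlab]
      rcases q with _ | ⟨b', q⟩
      · simp [label]
        tauto
      · rw [List.dropLast_cons_of_ne_nil (by simp), hlab]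
        constructor
        · rintro ⟨h1, h2, h3⟩
          refine ⟨?_, h1, h2, fun h => h3 (by simp)⟩
          obtain ⟨S'', hS''⟩ := mem_verts.1 h1
          obtain ⟨S₃, hS₃⟩ := subtree_eq_some_of_prefix hS'' (List.dropLast_prefix _)
          rcases S₃ with w | ⟨s', l', r'⟩
          · exfalso
            have h4 := List.dropLast_append_getLast (l := b' :: q) (by simp)
            rw [← h4, subtree_append_of_eq hS₃] at hS''
            cases hS''
          · have hs' := label_eq_some.2 ⟨l', r', hS₃⟩
            have h5 := h3 (by simp) s' hs'
            have h6 := hB.label_lt hs'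
            omega
        · rintro ⟨h0, h1, h2, h3⟩
          exact ⟨h1, h2, fun _ => h3 (by simp)⟩
    rcases p with _ | ⟨_ | _, p⟩
    · simp [verts, Lead, label, subtree]
    · exact key l false hS.2.2.2.1 (fun q => rfl) p (ihl hS.1)
    · exact key r true hS.2.2.2.2.1 (fun q => rfl) p (ihr hS.2.1)

theorem Lead.append {i j : ℕ} (hij : i ≤ j) {S S' : ColorTree n} {p q : List Bool}
    (hp : S.Lead j p) (h : S.subtree p = some S') (hq : S'.Lead i q) : S.Lead i (p ++ q) := by
  induction S generalizing p with
  | leaf w =>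
    obtain rfl : p = [] := hp
    cases h; exact hq
  | node s l r ihl ihr =>
    rcases p with _ | ⟨_ | _, p⟩
    · cases h; exact hq
    · exact ⟨hij.trans hp.1, ihl hp.2 h⟩
    · exact ⟨hij.trans hp.1, ihr hp.2 h⟩

theorem Lead.exists_prefix {i j : ℕ} (hij : i ≤ j) {S : ColorTree n} {x : List Bool}
    (hx : S.Lead i x) : ∃ p q S', x = p ++ q ∧ S.Lead j p ∧ S.subtree p = some S' ∧
      S'.Lead i q := by
  induction S generalizing x with
  | leaf w =>
    obtain rfl : x = [] := hx
    exact ⟨[], [], _, rfl, rfl, rfl, rfl⟩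
  | node s l r ihl ihr =>
    by_cases hs : s.val < j
    · exact ⟨[], x, _, rfl, hs, rfl, hx⟩
    rcases x with _ | ⟨_ | _, x⟩
    · exact absurd (lt_of_lt_of_le hx hij) hs
    · obtain ⟨p, q, S', rfl, h1, h2, h3⟩ := ihl hx.2
      exact ⟨false :: p, q, S', rfl, ⟨not_lt.1 hs, h1⟩, h2, h3⟩
    · obtain ⟨p, q, S', rfl, h1, h2, h3⟩ := ihr hx.2
      exact ⟨true :: p, q, S', rfl, ⟨not_lt.1 hs, h1⟩, h2, h3⟩

/-- Leading vertices of the same kind are not ancestors of one another. -/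
theorem Lead.eq_of_prefix {j : ℕ} {S : ColorTree n} {p q : List Bool} (hp : S.Lead j p)
    (hq : S.Lead j q) (h : p <+: q) : p = q := by
  induction S generalizing p q with
  | leaf w =>
    obtain rfl : p = [] := hp
    obtain rfl : q = [] := hq
    rfl
  | node s l r ihl ihr =>
    rcases p with _ | ⟨b, p⟩
    · rcases q with _ | ⟨_ | _, q⟩
      · rfl
      · exact absurd hp (not_lt.2 hq.1)
      · exact absurd hp (not_lt.2 hq.1)
    · rcases q with _ | ⟨b', q⟩
      · simp at h
      · rw [List.cons_prefix_cons] at h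
        obtain ⟨rfl, h⟩ := h
        cases b
        · rw [ihl hp.2 hq.2 h]
        · rw [ihr hp.2 hq.2 h]

theorem Lead.eq_of_prefix_of_prefix {j : ℕ} {S : ColorTree n} {p q x : List Bool}
    (hp : S.Lead j p) (hq : S.Lead j q) (h : p <+: x) (h' : q <+: x) : p = q := by
  rcases List.prefix_or_prefix_of_prefix h h' with h | h
  · exact hp.eq_of_prefix hq h
  · exact (hq.eq_of_prefix hp h).symm

theorem prefix_of_between {x p q z : List Bool} (h1 : ¬ z < x ++ p) (h2 : z < x ++ q) :
    x <+: z := by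
  induction x generalizing z with
  | nil => exact List.nil_prefix
  | cons b x ih =>
    rcases z with _ | ⟨b', z⟩
    · exact absurd List.Lex.nil h1
    · rw [List.cons_append, List.cons_lt_cons_iff] at h1 h2
      rw [List.cons_prefix_cons]
      rcases h2 with h2 | ⟨rfl, h2⟩
      · exact absurd (Or.inl h2) h1
      · exact ⟨rfl, ih (fun h => h1 (Or.inr ⟨rfl, h⟩)) h2⟩

theorem append_lt_append_iff {x p q : List Bool} : x ++ p < x ++ q ↔ p < q := by
  induction x with
  | nil => rfl
  | cons b x ih => simp [ih]

end Addresses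

/-! ### Splitting labels and signatures of leading vertices -/

section Signatures

variable {n : ℕ}

theorem Lead.split_eq {j : ℕ} {S : ColorTree n} {p : List Bool} (hp : S.Lead j p)
    (c : Fin n → ℤ) {i : Fin n} (hi : i.val < j) : S.split c p i = c i := by
  induction S generalizing p c with
  | leaf w => obtain rfl : p = [] := hp; rfl
  | node s l r ihl ihr =>
    rcases p with _ | ⟨_ | _, p⟩
    · rfl
    · exact ihl hp.2 c
    · have hne : i ≠ s := by
        rintro rfl
        have := hp.1
        omega
      have := ihr hp.2 (c - Pi.single s 1)
      simpa [split, hne] using this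

theorem Below.split_eq {j : ℕ} {S : ColorTree n} (hS : S.Below j) (p : List Bool)
    (c : Fin n → ℤ) {i : Fin n} (hi : j ≤ i.val) : S.split c p i = c i := by
  induction S generalizing p c with
  | leaf w => rcases p with _ | ⟨_, p⟩ <;> rfl
  | node s l r ihl ihr =>
    rcases p with _ | ⟨_ | _, p⟩
    · rfl
    · exact ihl hS.2.1 p c
    · have hne : i ≠ s := by
        rintro rfl
        have := hS.1
        omega
      have := ihr hS.2.2 p (c - Pi.single s 1)
      simpa [split, hne] using this

/-- Inside a level of color `t`, the splitting label in color `t` drops by the number of right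
turns. -/
theorem Lead.split_self {t : Fin n} {S : ColorTree n} (hB : S.Below (t + 1)) {p : List Bool}
    (hp : S.Lead t p) (c : Fin n → ℤ) : S.split c p t = c t - p.count true := by
  induction S generalizing p c with
  | leaf w => obtain rfl : p = [] := hp; simp [split]
  | node s l r ihl ihr =>
    rcases p with _ | ⟨_ | _, p⟩
    · simp [split]
    · simpa [split] using ihl hB.2.1 hp.2 c
    · have hst : s = t := by
        have h1 := hB.1; have h2 := hp.1; exact Fin.ext (by omega)
      subst hst
      have := ihr hB.2.2 hp.2 (c - Pi.single s 1)
      simp [split, this]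
      ring

theorem mem_psi {S : ColorTree n} {t : Fin n} {x : List Bool} {k : ℕ} :
    k ∈ S.psi t x ↔ ∃ v l r, S.subtree v = some (node t l r) ∧ v ++ [true] <+: x ∧
      l.topWeight t + 1 = k := by
  simp only [psi, List.mem_toFinset, List.mem_map, List.mem_filter, decide_eq_true_eq,
    Bool.decide_and, Bool.and_eq_true]
  constructor
  · rintro ⟨v, ⟨-, hv, hx⟩, hk⟩
    obtain ⟨l, r, h⟩ := label_eq_some.1 hv
    exact ⟨v, l, r, h, hx, by rw [← hk, leftWeight_of_subtree h, topWeight_node_self]⟩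
  · rintro ⟨v, l, r, h, hx, hk⟩
    exact ⟨v, ⟨mem_verts.2 ⟨_, h⟩, label_eq_some.2 ⟨l, r, h⟩, hx⟩,
      by rw [leftWeight_of_subtree h, topWeight_node_self, hk]⟩

theorem psi_nil (S : ColorTree n) (t : Fin n) : S.psi t [] = ∅ := by
  ext k
  simp [mem_psi]

theorem psi_node_false (s t : Fin n) (l r : ColorTree n) (p : List Bool) :
    (node s l r).psi t (false :: p) = l.psi t p := by
  ext k
  rw [mem_psi, mem_psi]
  constructor
  · rintro ⟨_ | ⟨_ | _, v⟩, l', r', h, hx, hk⟩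
    · simp at hx
    · exact ⟨v, l', r', h, by simpa using hx, hk⟩
    · simp at hx
  · rintro ⟨v, l', r', h, hx, hk⟩
    exact ⟨false :: v, l', r', h, by simpa using hx, hk⟩

theorem psi_node_true_self (t : Fin n) (l r : ColorTree n) (p : List Bool) :
    (node t l r).psi t (true :: p) = insert (l.topWeight t + 1) (r.psi t p) := by
  ext k
  rw [mem_insert, mem_psi, mem_psi]
  constructor
  · rintro ⟨_ | ⟨_ | _, v⟩, l', r', h, hx, hk⟩
    · cases h; exact Or.inl hk.symm
    · simp at hx
    · exact Or.inr ⟨v, l', r', h, by simpa using hx, hk⟩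
  · rintro (rfl | ⟨v, l', r', h, hx, hk⟩)
    · exact ⟨[], l, r, rfl, by simp, rfl⟩
    · exact ⟨true :: v, l', r', h, by simpa using hx, hk⟩

theorem psi_node_true_of_ne {s t : Fin n} (hst : s ≠ t) (l r : ColorTree n) (p : List Bool) :
    (node s l r).psi t (true :: p) = r.psi t p := by
  ext k
  rw [mem_psi, mem_psi]
  constructor
  · rintro ⟨_ | ⟨_ | _, v⟩, l', r', h, hx, hk⟩
    · cases h; exact absurd rfl hst
    · simp at hx
    · exact ⟨v, l', r', h, by simpa using hx, hk⟩
  · rintro ⟨v, l', r', h, hx, hk⟩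
    exact ⟨true :: v, l', r', h, by simpa using hx, hk⟩

/-- Only splittings inside the level of color `t` containing the vertex contribute to `psi`. -/
theorem psi_append_of_lead {t : Fin n} {S S' : ColorTree n} {p : List Bool}
    (hp : S.Lead (t + 1) p) (h : S.subtree p = some S') (q : List Bool) :
    S.psi t (p ++ q) = S'.psi t q := by
  induction S generalizing p with
  | leaf w => obtain rfl : p = [] := hp; cases h; rfl
  | node s l r ihl ihr =>
    rcases p with _ | ⟨_ | _, p⟩
    · cases h; rfl
    · rw [List.cons_append, psi_node_false]
      exact ihl hp.2 h
    · have hne : s ≠ t := by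
        rintro rfl
        have := hp.1
        omega
      rw [List.cons_append, psi_node_true_of_ne hne]
      exact ihr hp.2 h

/-- The signature at the end of a level is the largest set of the corresponding cell; the
elements `1, 2, …` of a class correspond to `0, 1, …` here. -/
theorem psi_union_Ioc {t : Fin n} {S S' : ColorTree n} {c : Fin n → ℤ} (hS : S.Core c)
    (hB : S.Below (t + 1)) {k : ℕ} (hk : c t = k) {p : List Bool} (hp : S.Lead t p)
    (h : S.subtree p = some S') :
    (S.psi t p).card = p.count true ∧
      S.psi t p ∪ Ioc (S'.topWeight t - (k - (S.psi t p).card)) (S'.topWeight t) =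
        (S.cellMax t k p).image Nat.succ := by
  have hnil : ∀ (S : ColorTree n) (k : ℕ),
      S.psi t [] ∪ Ioc (S.topWeight t - (k - (S.psi t []).card)) (S.topWeight t) =
        (S.cellMax t k []).image Nat.succ := by
    intro S k
    ext m
    rw [psi_nil]
    rcases m with _ | m
    · simp
    · simp [cellMax]
  induction S generalizing c k p with
  | leaf w =>
    obtain rfl : p = [] := hp
    cases h
    exact ⟨by simp [psi_nil], hnil _ k⟩
  | node s l r ihl ihr =>
    rcases p with _ | ⟨_ | _, p⟩
    · cases h
      exact ⟨by simp [psi_nil], hnil _ k⟩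
    · rw [psi_node_false]
      simpa [cellMax] using ihl hS.1 hB.2.1 hk hp.2 h
    · have hst : s = t := by
        have h1 := hB.1; have h2 := hp.1; exact Fin.ext (by omega)
      subst hst
      have hk1 := hS.one_le
      obtain ⟨h1, h2⟩ := ihr hS.2.1 hB.2.2 (k := k - 1) (by simp; omega) hp.2 h
      have hlt : l.topWeight s + 1 ∉ r.psi s p := fun hm => by
        have h3 : l.topWeight s + 1 ∈ (r.cellMax s (k - 1) p).image Nat.succ := by
          rw [← h2]; exact mem_union_left _ hm
        obtain ⟨m, hm1, hm2⟩ := mem_image.1 h3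
        have h4 := mem_range.1 (cellMax_subset_range hS.2.1 hB.2.2 _ hp.2 hm1)
        have h5 : r.topWeight s ≤ l.topWeight s := hS.2.2.1 s
        have : m = l.topWeight s := Nat.succ_injective hm2
        omega
      rw [psi_node_true_self, card_insert_of_notMem hlt, h1]
      refine ⟨by simp, ?_⟩
      rw [cellMax, image_insert, ← h2, h1, insert_union, Nat.succ_eq_add_one]
      congr 4
      omega

theorem psi_replicate_topRun {t : Fin n} {S : ColorTree n} (hB : S.Below (t + 1)) :
    S.psi t (List.replicate (S.topRun t) true) =
      (range (S.topRun t)).image fun i => S.leftWeight (List.replicate i true) t := by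
  induction S with
  | leaf w => simp [topRun, psi_nil]
  | node s l r ihl ihr =>
    by_cases hs : s = t
    · subst hs
      simp only [topRun, if_true, List.replicate_succ]
      rw [psi_node_true_self, ihr hB.2.2]
      ext k
      simp only [mem_insert, mem_image, mem_range]
      constructor
      · rintro (rfl | ⟨i, hi, rfl⟩)
        · exact ⟨0, Nat.succ_pos _, by simp [leftWeight]⟩
        · exact ⟨i + 1, by omega, rfl⟩
      · rintro ⟨_ | i, hi, rfl⟩
        · left; simp [leftWeight]
        · exact Or.inr ⟨i, by omega, rfl⟩
    · simp [topRun, hs, psi_nil]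

theorem Below.topRun_eq_zero {t : Fin n} {S : ColorTree n} (hB : S.Below t) : S.topRun t = 0 := by
  rcases S with w | ⟨s, l, r⟩
  · rfl
  · have hs : s ≠ t := by rintro rfl; exact lt_irrefl _ hB.1
    simp [topRun, hs]

theorem run_of_subtree {T S : ColorTree n} {x : List Bool} (h : T.subtree x = some S)
    (t : Fin n) : T.run t x = S.topRun t := by rw [run, h]

section

variable {T S : ColorTree n} {a : Fin n → ℕ} {t : Fin n} {X : List Bool}

theorem Core.subtree_lead (hT : T.Core fun i => (a i : ℤ)) {j : ℕ} (hX : T.Lead j X)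
    (hS : T.subtree X = some S) : ∃ c, S.Core c ∧ ∀ i : Fin n, i.val < j → c i = a i :=
  ⟨_, hT.subtree hS, fun _ hi => hX.split_eq _ hi⟩

/-- The signature of a cell is the largest set of that cell, shifted by one. -/
theorem signature_of_lead (hT : T.Core fun i => (a i : ℤ)) (hX : T.Lead (t + 1) X)
    (hS : T.subtree X = some S) {p : List Bool} (hp : S.Lead t p) :
    T.signature a t (X ++ p) = (S.cellMax t (a t) p).image Nat.succ := by
  obtain ⟨c, hc, hca⟩ := hT.subtree_lead hX hS
  have hB := hX.below hT hS
  obtain ⟨S', hS'⟩ := hp.subtree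
  have hx : T.subtree (X ++ p) = some S' := by rw [subtree_append_of_eq hS, hS']
  have hrun : T.run t (X ++ p) = 0 := by
    rw [run_of_subtree hx, (hp.below hc hS').topRun_eq_zero]
  rw [signature, runEnd, hrun, psi_append_of_lead hX hS]
  have := (psi_union_Ioc hc hB (hca t (Nat.lt_succ_self _)) hp hS').2
  simpa [leftWeight_of_subtree hx] using this

/-- The signature at the beginning of a level is the largest set described by the level. -/
theorem signature_of_lead_succ (hT : T.Core fun i => (a i : ℤ)) (hX : T.Lead (t + 1) X)
    (hS : T.subtree X = some S) :
    T.signature a t X =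
      (S.cellMax t (a t) (List.replicate (S.topRun t) true)).image Nat.succ := by
  obtain ⟨c, hc, hca⟩ := hT.subtree_lead hX hS
  have hB := hX.below hT hS
  have hp := lead_replicate_topRun hB
  obtain ⟨S', hS'⟩ := hp.subtree
  have hx : T.subtree (X ++ List.replicate (S.topRun t) true) = some S' := by
    rw [subtree_append_of_eq hS, hS']
  obtain ⟨h1, h2⟩ := psi_union_Ioc hc hB (hca t (Nat.lt_succ_self _)) hp hS'
  have hpsi : T.psi t X = ∅ := by
    have := psi_append_of_lead hX hS []
    rwa [List.append_nil, psi_nil] at this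
  rw [← h2, h1, psi_replicate_topRun hB, signature, runEnd, run_of_subtree hS, hpsi,
    leftWeight_of_subtree hx]
  simp only [empty_union, card_empty, Nat.sub_zero, List.count_replicate_self,
    leftWeight_append hS]

end

/-! ### The vertices compared by the compatibility condition -/

theorem getLast?_takeWhile_ne {L : List (List Bool)} (hL : L.Pairwise (· < ·)) {x z : List Bool}
    (hx : x ∈ L) :
    (L.takeWhile fun z => z ≠ x).getLast? = some z ↔
      z ∈ L ∧ z < x ∧ ∀ y ∈ L, y < x → ¬ z < y := by
  obtain ⟨L₁, L₂, rfl⟩ := List.append_of_mem hx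
  rw [List.pairwise_append, List.pairwise_cons] at hL
  obtain ⟨h1, ⟨h2, h3⟩, h4⟩ := hL
  have hlt : ∀ y ∈ L₁, y < x := fun y hy => h4 y hy x (by simp)
  have htw : ((L₁ ++ x :: L₂).takeWhile fun z => z ≠ x) = L₁ := by
    rw [List.takeWhile_append_of_pos (fun y hy => by simpa using (hlt y hy).ne)]
    simp
  rw [htw]
  have hmem : ∀ y, (y ∈ L₁ ++ x :: L₂ ∧ y < x) ↔ y ∈ L₁ := by
    intro y
    constructor
    · rintro ⟨hy, hyx⟩
      rcases List.mem_append.1 hy with hy | hy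
      · exact hy
      · rcases List.mem_cons.1 hy with rfl | hy
        · exact absurd hyx (lt_irrefl _)
        · exact absurd hyx (h2 y hy).asymm
    · exact fun hy => ⟨List.mem_append_left _ hy, hlt y hy⟩
  rw [← and_assoc, hmem]
  have : (∀ y ∈ L₁ ++ x :: L₂, y < x → ¬ z < y) ↔ ∀ y ∈ L₁, ¬ z < y := by
    refine ⟨fun h y hy => h y ((hmem y).2 hy).1 ((hmem y).2 hy).2,
      fun h y hy hyx => h y ((hmem y).1 ⟨hy, hyx⟩)⟩
  rw [this]
  rcases List.eq_nil_or_concat L₁ with rfl | ⟨L₀, b, rfl⟩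
  · simp
  · rw [List.concat_eq_append, List.getLast?_append, List.pairwise_append] at *
    simp only [List.getLast?_singleton, Option.some_or, Option.some.injEq]
    have hb := h1.2.2
    constructor
    · rintro rfl
      refine ⟨by simp, fun y hy => ?_⟩
      rcases List.mem_append.1 hy with hy | hy
      · exact (hb y hy b (by simp)).asymm
      · rw [List.mem_singleton.1 hy]; exact lt_irrefl _
    · rintro ⟨hz, hz'⟩
      rcases List.mem_append.1 hz with hz | hz
      · exact absurd (hb z hz b (by simp)) (hz' b (by simp))
      · exact (List.mem_singleton.1 hz).symm

theorem find?_eq_some_of_sorted {L : List (List Bool)} (hL : L.Pairwise (· < ·))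
    {P : List Bool → Bool} {z : List Bool} (h : L.find? P = some z) :
    z ∈ L ∧ P z ∧ ∀ y ∈ L, P y → ¬ y < z := by
  obtain ⟨hz, L₁, L₂, rfl, hL₁⟩ := List.find?_eq_some_iff_append.1 h
  refine ⟨by simp, hz, fun y hy hPy hlt => ?_⟩
  rw [List.pairwise_append, List.pairwise_cons] at hL
  rcases List.mem_append.1 hy with hy | hy
  · have := hL₁ y hy
    simp [hPy] at this
  · rcases List.mem_cons.1 hy with rfl | hy
    · exact lt_irrefl _ hlt
    · exact (hL.2.1.1 y hy).asymm hlt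

section

variable {T S : ColorTree n} {a : Fin n → ℕ} {X : List Bool}

/-- The start of the recursion for `ζ`: the preceding leading vertex. -/
theorem zeta_zero (hT : T.Core fun i => (a i : ℤ)) {i : Fin n} {x z : List Bool}
    (hx : T.Lead i x) :
    T.zeta a i 0 x = some z ↔ T.Lead i z ∧ z < x ∧ ∀ y, T.Lead i y → y < x → ¬ z < y := by
  rw [zeta, getLast?_takeWhile_ne (T.leading_sorted _) ((mem_leading hT).2 hx)]
  simp only [mem_leading hT]

/-- One descent step in the definition of `ζ`: below the vertex `Y` found one level up, `ζ` is the
first cell of `Y` whose largest set is at least that of the cell of `x`. -/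
theorem zeta_succ (hT : T.Core fun i => (a i : ℤ)) {i t : Fin n} {d : ℕ} (hd : t.val + (d + 1) = i)
    {p Y : List Bool} (hX : T.Lead (t + 1) X) (hS : T.subtree X = some S) (hp : S.Lead t p)
    (hY : T.zeta a i d X = some Y) (hYlead : T.Lead (t + 1) Y) {S' : ColorTree n}
    (hS' : T.subtree Y = some S')
    (hex : ∃ q, S'.Lead t q ∧
      toColex (S.cellMax t (a t) p) ≤ toColex (S'.cellMax t (a t) q)) :
    ∃ q, T.zeta a i (d + 1) (X ++ p) = some (Y ++ q) ∧ S'.Lead t q ∧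
      toColex (S.cellMax t (a t) p) ≤ toColex (S'.cellMax t (a t) q) ∧
      ∀ q', S'.Lead t q' → q' < q →
        ¬ toColex (S.cellMax t (a t) p) ≤ toColex (S'.cellMax t (a t) q') := by
  have hsucc : StrictMono Nat.succ := fun _ _ h => Nat.succ_lt_succ h
  have hit : i.val - (d + 1) = t.val := by omega
  have hit' : i.val - d = t.val + 1 := by omega
  have ht : (⟨i.val - (d + 1), lt_of_le_of_lt (Nat.sub_le _ _) i.isLt⟩ : Fin n) = t :=
    Fin.ext hit
  have hx : T.Lead t (X ++ p) := hX.append (Nat.le_succ _) hS hp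
  have hfind : ((T.leading (i.val - d)).find? fun x' => decide (x' <+: X ++ p)) = some X := by
    rcases hf : (T.leading (i.val - d)).find? fun x' => decide (x' <+: X ++ p) with _ | X'
    · rw [List.find?_eq_none] at hf
      have := hf X (by rw [hit', mem_leading hT]; exact hX)
      simp at this
    · obtain ⟨h1, h2, -⟩ := find?_eq_some_of_sorted (T.leading_sorted _) hf
      rw [hit', mem_leading hT] at h1
      rw [h1.eq_of_prefix_of_prefix hX (by simpa using h2) (List.prefix_append _ _)]
  have hzeta : T.zeta a i (d + 1) (X ++ p) = (T.leading t.val).find? fun z =>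
      Y <+: z ∧ toColex (T.signature a t (X ++ p)) ≤ toColex (T.signature a t z) := by
    rw [zeta, hfind, Option.bind_some, hY, Option.bind_some]
    simp only [ht]
    rw [hit]
  have hsig : ∀ q, S'.Lead t q →
      (toColex (T.signature a t (X ++ p)) ≤ toColex (T.signature a t (Y ++ q)) ↔
        toColex (S.cellMax t (a t) p) ≤ toColex (S'.cellMax t (a t) q)) := fun q hq => by
    rw [signature_of_lead hT hX hS hp, signature_of_lead hT hYlead hS' hq,
      toColex_image_le_toColex_image hsucc]
  have hmem : ∀ q, S'.Lead t q → Y ++ q ∈ T.leading t.val := fun q hq =>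
    (mem_leading hT).2 (hYlead.append (Nat.le_succ _) hS' hq)
  rcases hf : T.zeta a i (d + 1) (X ++ p) with _ | z
  · exfalso
    rw [hzeta, List.find?_eq_none] at hf
    obtain ⟨q, hq, hq'⟩ := hex
    refine hf _ (hmem q hq) ?_
    rw [decide_eq_true_eq]
    exact ⟨List.prefix_append _ _, (hsig q hq).2 hq'⟩
  · rw [hzeta] at hf
    obtain ⟨h1, h2, h3⟩ := find?_eq_some_of_sorted (T.leading_sorted _) hf
    rw [decide_eq_true_eq] at h2
    rw [mem_leading hT] at h1
    obtain ⟨Y', q, S₁, rfl, hY', hS₁, hq⟩ := h1.exists_prefix (Nat.le_succ t.val)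
    obtain rfl := hY'.eq_of_prefix_of_prefix hYlead (List.prefix_append _ _) h2.1
    obtain rfl : S₁ = S' := Option.some.inj (hS₁.symm.trans hS')
    refine ⟨q, rfl, hq, (hsig q hq).1 h2.2, fun q' hq' hlt hle => ?_⟩
    refine h3 (Y' ++ q') (hmem q' hq') ?_ (append_lt_append_iff.2 hlt)
    rw [decide_eq_true_eq]
    exact ⟨List.prefix_append _ _, (hsig q' hq').2 hle⟩

end

end Signatures

/-! ### Compatibility means that families decrease along every level -/

section Compatibility

variable {n : ℕ}

/-- The tuple `A`, restricted to the first `j` colors, is described by the subtree at `x`. -/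
def FaceAt (T : ColorTree n) (j : ℕ) (x : List Bool) (A : Fin n → Finset ℕ) : Prop :=
  ∃ S, T.subtree x = some S ∧ S.HasFace j A

/-- Every tuple of type `a` in the first `j` colors described at `x` is described at `z`. -/
def FacesLE (T : ColorTree n) (a : Fin n → ℕ) (j : ℕ) (x z : List Bool) : Prop :=
  ∀ A : Fin n → Finset ℕ, (∀ i : Fin n, i.val < j → (A i).card = a i) →
    T.FaceAt j x A → T.FaceAt j z A

/-- The tuples of type `a` described by `T` are closed under replacing one entry by an earlier
set in colex order. -/
def IsDown (T : ColorTree n) (c : Fin n → ℤ) : Prop :=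
  ∀ A : Fin n → Finset ℕ, (∀ i, ((A i).card : ℤ) = c i) → T.HasFace n A → ∀ i B,
    B.card = (A i).card → toColex B ≤ toColex (A i) → T.HasFace n (update A i B)

theorem hasFace_subset {S : ColorTree n} {c : Fin n → ℤ} (hS : S.Core c) {j : ℕ}
    {A : Fin n → Finset ℕ} (h : S.HasFace j A) {i : Fin n} (hi : i.val < j) :
    A i ⊆ range (S.topWeight i) := by
  induction S generalizing c A with
  | leaf w => exact h i hi
  | node s l r ihl ihr =>
    simp only [HasFace] at h
    have hrl : r.topWeight ≤ l.topWeight := hS.2.2.1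
    split_ifs at h with hv
    · have h1 := ihr hS.2.1 h
      by_cases his : i = s
      · subst his
        rw [update_self] at h1
        rw [topWeight_node_self]
        intro b hb
        by_cases hbv : b = l.topWeight i
        · simp [hbv]
        · have := mem_range.1 (h1 (mem_erase.2 ⟨hbv, hb⟩))
          have : r.topWeight i ≤ l.topWeight i := hrl i
          rw [mem_range]; omega
      · rw [update_of_ne his] at h1
        rw [topWeight_node_of_ne his]
        exact h1.trans (range_mono (hrl i))
    · exact (ihl hS.1 h).trans (range_mono (topWeight_le_node s l r i))

theorem exists_hasFace {S : ColorTree n} {c : Fin n → ℤ} (hS : S.Core c) (j : ℕ) :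
    ∃ A : Fin n → Finset ℕ, (∀ i, ((A i).card : ℤ) = c i) ∧
      (∀ i, A i ⊆ range (S.topWeight i)) ∧ S.HasFace j A := by
  induction S generalizing c with
  | leaf w =>
    have hsub : ∀ i, range (c i).toNat ⊆ range (w i) := fun i =>
      range_mono (by have := hS.2.2.2 i; omega)
    refine ⟨fun i => range (c i).toNat, fun i => ?_, hsub, fun i _ => hsub i⟩
    have := hS.2.1 i
    simpa using this
  | node s l r ihl ihr =>
    obtain ⟨A, h1, h2, h3⟩ := ihl hS.1
    refine ⟨A, h1, fun i => (h2 i).trans (range_mono (topWeight_le_node s l r i)), ?_⟩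
    have hv : l.topWeight s ∉ A s := fun h => by simpa using h2 s h
    simpa [HasFace, hv] using h3

section

variable {T S : ColorTree n} {a : Fin n → ℕ} {X : List Bool}

theorem faceAt_succ (hT : T.Core fun i => (a i : ℤ)) {t : Fin n} (hX : T.Lead (t + 1) X)
    (hS : T.subtree X = some S) {A : Fin n → Finset ℕ} :
    T.FaceAt (t + 1) X A ↔ S.InLevel t (A t) ∧ T.FaceAt t (X ++ S.cell t (A t)) A := by
  have h1 := hasFace_succ (hT.subtree hS) (hX.below hT hS) (A := A)
  rw [FaceAt, FaceAt, subtree_append_of_eq hS, subtree_cell, hS]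
  simpa using h1

theorem faceAt_congr (hT : T.Core fun i => (a i : ℤ)) {j : ℕ} {x : List Bool} (hx : T.Lead j x)
    {A A' : Fin n → Finset ℕ} (h : ∀ i : Fin n, i.val < j → A i = A' i) :
    T.FaceAt j x A ↔ T.FaceAt j x A' := by
  refine exists_congr fun S => and_congr_right fun hS => hasFace_congr (hx.below hT hS) h

theorem faceAt_zero {x : List Bool} (hT : T.Core fun i => (a i : ℤ)) (hx : T.Lead 0 x)
    (A : Fin n → Finset ℕ) : T.FaceAt 0 x A := by
  obtain ⟨S, hS⟩ := hx.subtree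
  refine ⟨S, hS, ?_⟩
  have hB := hx.below hT hS
  rcases S with w | ⟨s, l, r⟩
  · intro i hi; exact absurd hi (Nat.not_lt_zero _)
  · exact absurd hB.1 (Nat.not_lt_zero _)

theorem nu_append (hS : T.subtree X = some S) (p : List Bool) :
    T.nu a (X ++ p) = S.split (T.nu a X) p := split_append hS _ p

theorem faceAt_succ_of_cellMax (hT : T.Core fun i => (a i : ℤ)) {t : Fin n}
    (hX : T.Lead (t + 1) X) (hS : T.subtree X = some S) {p : List Bool} (hp : S.Lead t p)
    (A : Fin n → Finset ℕ) (hA : A t = S.cellMax t (a t) p) :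
    T.FaceAt (t + 1) X A ↔ T.FaceAt t (X ++ p) A := by
  obtain ⟨c, hc, hca⟩ := hT.subtree_lead hX hS
  have hB := hX.below hT hS
  obtain ⟨-, h2, h3⟩ := cellMax_spec hc hB (hca t (Nat.lt_succ_self _)) hp
  rw [faceAt_succ hT hX hS, hA, h3]
  exact and_iff_right h2

theorem exists_card_faceAt (hT : T.Core fun i => (a i : ℤ)) {j : ℕ} {x : List Bool}
    (hx : T.Lead j x) :
    ∃ A : Fin n → Finset ℕ, (∀ i : Fin n, i.val < j → (A i).card = a i) ∧ T.FaceAt j x A := by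
  obtain ⟨S, hS⟩ := hx.subtree
  obtain ⟨c, hc, hca⟩ := hT.subtree_lead hx hS
  obtain ⟨A, h1, -, h3⟩ := exists_hasFace hc j
  refine ⟨A, fun i hi => ?_, S, hS, h3⟩
  have := h1 i
  rw [hca i hi] at this
  exact_mod_cast this

/-- Unless a leading vertex is the first one of its level, its predecessor lies in the same level.
-/
theorem zeta_lead_of_count (hT : T.Core fun i => (a i : ℤ)) {i : Fin n} (hX : T.Lead (i + 1) X)
    (hS : T.subtree X = some S) {p q : List Bool} (hp : S.Lead i p) (hq : S.Lead i q)
    (hpq : p < q) :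
    ∃ q', T.zeta a i 0 (X ++ q) = some (X ++ q') ∧ S.Lead i q' ∧ q' < q ∧ ¬ q' < p := by
  have hXp := hX.append (Nat.le_succ _) hS hp
  have hXq := hX.append (Nat.le_succ _) hS hq
  -- the predecessor is the largest of the finitely many earlier leading vertices
  let L := (T.leading i).toFinset.filter (· < X ++ q)
  have hL : L.Nonempty :=
    ⟨X ++ p, by simp [L, (mem_leading hT).2 hXp, append_lt_append_iff.2 hpq]⟩
  obtain ⟨z, hm, hmax⟩ : ∃ z ∈ L, ∀ y ∈ L, y ≤ z := ⟨L.max' hL, L.max'_mem hL, L.le_max'⟩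
  simp only [L, mem_filter, List.mem_toFinset, mem_leading hT] at hm hmax
  have hzp := not_lt.2 (hmax _ ⟨hXp, append_lt_append_iff.2 hpq⟩)
  obtain ⟨q', rfl⟩ := prefix_of_between hzp hm.2
  obtain ⟨X', q₁, S', he, hX', hS', hq₁⟩ := hm.1.exists_prefix (Nat.le_succ i.val)
  obtain rfl := hX'.eq_of_prefix_of_prefix hX (List.prefix_append _ _) (he ▸ List.prefix_append _ _)
  obtain rfl := List.append_cancel_left he
  obtain rfl : S' = S := Option.some.inj (hS'.symm.trans hS)
  refine ⟨q', ?_, hq₁, append_lt_append_iff.1 hm.2, fun h => hzp (append_lt_append_iff.2 h)⟩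
  rw [zeta_zero hT hXq]
  exact ⟨hm.1, hm.2, fun y hy hlt => not_lt.2 (hmax y ⟨hy, hlt⟩)⟩

theorem count_pos_of_lt {i : ℕ} {p q : List Bool} (hp : S.Lead i p) (hq : S.Lead i q)
    (hpq : p < q) : 0 < q.count true := by
  by_contra h
  have h0 : q.count true = 0 := by omega
  induction S generalizing p q with
  | leaf w =>
    obtain rfl : p = [] := hp
    obtain rfl : q = [] := hq
    exact lt_irrefl _ hpq
  | node s l r ihl ihr =>
    rcases q with _ | ⟨_ | _, q⟩
    · cases hpq
    · rcases p with _ | ⟨_ | _, p⟩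
      · exact absurd hp (not_lt.2 hq.1)
      · rw [List.cons_lt_cons_iff] at hpq
        exact ihl hp.2 hq.2 (by simpa using hpq) (by simpa using h) (by simpa using h0)
      · simp only [List.cons_lt_cons_iff, Bool.true_eq_false, false_and, or_false] at hpq
        exact absurd hpq (by decide)
    · simp at h0

theorem exists_lt_of_count_pos {i : ℕ} {q : List Bool} (hq : S.Lead i q) (h : 0 < q.count true) :
    ∃ p, S.Lead i p ∧ p < q := by
  have hex : ∀ S : ColorTree n, ∃ p, S.Lead i p := fun S => by
    induction S with
    | leaf w => exact ⟨[], rfl⟩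
    | node s l r ihl ihr =>
      obtain ⟨p, hp⟩ := ihl
      by_cases hs : s.val < i
      · exact ⟨[], hs⟩
      · exact ⟨false :: p, not_lt.1 hs, hp⟩
  induction S generalizing q with
  | leaf w =>
    obtain rfl : q = [] := hq
    simp at h
  | node s l r ihl ihr =>
    rcases q with _ | ⟨_ | _, q⟩
    · simp at h
    · obtain ⟨p, hp, hlt⟩ := ihl hq.2 (by simpa using h)
      exact ⟨false :: p, ⟨hq.1, hp⟩, by simpa [List.cons_lt_cons_iff] using hlt⟩
    · obtain ⟨p, hp⟩ := hex l
      exact ⟨false :: p, ⟨hq.1, hp⟩, by simp [List.cons_lt_cons_iff]⟩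

/-- A color `i` has been split on the way to `X ++ q` exactly if `q` turns right. -/
theorem nu_lt_iff (hT : T.Core fun i => (a i : ℤ)) {i : Fin n} (hX : T.Lead (i + 1) X)
    (hS : T.subtree X = some S) {q : List Bool} (hq : S.Lead i q) :
    0 < (a i : ℤ) - T.nu a (X ++ q) i ↔ 0 < q.count true := by
  rw [nu_append hS, hq.split_self (hX.below hT hS), nu, hX.split_eq _ (Nat.lt_succ_self _)]
  omega

/-- A compatible tree: if the families at the cells of each lower level decrease, then the family
at a vertex is contained in the family at the vertex assigned to it by `ζ`. -/
theorem facesLE_zeta (hT : T.Core fun i => (a i : ℤ)) (hC : T.IsCompatible a) {i : Fin n}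
    (ih : ∀ t : Fin n, t < i → ∀ X S, T.Lead (t + 1) X → T.subtree X = some S → ∀ p q,
      S.Lead t p → S.Lead t q → p < q → T.FacesLE a t (X ++ q) (X ++ p)) (j : ℕ) :
    ∀ d, j + d = i → ∀ x, T.Lead j x → 0 < (a i : ℤ) - T.nu a x i → ∀ z,
      T.zeta a i d x = some z → T.Lead j z → T.FacesLE a j x z := by
  have hsucc : StrictMono Nat.succ := fun _ _ h => Nat.succ_lt_succ h
  induction j with
  | zero => exact fun d _ x _ _ z _ hz A _ _ => faceAt_zero hT hz A
  | succ j IH =>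
    intro d hd x hx hnu z hz hzl A hA hxA
    have hjn : j < n := by omega
    obtain ⟨t, rfl⟩ : ∃ t : Fin n, t.val = j := ⟨⟨j, hjn⟩, rfl⟩
    have hti : t < i := Fin.lt_def.2 (by omega)
    obtain ⟨z', hz'l, hz', hsig⟩ := hC i t hti x ((mem_leading hT).2 hx) hnu
    obtain rfl : z' = z := by
      rw [show i.val - (t.val + 1) = d by omega] at hz'
      exact Option.some.inj (hz'.symm.trans hz)
    obtain ⟨S, hS⟩ := hx.subtree
    obtain ⟨S', hS'⟩ := hzl.subtree
    obtain ⟨c, hc, hca⟩ := hT.subtree_lead hx hS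
    obtain ⟨c', hc', hca'⟩ := hT.subtree_lead hzl hS'
    have hB := hx.below hT hS
    have hB' := hzl.below hT hS'
    rw [signature_of_lead_succ hT hx hS, signature_of_lead_succ hT hzl hS',
      toColex_image_le_toColex_image hsucc] at hsig
    obtain ⟨hin, hface⟩ := (faceAt_succ hT hx hS).1 hxA
    have hcard := hA t (Nat.lt_succ_self _)
    have hp := lead_cell hB (A t)
    have hle := hin.le_cellMax hc hB
    rw [hcard] at hle
    obtain ⟨hcm, hcin, -⟩ := cellMax_spec hc hB (hca t (Nat.lt_succ_self _)) hp
    have hle2 := hcin.le_cellMax_topRun hc hB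
    rw [hcm] at hle2
    obtain ⟨q, hq1, hq2, hq3, -⟩ := zeta_succ hT (d := d) (by omega) hx hS hp hz hzl hS'
      ⟨_, lead_replicate_topRun hB', hle2.trans hsig⟩
    have hzq : T.Lead t (z' ++ q) := hzl.append (Nat.le_succ _) hS' hq2
    have hface' : T.FaceAt t (z' ++ q) A := by
      refine IH (d + 1) (by omega) _ (hx.append (Nat.le_succ _) hS hp) ?_ _ hq1 hzq A
        (fun i hi => hA i (Nat.lt_succ_of_lt hi)) hface
      rwa [nu_append hS, hB.split_eq _ _ hti]
    obtain ⟨hqm, hqin, hqc⟩ := cellMax_spec hc' hB' (hca' t (Nat.lt_succ_self _)) hq2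
    obtain ⟨hin', hnlt⟩ := hqin.mono hc' (hle.trans hq3) (by rw [hcard, hqm])
    rw [hqc] at hnlt
    rw [faceAt_succ hT hzl hS']
    refine ⟨hin', ?_⟩
    rcases (not_lt.1 hnlt).lt_or_eq with hlt | heq
    · exact ih t hti z' S' hzl hS' _ q (lead_cell hB' _) hq2 hlt A
        (fun i hi => hA i (Nat.lt_succ_of_lt hi)) hface'
    · rwa [heq]

/-- In a compatible tree the families at the cells of a level decrease in depth-first order: by
induction on the color, and along a level by passing from a cell to its predecessor. -/
theorem facesLE_of_isCompatible (hT : T.Core fun i => (a i : ℤ)) (hC : T.IsCompatible a)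
    (i : Fin n) : ∀ X S, T.Lead (i + 1) X → T.subtree X = some S → ∀ p q,
      S.Lead i p → S.Lead i q → p < q → T.FacesLE a i (X ++ q) (X ++ p) := by
  induction i using WellFoundedLT.induction with
  | ind i ih =>
  intro X S hX hS p q hp hq hpq
  induction hk : ((T.leading i).toFinset.filter (· < X ++ q)).card using Nat.strong_induction_on
    generalizing q with
  | h k IH =>
  have hXq := hX.append (Nat.le_succ _) hS hq
  obtain ⟨q', hz, hq', hlt, hge⟩ := zeta_lead_of_count hT hX hS hp hq hpq
  have hXq' := hX.append (Nat.le_succ _) hS hq'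
  have h1 : T.FacesLE a i (X ++ q) (X ++ q') :=
    facesLE_zeta hT hC ih i 0 (by omega) _ hXq
      ((nu_lt_iff hT hX hS hq).2 (count_pos_of_lt hp hq hpq)) _ hz hXq'
  rcases (not_lt.1 hge).lt_or_eq with hlt' | rfl
  · have h2 := IH _ (by
      rw [← hk]
      refine card_lt_card ((ssubset_iff_of_subset fun y hy => ?_).2 ⟨X ++ q', ?_, ?_⟩)
      · rw [mem_filter] at hy ⊢
        exact ⟨hy.1, hy.2.trans (append_lt_append_iff.2 hlt)⟩
      · rw [mem_filter, List.mem_toFinset, mem_leading hT]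
        exact ⟨hXq', append_lt_append_iff.2 hlt⟩
      · simp) q' hq' hlt' rfl
    exact fun A hA h => h2 A hA (h1 A hA h)
  · exact h1

/-- If the families decrease along every level, an entry of a described tuple may be replaced by an
earlier set: the path of the tuple moves to an earlier cell, whose family is larger. -/
theorem faceAt_update (hT : T.Core fun i => (a i : ℤ))
    (hle : ∀ (i : Fin n) X S, T.Lead (i + 1) X → T.subtree X = some S → ∀ p q,
      S.Lead i p → S.Lead i q → p < q → T.FacesLE a i (X ++ q) (X ++ p)) (j : ℕ) (hj : j ≤ n) :
    ∀ X, T.Lead j X → ∀ A : Fin n → Finset ℕ, (∀ i : Fin n, i.val < j → (A i).card = a i) →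
      T.FaceAt j X A → ∀ i B, B.card = (A i).card → toColex B ≤ toColex (A i) →
        T.FaceAt j X (update A i B) := by
  induction j with
  | zero => exact fun X hX A _ _ i B _ _ => faceAt_zero hT hX _
  | succ j IH =>
    intro X hX A hA h i B hBc hBle
    obtain ⟨t, rfl⟩ : ∃ t : Fin n, t.val = j := ⟨⟨j, hj⟩, rfl⟩
    obtain ⟨S, hS⟩ := hX.subtree
    obtain ⟨c, hc, hca⟩ := hT.subtree_lead hX hS
    have hB := hX.below hT hS
    have hA' : ∀ i : Fin n, i.val < t.val → (A i).card = a i :=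
      fun i hi => hA i (Nat.lt_succ_of_lt hi)
    rw [faceAt_succ hT hX hS] at h ⊢
    have hlead := hX.append (Nat.le_succ _) hS (lead_cell hB (A t))
    rcases eq_or_ne i t with rfl | hne
    · rw [update_self]
      obtain ⟨h1, h2⟩ := h.1.mono hc hBle hBc
      have hlead' := hX.append (Nat.le_succ _) hS (lead_cell hB B)
      rw [faceAt_congr hT hlead' (A' := A) fun k hk => by simp [Fin.ne_of_lt hk]]
      refine ⟨h1, ?_⟩
      rcases (not_lt.1 h2).lt_or_eq with hlt | heq
      · exact hle i X S hX hS _ _ (lead_cell hB _) (lead_cell hB _) hlt A hA' h.2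
      · rw [heq]; exact h.2
    · rw [update_of_ne hne.symm]
      exact ⟨h.1, IH (by omega) _ hlead A hA' h.2 i B hBc hBle⟩

theorem lead_top (T : ColorTree n) : T.Lead n [] := by
  rcases T with w | ⟨s, l, r⟩
  · rfl
  · exact s.isLt

/-- Compatible trees describe families closed under colex descent. -/
theorem isDown_of_isCompatible (hT : T.Core fun i => (a i : ℤ)) (hC : T.IsCompatible a) :
    T.IsDown fun i => (a i : ℤ) := by
  intro A hA h i B hBc hBle
  obtain ⟨S, hS, hf⟩ := faceAt_update hT (facesLE_of_isCompatible hT hC) n le_rfl [] T.lead_top A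
    (fun i _ => Nat.cast_injective (hA i)) ⟨T, T.subtree_nil, h⟩ i B hBc hBle
  obtain rfl : T = S := Option.some.inj (T.subtree_nil.symm.trans hS)
  exact hf

end

end Compatibility

/-! ### Counting faces by the differential -/

section Counting

variable {n : ℕ}

/-- The tuples of type `b` described by a tree. -/
def tuples : ColorTree n → (Fin n → ℤ) → Finset (Fin n → Finset ℕ)
  | leaf w, b =>
    Fintype.piFinset fun i => if b i < 0 then ∅ else powersetCard (b i).toNat (range (w i))
  | node t l r, b => l.tuples b ∪
      (r.tuples (b - Pi.single t 1)).image fun A => update A t (insert (l.topWeight t) (A t))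

theorem mem_tuples {S : ColorTree n} {c b : Fin n → ℤ} (hS : S.Core c)
    {A : Fin n → Finset ℕ} :
    A ∈ S.tuples b ↔ S.HasFace n A ∧ ∀ i, ((A i).card : ℤ) = b i := by
  induction S generalizing c b A with
  | leaf w =>
    simp only [tuples, Fintype.mem_piFinset, HasFace, Fin.is_lt, forall_const]
    rw [← forall_and]
    refine forall_congr' fun i => ?_
    split_ifs with h
    · simp; intro _; omega
    · rw [mem_powersetCard]
      refine and_congr Iff.rfl ?_
      omega
  | node s l r ihl ihr =>
    have hrl : r.topWeight s ≤ l.topWeight s := hS.2.2.1 s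
    simp only [tuples, mem_union, mem_image, HasFace]
    split_ifs with hv
    · constructor
      · rintro (h | ⟨A', hA', rfl⟩)
        · rw [ihl hS.1] at h
          have := mem_range.1 (hasFace_subset hS.1 h.1 s.isLt hv)
          exact absurd this (lt_irrefl _)
        · rw [ihr hS.2.1] at hA'
          have hv' : l.topWeight s ∉ A' s := fun hv' => by
            have := mem_range.1 (hasFace_subset hS.2.1 hA'.1 s.isLt hv')
            omega
          refine ⟨by simpa [erase_insert hv'] using hA'.1, fun i => ?_⟩
          have := hA'.2 i
          by_cases his : i = s
          · subst his
            simp only [Pi.sub_apply, Pi.single_eq_same] at this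
            rw [update_self, card_insert_of_notMem hv']
            push_cast
            omega
          · simpa [his] using this
      · rintro ⟨h1, h2⟩
        refine Or.inr ⟨_, (ihr hS.2.1).2 ⟨h1, fun i => ?_⟩, ?_⟩
        · have := h2 i
          by_cases his : i = s
          · subst his
            have h3 := card_erase_add_one hv
            simp only [update_self, Pi.sub_apply, Pi.single_eq_same]
            omega
          · simpa [his] using this
        · simp [insert_erase hv]
    · rw [ihl hS.1]
      refine or_iff_left ?_
      rintro ⟨A', -, rfl⟩
      simp at hv

/-- At a terminal vertex the entries are chosen independently. -/
theorem card_tuples_leaf (w : Fin n → ℕ) (b : Fin n → ℤ) :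
    ((leaf w).tuples b).card = tupleChoose w b := by
  rw [tuples, Fintype.card_piFinset, tupleChoose]
  refine prod_congr rfl fun i _ => ?_
  split_ifs <;> simp

/-- The sum over all terminal vertices which defines the differential, for an arbitrary splitting
label `b` of the top vertex. -/
theorem card_tuples {S : ColorTree n} {c : Fin n → ℤ} (hS : S.Core c) (b : Fin n → ℤ) :
    (S.tuples b).card =
      (S.leaves.map fun u => tupleChoose (S.leftWeight u) (S.split b u)).sum := by
  induction S generalizing c b with
  | leaf w =>
    rw [card_tuples_leaf]
    simp [leaves, leftWeight, split, topWeight]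
  | node s l r ihl ihr =>
    have hrl : r.topWeight s ≤ l.topWeight s := hS.2.2.1 s
    have hnot : ∀ A ∈ r.tuples (b - Pi.single s 1), l.topWeight s ∉ A s := fun A hA hv => by
      rw [mem_tuples hS.2.1] at hA
      have := mem_range.1 (hasFace_subset hS.2.1 hA.1 s.isLt hv)
      omega
    rw [tuples, card_union_of_disjoint, card_image_of_injOn, ihl hS.1, ihr hS.2.1]
    · simp only [leaves, List.map_append, List.map_map, List.sum_append]
      rfl
    · intro A hA A' hA' he
      have h1 := hnot A hA
      have h2 := hnot A' hA'
      funext i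
      have := congrFun he i
      by_cases his : i = s
      · subst his
        simp only [update_self] at this
        rw [← erase_insert h1, this, erase_insert h2]
      · simpa [his] using this
    · rw [disjoint_left]
      rintro A hA hA'
      obtain ⟨A', -, rfl⟩ := mem_image.1 hA'
      rw [mem_tuples hS.1] at hA
      have := mem_range.1 (hasFace_subset hS.1 hA.1 s.isLt (by simp : l.topWeight s ∈ _))
      exact lt_irrefl _ this

theorem split_add (S : ColorTree n) (c d : Fin n → ℤ) (p : List Bool) :
    S.split (c + d) p = S.split c p + d := by
  induction S generalizing p c with
  | leaf w => rcases p with _ | ⟨_, p⟩ <;> rfl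
  | node s l r ihl ihr =>
    rcases p with _ | ⟨_ | _, p⟩
    · rfl
    · exact ihl c p
    · simp only [split]
      rw [← ihr, add_sub_right_comm]

/-- The differential counts the tuples of every type. -/
theorem card_tuples_eq_differential {T : ColorTree n} {a : Fin n → ℕ}
    (hT : T.Core fun i => (a i : ℤ)) (b : Fin n → ℤ) :
    (T.tuples b).card = T.differential a fun i => b i - a i := by
  rw [card_tuples hT, differential]
  have : b = (fun i => (a i : ℤ)) + fun i => b i - a i := by funext i; simp
  congr 2
  funext u
  rw [nu, ← split_add, ← this]

/-! ### The tuples of smaller type are the subtuples of the facets -/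

/-- Described tuples of smaller type extend to described tuples of full type. -/
theorem HasFace.exists_superset {S : ColorTree n} {c : Fin n → ℤ} (hS : S.Core c)
    {B : Fin n → Finset ℕ} (h : S.HasFace n B) (hB : ∀ i, ((B i).card : ℤ) ≤ c i) :
    ∃ A, (∀ i, B i ⊆ A i) ∧ (∀ i, ((A i).card : ℤ) = c i) ∧ S.HasFace n A := by
  induction S generalizing c B with
  | leaf w =>
    have : ∀ i, ∃ A, B i ⊆ A ∧ A ⊆ range (w i) ∧ A.card = (c i).toNat := fun i => by
      refine exists_subsuperset_card_eq (h i i.isLt) ?_ ?_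
      · have := hB i; omega
      · have := hS.2.2.2 i; rw [card_range]; omega
    choose A h1 h2 h3 using this
    refine ⟨A, h1, fun i => ?_, fun i _ => h2 i⟩
    have := hS.2.1 i
    rw [h3]
    exact Int.toNat_of_nonneg this
  | node s l r ihl ihr =>
    simp only [HasFace] at h ⊢
    split_ifs at h with hv
    · obtain ⟨A, h1, h2, h3⟩ := ihr hS.2.1 h fun i => by
        have := hB i
        by_cases his : i = s
        · subst his
          have h3 := card_erase_add_one hv
          simp only [update_self, Pi.sub_apply, Pi.single_eq_same]
          omega
        · simpa [his] using this
      have hrl : r.topWeight s ≤ l.topWeight s := hS.2.2.1 s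
      have hv' : l.topWeight s ∉ A s := fun hv' => by
        have := mem_range.1 (hasFace_subset hS.2.1 h3 s.isLt hv')
        omega
      refine ⟨update A s (insert (l.topWeight s) (A s)), fun i => ?_, fun i => ?_, ?_⟩
      · have := h1 i
        by_cases his : i = s
        · subst his
          simp only [update_self] at this ⊢
          exact (insert_erase hv) ▸ insert_subset_insert _ this
        · simpa [his] using this
      · have := h2 i
        by_cases his : i = s
        · subst his
          simp only [Pi.sub_apply, Pi.single_eq_same] at this
          rw [update_self, card_insert_of_notMem hv']
          push_cast
          omega
        · simpa [his] using this
      · simpa [erase_insert hv'] using h3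
    · obtain ⟨A, h1, h2, h3⟩ := ihl hS.1 h hB
      have hv' : l.topWeight s ∉ A s := fun hv' => by
        simpa using hasFace_subset hS.1 h3 s.isLt hv'
      exact ⟨A, h1, h2, by simpa [hv'] using h3⟩

theorem IsDown.left {s : Fin n} {l r : ColorTree n} {c : Fin n → ℤ}
    (hS : (node s l r).Core c) (hD : (node s l r).IsDown c) : l.IsDown c := by
  intro A hA h i B hBc hBle
  have hnot : ∀ A, l.HasFace n A → l.topWeight s ∉ A s := fun A h hv => by
    simpa using hasFace_subset hS.1 h s.isLt hv
  have h1 := hD A hA (by simpa [HasFace, hnot A h] using h) i B hBc hBle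
  have h2 : l.topWeight s ∉ update A i B s := by
    by_cases his : i = s
    · subst his
      rw [update_self]
      intro hv
      simpa using subset_range_of_le hBle (hasFace_subset hS.1 h i.isLt) hv
    · rw [update_of_ne (Ne.symm his)]; exact hnot A h
  simpa only [HasFace, h2, if_false] using h1

theorem IsDown.right {s : Fin n} {l r : ColorTree n} {c : Fin n → ℤ}
    (hS : (node s l r).Core c) (hD : (node s l r).IsDown c) :
    r.IsDown (c - Pi.single s 1) := by
  intro A hA h i B hBc hBle
  have hrl : r.topWeight s ≤ l.topWeight s := hS.2.2.1 s
  have hsub := hasFace_subset hS.2.1 h s.isLt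
  have hv : l.topWeight s ∉ A s := fun hv => by
    have := mem_range.1 (hsub hv); omega
  have hcard : ∀ i, ((update A s (insert (l.topWeight s) (A s)) i).card : ℤ) = c i := by
    intro i
    have := hA i
    by_cases his : i = s
    · subst his
      simp only [Pi.sub_apply, Pi.single_eq_same] at this
      rw [update_self, card_insert_of_notMem hv]
      push_cast
      omega
    · simpa [his] using this
  have hface : (node s l r).HasFace n (update A s (insert (l.topWeight s) (A s))) := by
    simpa [HasFace, erase_insert hv] using h
  by_cases his : i = s
  · subst his
    have hvB : l.topWeight i ∉ B := fun hvB => by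
      have := mem_range.1 (subset_range_of_le hBle hsub hvB); omega
    have := hD _ hcard hface i (insert (l.topWeight i) B)
      (by rw [update_self, card_insert_of_notMem hv, card_insert_of_notMem hvB, hBc])
      (by rw [update_self]; exact insert_mono_of_notMem hvB hv hBle)
    simpa [HasFace, erase_insert hvB] using this
  · have := hD _ hcard hface i B (by simpa [his] using hBc) (by simpa [his] using hBle)
    have he : update (update A i B) s (A s) = update A i B := by
      rw [update_comm his, update_eq_self]
    rw [update_comm (Ne.symm his)] at this
    simpa [HasFace, erase_insert hv, he] using this

/-- Since the family of facets is closed under passing to earlier sets, a subtuple of a facet that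
uses the vertex split off at the top can be completed without that vertex. -/
theorem HasFace.of_subset {S : ColorTree n} {c : Fin n → ℤ} (hS : S.Core c) (hD : S.IsDown c)
    {A B : Fin n → Finset ℕ} (h : S.HasFace n A) (hA : ∀ i, ((A i).card : ℤ) = c i)
    (hBA : ∀ i, B i ⊆ A i) : S.HasFace n B := by
  induction S generalizing c A B with
  | leaf w => exact fun i hi => (hBA i).trans (h i hi)
  | node s l r ihl ihr =>
    have hnotl : ∀ A, l.HasFace n A → l.topWeight s ∉ A s := fun A h hv => by
      simpa using hasFace_subset hS.1 h s.isLt hv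
    by_cases hv : l.topWeight s ∈ A s
    · by_cases hvB : l.topWeight s ∈ B s
      · simp only [HasFace, hv, hvB, if_true] at h ⊢
        refine ihr hS.2.1 (hD.right hS) h (fun i => ?_) fun i => ?_
        · have := hA i
          by_cases his : i = s
          · subst his
            have h3 := card_erase_add_one hv
            simp only [update_self, Pi.sub_apply, Pi.single_eq_same]
            omega
          · simpa [his] using this
        · by_cases his : i = s
          · subst his
            simpa using erase_subset_erase _ (hBA i)
          · simpa [his] using hBA i
      · -- exchange the vertex split off for a smaller one
        have hsub := hasFace_subset hS h s.isLt
        rw [topWeight_node_self] at hsub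
        have hcard := hS.le_left
        have hAs := hA s
        have hex : ∃ x ∈ range (l.topWeight s), x ∉ (A s).erase (l.topWeight s) := by
          refine exists_mem_notMem_of_card_lt_card ?_
          have h3 := card_erase_add_one hv
          rw [card_range]
          omega
        obtain ⟨x, hx, hxA⟩ := hex
        rw [mem_range] at hx
        have hle : toColex (insert x ((A s).erase (l.topWeight s))) ≤ toColex (A s) := by
          have := (insert_le_insert hxA (notMem_erase (l.topWeight s) (A s))).2 hx.le
          rwa [insert_erase hv] at this
        have h1 := hD A hA h s (insert x ((A s).erase (l.topWeight s)))
          (by rw [card_insert_of_notMem hxA, card_erase_add_one hv]) hle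
        have hv1 : l.topWeight s ∉ update A s (insert x ((A s).erase (l.topWeight s))) s := by
          simp [hx.ne']
        simp only [HasFace, hv1, hvB, if_false] at h1 ⊢
        refine ihl hS.1 (hD.left hS) h1 (fun i => ?_) fun i => ?_
        · have := hA i
          by_cases his : i = s
          · subst his
            rw [update_self, card_insert_of_notMem hxA, card_erase_add_one hv, this]
          · simpa [his] using this
        · by_cases his : i = s
          · subst his
            rw [update_self]
            intro y hy
            exact mem_insert_of_mem (mem_erase.2 ⟨fun e => hvB (e ▸ hy), hBA i hy⟩)
          · simpa [his] using hBA i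
    · have hvB : l.topWeight s ∉ B s := fun h => hv (hBA s h)
      simp only [HasFace, hv, hvB, if_false] at h ⊢
      exact ihl hS.1 (hD.left hS) h hA hBA

/-- For `b ≤ a`, the differential counts the subtuples of type `b` of the facets. -/
theorem mem_tuples_iff_exists {T : ColorTree n} {c : Fin n → ℤ} (hT : T.Core c) (hD : T.IsDown c)
    {b : Fin n → ℤ} (hb : b ≤ c) {B : Fin n → Finset ℕ} :
    B ∈ T.tuples b ↔ (∃ A ∈ T.tuples c, ∀ i, B i ⊆ A i) ∧ ∀ i, ((B i).card : ℤ) = b i := by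
  rw [mem_tuples hT]
  refine and_congr_left fun hB => ⟨fun h => ?_, ?_⟩
  · obtain ⟨A, h1, h2, h3⟩ := h.exists_superset hT fun i => (hB i).trans_le (hb i)
    exact ⟨A, (mem_tuples hT).2 ⟨h3, h2⟩, h1⟩
  · rintro ⟨A, hA, hBA⟩
    rw [mem_tuples hT] at hA
    exact hA.1.of_subset hT hD hA.2 hBA

end Counting

/-! ### Recursive and address-wise forms of the local conditions -/

section Local

variable {n : ℕ}

/-- `Core` says that its conditions at a terminal vertex and at a trivalent vertex hold at every
address. -/
theorem core_iff {T : ColorTree n} {c : Fin n → ℤ} :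
    T.Core c ↔ (∀ u w, T.subtree u = some (leaf w) → (leaf w).Core (T.split c u)) ∧
      ∀ y s l r, T.subtree y = some (node s l r) → r.topWeight ≤ l.topWeight ∧
        l.Below (s + 1) ∧ r.Below (s + 1) ∧
        (∀ i, s < i → l.ConstAt i (l.topWeight i) ∧ r.ConstAt i (l.topWeight i)) ∧ l.Full s := by
  refine ⟨fun h => ⟨fun u w hu => h.subtree hu, fun y s l r hy => (h.subtree hy).2.2⟩, ?_⟩
  rintro ⟨h1, h2⟩
  induction T generalizing c with
  | leaf w => exact h1 [] w rfl
  | node s l r ihl ihr =>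
    exact ⟨ihl (fun u w hu => h1 (false :: u) w hu) fun y => h2 (false :: y),
      ihr (fun u w hu => h1 (true :: u) w hu) fun y => h2 (true :: y), h2 [] s l r rfl⟩

theorem below_of_label {j : ℕ} {S : ColorTree n}
    (h : ∀ p t, S.label p = some t → t.val < j) : S.Below j := by
  induction S with
  | leaf w => trivial
  | node s l r ihl ihr =>
    exact ⟨h [] s rfl, ihl fun p => h (false :: p), ihr fun p => h (true :: p)⟩

theorem constAt_iff {i : Fin n} {m : ℕ} {S : ColorTree n} :
    S.ConstAt i m ↔ ∀ p w, S.subtree p = some (leaf w) → w i = m := by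
  induction S with
  | leaf w =>
    refine ⟨?_, fun h => h [] w rfl⟩
    rintro h (_ | ⟨_, p⟩) w' hw
    · cases hw; exact h
    · cases hw
  | node s l r ihl ihr =>
    rw [ConstAt, ihl, ihr]
    refine ⟨?_, fun h => ⟨fun p => h (false :: p), fun p => h (true :: p)⟩⟩
    rintro ⟨h1, h2⟩ (_ | ⟨_ | _, p⟩) w hw
    · cases hw
    · exact h1 p w hw
    · exact h2 p w hw

theorem ConstAt.subtree {i : Fin n} {m : ℕ} {S S' : ColorTree n} (h : S.ConstAt i m)
    {p : List Bool} (hp : S.subtree p = some S') : S'.ConstAt i m := by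
  rw [constAt_iff] at h ⊢
  exact fun q w hq => h (p ++ q) w (by rw [subtree_append_of_eq hp, hq])

theorem Below.subtree {j : ℕ} {S S' : ColorTree n} (h : S.Below j)
    {p : List Bool} (hp : S.subtree p = some S') : S'.Below j :=
  below_of_label fun q t hq => h.label_lt (p := p ++ q) (by rw [label_append hp, hq])

theorem exists_leaf (S : ColorTree n) : ∃ p w, S.subtree p = some (leaf w) := by
  induction S with
  | leaf w => exact ⟨[], w, rfl⟩
  | node s l r ihl ihr =>
    obtain ⟨p, w, h⟩ := ihl
    exact ⟨false :: p, w, h⟩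

theorem full_of_topWeight_eq {t : Fin n} {S : ColorTree n}
    (h : ∀ p l r, S.subtree p = some (node t l r) → r.topWeight t = l.topWeight t) :
    S.Full t := by
  induction S with
  | leaf w => trivial
  | node s l r ihl ihr =>
    rintro rfl
    exact ⟨ihl fun p => h (false :: p), ihr fun p => h (true :: p), h [] l r rfl⟩

/-- Below a full level of color `t` the weight of this color drops by one at every step of a path
to a right child of a vertex of color `t`. -/
theorem Full.leftWeight_eq {t : Fin n} {S S' : ColorTree n} {c : Fin n → ℤ} (hS : S.Core c)
    (hB : S.Below (t + 1)) (hF : S.Full t) {p q : List Bool} (hp : S.label p = some t)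
    (hq : q <+: p ++ [true]) (h : S.subtree q = some S') :
    (S'.topWeight t : ℤ) = S.topWeight t - q.length := by
  induction S generalizing c p q with
  | leaf w => rcases p with _ | ⟨_, p⟩ <;> simp [label, subtree] at hp
  | node s l r ihl ihr =>
    by_cases hst : s = t
    · subst hst
      obtain ⟨h1, h2, h3⟩ := hF rfl
      rcases q with _ | ⟨b, q⟩
      · cases h; simp
      rcases p with _ | ⟨b', p⟩
      · obtain ⟨rfl, rfl⟩ : b = true ∧ q = [] := by simpa using hq
        obtain rfl : r = S' := by simpa [subtree] using h
        simp [h3]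
      · rw [List.cons_append, List.cons_prefix_cons] at hq
        obtain ⟨rfl, hq⟩ := hq
        cases b
        · have := ihl hS.1 hB.2.1 h1 hp hq h
          rw [topWeight_node_self, this, List.length_cons]
          push_cast
          ring
        · have := ihr hS.2.1 hB.2.2 h2 hp hq h
          rw [topWeight_node_self, this, List.length_cons, h3]
          push_cast
          ring
    · exfalso
      have h1 := hS.below_node.label_lt hp
      have h2 := hB.1
      exact hst (Fin.ext (by omega))

theorem subtree_left {T : ColorTree n} {y : List Bool} {s : Fin n} {l r : ColorTree n}
    (h : T.subtree y = some (node s l r)) : T.subtree (y ++ [false]) = some l := by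
  rw [subtree_append_of_eq h, subtree, subtree_nil]

theorem subtree_right {T : ColorTree n} {y : List Bool} {s : Fin n} {l r : ColorTree n}
    (h : T.subtree y = some (node s l r)) : T.subtree (y ++ [true]) = some r := by
  rw [subtree_append_of_eq h, subtree, subtree_nil]

/-- The conditions on exhausted colors and condensedness are not part of `Core`, nor is the
condition on the ends of runs. -/
theorem IsMacaulayTree.core {T : ColorTree n} {a : Fin n → ℕ} {N : ℕ} (hM : T.IsMacaulayTree a N)
    (hC : T.IsCompressedLike) : T.Core fun i => (a i : ℤ) := by
  rw [core_iff]
  constructor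
  · intro u w hu
    have hul : u ∈ T.leaves := mem_leaves.2 ⟨w, hu⟩
    have hw : T.leftWeight u = w := leftWeight_of_subtree hu
    have h1 := hM.leaf_pos u hul
    have h2 := hM.nu_le u hul
    rw [hw] at h1 h2
    exact ⟨h1, (hM.nu_pos u hul).1, (hM.nu_pos u hul).2, h2⟩
  · intro y s l r hy
    have hyv : y ∈ T.verts := mem_verts.2 ⟨_, hy⟩
    have hys : T.label y = some s := label_eq_some.2 ⟨l, r, hy⟩
    have hl := subtree_left hy
    have hr := subtree_right hy
    have hlab : ∀ p t, (node s l r).label p = some t → t.val < s + 1 := fun p t hp => by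
      rw [← label_append hy] at hp
      obtain ⟨l', r', h'⟩ := label_eq_some.1 hp
      exact Nat.lt_succ_of_le (Fin.le_def.1 (hM.label_antitone y hyv (y ++ p)
        (mem_verts.2 ⟨_, h'⟩) s t hys hp (List.prefix_append _ _)))
    have hB := below_of_label hlab
    refine ⟨?_, hB.2.1, hB.2.2, fun i hi => ?_, full_of_topWeight_eq fun p l' r' hp => ?_⟩
    · have := hM.proper y hyv s hys
      rwa [leftWeight_of_subtree hl, leftWeight_of_subtree hr] at this
    · obtain ⟨p, w, hp⟩ := exists_leaf (node s l r)
      have hc : (node s l r).ConstAt i (w i) := by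
        rw [constAt_iff]
        intro q w' hq
        have h1 : T.subtree (y ++ p) = some (leaf w) := by rw [subtree_append_of_eq hy, hp]
        have h2 : T.subtree (y ++ q) = some (leaf w') := by rw [subtree_append_of_eq hy, hq]
        have := hM.leaf_eq y hyv s hys _ (mem_leaves.2 ⟨w', h2⟩) _ (mem_leaves.2 ⟨w, h1⟩)
          (List.prefix_append _ _) (List.prefix_append _ _) i hi
        rwa [leftWeight_of_subtree h1, leftWeight_of_subtree h2] at this
      rw [hc.1.topWeight_eq hB.2.1 hi]
      exact hc
    · have hp' : T.subtree (y ++ [false] ++ p) = some (node s l' r') := by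
        rw [subtree_append_of_eq hl, hp]
      have key := hC.path s _ (mem_verts.2 ⟨_, hp'⟩) (label_eq_some.2 ⟨_, _, hp'⟩) y hyv hys
        (List.prefix_append _ _)
      have h1 := key _ (mem_verts.2 ⟨_, hp'⟩) ⟨[false] ++ p, by simp⟩ (List.prefix_append _ _)
      have h2 := key _ (mem_verts.2 ⟨_, subtree_right hp'⟩) ⟨[false] ++ p ++ [true], by simp⟩
        (List.prefix_refl _)
      rw [leftWeight_of_subtree hp', topWeight_node_self] at h1
      rw [leftWeight_of_subtree (subtree_right hp')] at h2
      simp only [List.length_append, List.length_singleton] at h1 h2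
      push_cast at h1 h2
      omega

/-- Recursive form of the two conditions which prevent redundant splitting: a color exhausted by
splitting keeps its weight below the right child, and no vertex has two equal subtrees without its
color. -/
def Reduced : ColorTree n → (Fin n → ℤ) → Prop
  | leaf _, _ => True
  | node t l r, c => l.Reduced c ∧ r.Reduced (c - Pi.single t 1) ∧
      (c t = 1 → r.ConstAt t (l.topWeight t)) ∧ (l = r → ¬ l.Below t)

theorem Reduced.subtree {S S' : ColorTree n} {c : Fin n → ℤ} (hS : S.Reduced c) {p : List Bool}
    (h : S.subtree p = some S') : S'.Reduced (S.split c p) := by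
  induction S generalizing c p with
  | leaf w =>
    rcases p with _ | ⟨_, p⟩
    · cases h; exact hS
    · cases h
  | node s l r ihl ihr =>
    rcases p with _ | ⟨_ | _, p⟩
    · cases h; exact hS
    · exact ihl hS.1 h
    · exact ihr hS.2.1 h

section

variable {T : ColorTree n} {a : Fin n → ℕ}

theorem isMacaulayTree_of_core (hT : T.Core fun i => (a i : ℤ))
    (hR : T.Reduced fun i => (a i : ℤ)) :
    T.IsMacaulayTree a (T.leaves.map fun u => tupleChoose (T.leftWeight u) (T.nu a u)).sum where
  leaf_pos u hu i := by
    obtain ⟨w, hw⟩ := mem_leaves.1 hu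
    rw [leftWeight_of_subtree hw]
    exact (hT.subtree hw).1 i
  label_antitone y _ y' _ s s' hy hy' hp := by
    obtain ⟨l, r, h⟩ := label_eq_some.1 hy
    obtain ⟨p, rfl⟩ := hp
    rw [label_append h] at hy'
    exact Fin.le_def.2 (Nat.le_of_lt_succ ((hT.subtree h).below_node.label_lt hy'))
  leaf_eq y _ s hy u hu u' hu' hp hp' t ht := by
    obtain ⟨l, r, h⟩ := label_eq_some.1 hy
    obtain ⟨p, rfl⟩ := hp
    obtain ⟨p', rfl⟩ := hp'
    obtain ⟨w, hw⟩ := mem_leaves.1 hu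
    obtain ⟨w', hw'⟩ := mem_leaves.1 hu'
    rw [leftWeight_of_subtree hw, leftWeight_of_subtree hw']
    have hc : (node s l r).ConstAt t (l.topWeight t) := (hT.subtree h).2.2.2.2.2.1 t ht
    rw [constAt_iff] at hc
    rw [subtree_append_of_eq h] at hw hw'
    exact (hc _ _ hw).trans (hc _ _ hw').symm
  proper y _ s hy := by
    obtain ⟨l, r, h⟩ := label_eq_some.1 hy
    rw [leftWeight_of_subtree (subtree_left h), leftWeight_of_subtree (subtree_right h)]
    exact (hT.subtree h).2.2.1
  nu_le u hu i := by
    obtain ⟨w, hw⟩ := mem_leaves.1 hu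
    rw [leftWeight_of_subtree hw]
    exact (hT.subtree hw).2.2.2 i
  nu_pos u hu := by
    obtain ⟨w, hw⟩ := mem_leaves.1 hu
    exact ⟨(hT.subtree hw).2.1, (hT.subtree hw).2.2.1⟩
  exhausted y _ s hy hnu x hx hp := by
    obtain ⟨l, r, h⟩ := label_eq_some.1 hy
    obtain ⟨p, rfl⟩ := hp
    have hr := subtree_right h
    obtain ⟨S, hS⟩ := mem_verts.1 hx
    have hcore := hT.subtree h
    have hconst := (hR.subtree h).2.2.1 hnu
    -- the class of color `s` is used up, so it is not split again on the right
    have hB : r.Below s := by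
      rcases r with w | ⟨s', l', r'⟩
      · trivial
      · have h1 := hcore.2.1.one_le
        have h2 := hcore.2.2.2.2.1.1
        have hne : s' ≠ s := by
          rintro rfl
          simp only [Pi.sub_apply, Pi.single_eq_same] at h1
          rw [nu] at hnu
          omega
        refine hcore.2.1.below_node.mono ?_
        have : s'.val ≠ s.val := fun e => hne (Fin.ext e)
        omega
    rw [leftWeight_of_subtree hS, leftWeight_of_subtree h, topWeight_node_self]
    rw [subtree_append_of_eq hr] at hS
    rw [(hconst.subtree hS).topWeight_eq (hB.subtree hS) le_rfl]
    push_cast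
    ring
  sum_eq := rfl

theorem isCondensed_of_core (hT : T.Core fun i => (a i : ℤ))
    (hR : T.Reduced fun i => (a i : ℤ)) : T.IsCondensed := by
  rintro y - s hy ⟨h1, h2, -⟩
  obtain ⟨l, r, h⟩ := label_eq_some.1 hy
  have hl := subtree_left h
  rw [hl, subtree_right h] at h1
  exact (hR.subtree h).2.2.2 (Option.some.inj h1) (((mem_leading hT).1 h2).below hT hl)

theorem path_of_core (hT : T.Core fun i => (a i : ℤ)) (t : Fin n) (y : List Bool)
    (hy : T.label y = some t) (x : List Bool) (hx : T.label x = some t) (hxy : x ++ [false] <+: y)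
    (z : List Bool) (hz : z ∈ T.verts) (hxz : x <+: z) (hzy : z <+: y ++ [true]) :
    (T.leftWeight z t : ℤ) = T.leftWeight x t - ((z.length : ℤ) - x.length) := by
  obtain ⟨l, r, h⟩ := label_eq_some.1 hx
  obtain ⟨p, rfl⟩ := hxy
  obtain ⟨q, rfl⟩ := hxz
  obtain ⟨S, hS⟩ := mem_verts.1 hz
  have hcore := hT.subtree h
  rw [leftWeight_of_subtree h, leftWeight_of_subtree hS, topWeight_node_self]
  rw [List.append_assoc, List.append_assoc, List.prefix_append_right_inj] at hzy
  rcases q with _ | ⟨b, q⟩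
  · rw [List.append_nil, h] at hS
    cases hS
    simp
  · rw [List.singleton_append, List.cons_prefix_cons] at hzy
    obtain ⟨rfl, hq⟩ := hzy
    have hl := subtree_left h
    rw [label_append hl] at hy
    have hS' : l.subtree q = some S := by
      rw [← hS, ← subtree_append_of_eq hl]; simp
    rw [hcore.2.2.2.2.2.2.leftWeight_eq hcore.1 hcore.2.2.2.1 hy hq hS']
    simp only [List.length_append, List.length_cons]
    push_cast
    ring

end

end Local

/-! ### Trees whose families are closed under colex descent -/

section CompatibleOfDown

variable {n : ℕ} {T S : ColorTree n} {a : Fin n → ℕ} {X : List Bool}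

/-- Every leading vertex is reached by suitable sets in the higher colors. -/
theorem exists_reaching (hT : T.Core fun i => (a i : ℤ)) (d : ℕ) :
    ∀ j, j + d = n → ∀ X, T.Lead j X → ∃ U : Fin n → Finset ℕ,
      (∀ i : Fin n, j ≤ i.val → (U i).card = a i) ∧
      ∀ A : Fin n → Finset ℕ, (∀ i : Fin n, j ≤ i.val → A i = U i) →
        (T.HasFace n A ↔ T.FaceAt j X A) := by
  induction d with
  | zero =>
    rintro j rfl X hX
    obtain rfl : X = [] := (T.lead_top.below hT T.subtree_nil).lead_iff.1 hX
    exact ⟨fun _ => ∅, fun i hi => absurd i.isLt (not_lt.2 hi), fun A _ => by simp [FaceAt]⟩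
  | succ d ih =>
    intro j hj x hx
    obtain ⟨t, rfl⟩ : ∃ t : Fin n, t.val = j := ⟨⟨j, by omega⟩, rfl⟩
    obtain ⟨X, p, S, rfl, hX, hS, hp⟩ := hx.exists_prefix (Nat.le_succ _)
    obtain ⟨U, hU, hUA⟩ := ih (t + 1) (by omega) X hX
    obtain ⟨c, hc, hca⟩ := hT.subtree_lead hX hS
    have hm := (cellMax_spec hc (hX.below hT hS) (hca t (Nat.lt_succ_self _)) hp).1
    have hne : ∀ i : Fin n, t.val + 1 ≤ i.val → i ≠ t := by
      rintro i hi rfl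
      omega
    refine ⟨update U t (S.cellMax t (a t) p), fun i hi => ?_, fun A hA => ?_⟩
    · rcases eq_or_ne i t with rfl | h
      · simpa using hm
      · have : i.val ≠ t.val := fun e => h (Fin.ext e)
        simpa [h] using hU i (by omega)
    · rw [hUA A fun i hi => by rw [hA i (by omega), update_of_ne (hne i hi)]]
      exact faceAt_succ_of_cellMax hT hX hS hp A (by rw [hA t le_rfl, update_self])

theorem cellMax_le_of_lt (hT : T.Core fun i => (a i : ℤ)) {t : Fin n} (hX : T.Lead (t + 1) X)
    (hS : T.subtree X = some S) {p q : List Bool} (hp : S.Lead t p) (hq : S.Lead t q)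
    (hpq : p < q) : toColex (S.cellMax t (a t) p) ≤ toColex (S.cellMax t (a t) q) := by
  obtain ⟨c, hc, hca⟩ := hT.subtree_lead hX hS
  have hB := hX.below hT hS
  obtain ⟨h1, h2, h3⟩ := cellMax_spec hc hB (hca t (Nat.lt_succ_self _)) hp
  obtain ⟨h4, -, h6⟩ := cellMax_spec hc hB (hca t (Nat.lt_succ_self _)) hq
  by_contra h
  have := (h2.mono hc (not_le.1 h).le (by rw [h1, h4])).2
  rw [h3, h6] at this
  exact this hpq

/-- If the family is closed under colex descent, the families at the cells of a level decrease. -/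
theorem facesLE_of_isDown (hT : T.Core fun i => (a i : ℤ)) (hD : T.IsDown fun i => (a i : ℤ))
    {t : Fin n} (hX : T.Lead (t + 1) X) (hS : T.subtree X = some S) {p q : List Bool}
    (hp : S.Lead t p) (hq : S.Lead t q) (hpq : p < q) :
    T.FacesLE a t (X ++ q) (X ++ p) := by
  intro A hA h
  obtain ⟨c, hc, hca⟩ := hT.subtree_lead hX hS
  have hB := hX.below hT hS
  have hcardq := (cellMax_spec hc hB (hca t (Nat.lt_succ_self _)) hq).1
  have hcardp := (cellMax_spec hc hB (hca t (Nat.lt_succ_self _)) hp).1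
  obtain ⟨U, hU, hUA⟩ := exists_reaching hT (n - (t + 1)) (t + 1) (by omega) X hX
  have hlq := hX.append (Nat.le_succ _) hS hq
  have hlp := hX.append (Nat.le_succ _) hS hp
  -- complete `A` by a set of color `t` in the later cell and by sets reaching `X` above
  let A' : Fin n → Finset ℕ := fun i => if i < t then A i else U i
  have hup : ∀ B, ∀ i : Fin n, t.val + 1 ≤ i.val → update A' t B i = U i := fun B i hi => by
    have h1 : i ≠ t := by rintro rfl; omega
    have h2 : ¬ i < t := by rw [Fin.lt_def]; omega
    simp [A', h1, h2]
  have hlow : ∀ B, ∀ i : Fin n, i.val < t.val → update A' t B i = A i := fun B i hi => by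
    have h1 : i ≠ t := Fin.ne_of_lt hi
    have h2 : i < t := hi
    simp [A', h1, h2]
  have key : ∀ p', S.Lead t p' → T.Lead t (X ++ p') →
      (T.HasFace n (update A' t (S.cellMax t (a t) p')) ↔ T.FaceAt t (X ++ p') A) :=
    fun p' hp' hl => by
      rw [hUA _ (hup _), faceAt_succ_of_cellMax hT hX hS hp' _ (update_self _ _ _)]
      exact faceAt_congr hT hl (hlow _)
  have h1 := hD _ (fun i => ?_) ((key q hq hlq).2 h) t (S.cellMax t (a t) p)
    (by rw [update_self, hcardp, hcardq])
    (by rw [update_self]; exact cellMax_le_of_lt hT hX hS hp hq hpq)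
  · rw [update_idem] at h1
    exact (key p hp hlp).1 h1
  · rcases lt_trichotomy i.val t.val with hi | hi | hi
    · rw [hlow _ i hi, hA i hi]
    · obtain rfl : i = t := Fin.ext hi
      rw [update_self, hcardq]
    · rw [hup _ i hi, hU i hi]

/-- A comparison of families at two vertices restricts to the cells which contain a given largest
set. -/
theorem cellMax_le_of_facesLE (hT : T.Core fun i => (a i : ℤ)) {t : Fin n} {Y : List Bool}
    {S' : ColorTree n} (hX : T.Lead (t + 1) X) (hS : T.subtree X = some S)
    (hY : T.Lead (t + 1) Y) (hS' : T.subtree Y = some S') (h : T.FacesLE a (t + 1) X Y)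
    {p : List Bool} (hp : S.Lead t p) :
    S'.InLevel t (S.cellMax t (a t) p) ∧ (∀ A : Fin n → Finset ℕ,
      (∀ i : Fin n, i.val < t.val → (A i).card = a i) → T.FaceAt t (X ++ p) A →
        T.FaceAt t (Y ++ S'.cell t (S.cellMax t (a t) p)) A) := by
  obtain ⟨c, hc, hca⟩ := hT.subtree_lead hX hS
  have hm := (cellMax_spec hc (hX.below hT hS) (hca t (Nat.lt_succ_self _)) hp).1
  have hlp := hX.append (Nat.le_succ _) hS hp
  have hlq := hY.append (Nat.le_succ _) hS' (lead_cell (hY.below hT hS') (S.cellMax t (a t) p))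
  have key : ∀ A : Fin n → Finset ℕ,
      (∀ i : Fin n, i.val < t.val → (A i).card = a i) → T.FaceAt t (X ++ p) A →
        S'.InLevel t (S.cellMax t (a t) p) ∧
        T.FaceAt t (Y ++ S'.cell t (S.cellMax t (a t) p)) A := fun A hA hf => by
    have hlow : ∀ i : Fin n, i.val < t.val → update A t (S.cellMax t (a t) p) i = A i :=
      fun i hi => update_of_ne (Fin.ne_of_lt hi) _ _
    have h1 := h (update A t (S.cellMax t (a t) p)) (fun i hi => by
      rcases eq_or_ne i t with rfl | hne
      · simpa using hm
      · have : i.val ≠ t.val := fun e => hne (Fin.ext e)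
        rw [update_of_ne hne]; exact hA i (by omega)) (by
      rw [faceAt_succ_of_cellMax hT hX hS hp _ (update_self _ _ _), faceAt_congr hT hlp hlow]
      exact hf)
    rw [faceAt_succ hT hY hS', update_self, faceAt_congr hT hlq hlow] at h1
    exact h1
  obtain ⟨A, hA, hf⟩ := exists_card_faceAt hT hlp
  exact ⟨(key A hA hf).1, fun A hA hf => (key A hA hf).2⟩

/-- If the family is closed under colex descent, `ζ` is defined wherever the compatibility condition
evaluates it, and its value describes at least the tuples described at the given vertex. -/
theorem exists_zeta_of_isDown (hT : T.Core fun i => (a i : ℤ))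
    (hD : T.IsDown fun i => (a i : ℤ)) {i : Fin n} (d : ℕ) :
    ∀ j, j + d = i → ∀ x, T.Lead j x → 0 < (a i : ℤ) - T.nu a x i → ∃ z,
      T.zeta a i d x = some z ∧ T.Lead j z ∧ T.FacesLE a j x z := by
  induction d with
  | zero =>
    rintro j hj x hx hnu
    obtain rfl : j = i.val := hj
    obtain ⟨X, q, S, rfl, hX, hS, hq⟩ := hx.exists_prefix (Nat.le_succ _)
    obtain ⟨p, hp, hpq⟩ := exists_lt_of_count_pos hq ((nu_lt_iff hT hX hS hq).1 hnu)
    obtain ⟨q', hz, hq', hlt, -⟩ := zeta_lead_of_count hT hX hS hp hq hpq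
    exact ⟨_, hz, hX.append (Nat.le_succ _) hS hq', facesLE_of_isDown hT hD hX hS hq' hq hlt⟩
  | succ d ih =>
    intro j hj x hx hnu
    obtain ⟨t, rfl⟩ : ∃ t : Fin n, t.val = j := ⟨⟨j, by omega⟩, rfl⟩
    obtain ⟨X, p, S, rfl, hX, hS, hp⟩ := hx.exists_prefix (Nat.le_succ _)
    have hB := hX.below hT hS
    have hti : t.val + 1 ≤ i.val := by omega
    rw [nu_append hS, hB.split_eq _ _ hti] at hnu
    obtain ⟨Y, hY, hYl, hle⟩ := ih (t + 1) (by omega) X hX hnu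
    obtain ⟨S', hS'⟩ := hYl.subtree
    have hB' := hYl.below hT hS'
    obtain ⟨c, hc, hca⟩ := hT.subtree_lead hX hS
    obtain ⟨c', hc', hca'⟩ := hT.subtree_lead hYl hS'
    obtain ⟨hm, -, -⟩ := cellMax_spec hc hB (hca t (Nat.lt_succ_self _)) hp
    obtain ⟨h1, h2⟩ := cellMax_le_of_facesLE hT hX hS hYl hS' hle hp
    have h3 := h1.le_cellMax hc' hB'
    rw [hm] at h3
    obtain ⟨q, hq1, hq2, hq3, hq4⟩ := zeta_succ hT hj hX hS hp hY hYl hS'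
      ⟨_, lead_cell hB' _, h3⟩
    refine ⟨_, hq1, hYl.append (Nat.le_succ _) hS' hq2, ?_⟩
    -- the first cell reaching the given set is the cell containing it
    have hcell : S'.cell t (S.cellMax t (a t) p) = q := by
      rcases lt_trichotomy (S'.cell t (S.cellMax t (a t) p)) q with hlt | heq | hgt
      · exact absurd h3 (hq4 _ (lead_cell hB' _) hlt)
      · exact heq
      · obtain ⟨h4, h5, h6⟩ := cellMax_spec hc' hB' (hca' t (Nat.lt_succ_self _)) hq2
        have := (h5.mono hc' hq3 (by rw [hm, h4])).2
        rw [h6] at this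
        exact absurd hgt this
    rw [← hcell]
    exact h2

/-- Converse of `isDown_of_isCompatible`: `ζ` picks the cell containing a given largest set, and
the family there is at least as large. -/
theorem isCompatible_of_isDown (hT : T.Core fun i => (a i : ℤ))
    (hD : T.IsDown fun i => (a i : ℤ)) : T.IsCompatible a := by
  have hsucc : StrictMono Nat.succ := fun _ _ h => Nat.succ_lt_succ h
  intro i t hti x hx hnu
  rw [mem_leading hT] at hx
  rw [Fin.lt_def] at hti
  obtain ⟨z, hz, hzl, hle⟩ :=
    exists_zeta_of_isDown hT hD (i.val - (t.val + 1)) (t + 1) (by omega) x hx hnu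
  refine ⟨z, (mem_leading hT).2 hzl, hz, ?_⟩
  obtain ⟨S, hS⟩ := hx.subtree
  obtain ⟨S', hS'⟩ := hzl.subtree
  rw [signature_of_lead_succ hT hx hS, signature_of_lead_succ hT hzl hS',
    toColex_image_le_toColex_image hsucc]
  obtain ⟨c, hc, hca⟩ := hT.subtree_lead hx hS
  obtain ⟨c', hc', hca'⟩ := hT.subtree_lead hzl hS'
  have hB := hx.below hT hS
  have hp := lead_replicate_topRun hB
  have h1 := ((cellMax_le_of_facesLE hT hx hS hzl hS' hle hp).1).le_cellMax_topRun hc'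
    (hzl.below hT hS')
  rwa [(cellMax_spec hc hB (hca t (Nat.lt_succ_self _)) hp).1] at h1

/-- The top weight is attained: its entries are the largest vertices that occur. -/
theorem exists_hasFace_mem {S : ColorTree n} {c : Fin n → ℤ} (hS : S.Core c) {i : Fin n}
    (hi : 1 ≤ c i) (j : ℕ) :
    ∃ A : Fin n → Finset ℕ, (∀ i, ((A i).card : ℤ) = c i) ∧ S.HasFace j A ∧
      S.topWeight i - 1 ∈ A i ∧ ∀ i, A i ⊆ range (S.topWeight i) := by
  induction S generalizing c with
  | leaf w =>
    have hsub : ∀ i, Ico (w i - (c i).toNat) (w i) ⊆ range (w i) := fun i b hb =>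
      mem_range.2 (mem_Ico.1 hb).2
    refine ⟨fun i => Ico (w i - (c i).toNat) (w i), fun i => ?_, fun i _ => hsub i, ?_, hsub⟩
    · have h1 : 0 ≤ c i := hS.2.1 i
      have h2 := hS.2.2.2 i
      rw [Nat.card_Ico]
      omega
    · have h2 := hS.1 i
      simp only [topWeight, mem_Ico]
      omega
  | node s l r ihl ihr =>
    by_cases his : i = s
    · subst his
      obtain ⟨A, h1, h2, h3⟩ := exists_hasFace hS.2.1 j
      have hrl : r.topWeight ≤ l.topWeight := hS.2.2.1
      have hrl' : r.topWeight i ≤ l.topWeight i := hrl i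
      have hv : l.topWeight i ∉ A i := fun hv => by
        have := mem_range.1 (h2 i hv)
        omega
      refine ⟨update A i (insert (l.topWeight i) (A i)), fun k => ?_, ?_, by simp, fun k => ?_⟩
      · have := h1 k
        by_cases hk : k = i
        · subst hk
          simp only [Pi.sub_apply, Pi.single_eq_same] at this
          rw [update_self, card_insert_of_notMem hv]
          push_cast
          omega
        · simpa [hk] using this
      · simpa [HasFace, erase_insert hv] using h3
      · by_cases hk : k = i
        · subst hk
          rw [update_self, topWeight_node_self]
          exact insert_subset (by simp) ((h2 k).trans (range_mono (hrl'.trans (Nat.le_succ _))))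
        · rw [update_of_ne hk, topWeight_node_of_ne hk]
          exact (h2 k).trans (range_mono (hrl k))
    · obtain ⟨A, h1, h2, h3, h4⟩ := ihl hS.1 hi
      have hv : l.topWeight s ∉ A s := fun hv => by simpa using h4 s hv
      exact ⟨A, h1, by simpa [HasFace, hv] using h2, by rwa [topWeight_node_of_ne his],
        fun k => (h4 k).trans (range_mono (topWeight_le_node s l r k))⟩

/-- Inclusion of families gives an inequality of weights, since the top weight of a color is
attained. -/
theorem FacesLE.topWeight_le (ha : ∀ i, 0 < a i) (hT : T.Core fun i => (a i : ℤ)) {j : ℕ}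
    {x z : List Bool} {S S' : ColorTree n} (hx : T.Lead j x) (hS : T.subtree x = some S)
    (hz : T.Lead j z) (hS' : T.subtree z = some S') (h : T.FacesLE a j x z) {i : Fin n}
    (hi : i.val < j) : S.topWeight i ≤ S'.topWeight i := by
  obtain ⟨c, hc, hca⟩ := hT.subtree_lead hx hS
  obtain ⟨c', hc', -⟩ := hT.subtree_lead hz hS'
  have h1 : 1 ≤ c i := by rw [hca i hi]; exact_mod_cast ha i
  obtain ⟨A, hA, hf, hm, -⟩ := exists_hasFace_mem hc h1 j
  obtain ⟨S₁, hS₁, hf'⟩ := h A (fun k hk => by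
    have := hA k
    rw [hca k hk] at this
    exact_mod_cast this) ⟨S, hS, hf⟩
  obtain rfl : S₁ = S' := Option.some.inj (hS₁.symm.trans hS')
  have := mem_range.1 (hasFace_subset hc' hf' hi hm)
  omega

theorem exists_lead_topWeight_eq {t : Fin n} {S : ColorTree n} (hB : S.Below (t + 1)) :
    ∃ p S', S.Lead t p ∧ S.subtree p = some S' ∧
      ∀ i, i ≠ t → S'.topWeight i = S.topWeight i := by
  induction S with
  | leaf w => exact ⟨[], _, rfl, rfl, fun _ _ => rfl⟩
  | node s l r ihl ihr =>
    by_cases hs : s.val < t.val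
    · exact ⟨[], _, hs, rfl, fun _ _ => rfl⟩
    · have hst : s = t := by
        have h1 := hB.1; exact Fin.ext (by omega)
      subst hst
      obtain ⟨p, S', h1, h2, h3⟩ := ihl hB.2.1
      exact ⟨false :: p, S', ⟨le_rfl, h1⟩, h2, fun i hi => by
        rw [h3 i hi, topWeight_node_of_ne hi]⟩

theorem lead_append_of_subtree_node {t : Fin n} {S l r : ColorTree n} {c : Fin n → ℤ}
    (hS : S.Core c) {y p : List Bool} (hy : S.subtree y = some (node t l r))
    (hp : (node t l r).Lead t p) : S.Lead t (y ++ p) := by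
  induction S generalizing c y with
  | leaf w => rcases y with _ | ⟨_, y⟩ <;> simp [subtree] at hy
  | node s l' r' ihl ihr =>
    have hlab : s.val ≥ t.val := Nat.le_of_lt_succ
      (hS.below_node.label_lt (label_eq_some.2 ⟨_, _, hy⟩))
    rcases y with _ | ⟨_ | _, y⟩
    · cases hy; exact hp
    · exact ⟨hlab, ihl hS.1 hy⟩
    · exact ⟨hlab, ihr hS.2.1 hy⟩

theorem exists_lead_prefix {t : Fin n} {S l r : ColorTree n} {y : List Bool}
    (hy : S.subtree y = some (node t l r)) :
    ∃ X p S', y = X ++ p ∧ S.Lead (t + 1) X ∧ S.subtree X = some S' ∧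
      S'.subtree p = some (node t l r) := by
  induction S generalizing y with
  | leaf w => rcases y with _ | ⟨_, y⟩ <;> simp [subtree] at hy
  | node s l' r' ihl ihr =>
    by_cases hs : s.val < t.val + 1
    · exact ⟨[], y, _, rfl, hs, rfl, hy⟩
    rcases y with _ | ⟨_ | _, y⟩
    · cases hy
      omega
    · obtain ⟨X, p, S', rfl, h1, h2, h3⟩ := ihl hy
      exact ⟨false :: X, p, S', rfl, ⟨not_lt.1 hs, h1⟩, h2, h3⟩
    · obtain ⟨X, p, S', rfl, h1, h2, h3⟩ := ihr hy
      exact ⟨true :: X, p, S', rfl, ⟨not_lt.1 hs, h1⟩, h2, h3⟩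

/-- The comparison of weights at the end of a run. For colors below `t` it follows from the
inclusion of families along the level; weights of colors above `t` are constant. -/
theorem runEnd_ge_of_isDown (ha : ∀ i, 0 < a i) (hT : T.Core fun i => (a i : ℤ))
    (hD : T.IsDown fun i => (a i : ℤ)) (t : Fin n) (y : List Bool) (hy : T.label y = some t)
    (i : Fin n) (hi : i ≠ t) :
    T.leftWeight (y ++ [true]) i ≤ T.leftWeight (T.runEnd t (y ++ [false])) i := by
  obtain ⟨l, r, h⟩ := label_eq_some.1 hy
  have hcore := hT.subtree h
  have hl := subtree_left h
  have hr := subtree_right h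
  have hlB := hcore.2.2.2.1
  have hrB := hcore.2.2.2.2.1
  have hlq := lead_replicate_topRun hlB
  obtain ⟨L, hL⟩ := hlq.subtree
  rw [runEnd, run_of_subtree hl, leftWeight_of_subtree hr, leftWeight_append hl,
    leftWeight_of_subtree hL]
  rcases lt_or_gt_of_ne hi with hlt | hgt
  · obtain ⟨p, R, hp, hR, hRw⟩ := exists_lead_topWeight_eq hrB
    rw [← hRw i hi]
    obtain ⟨X, u, S, rfl, hX, hS, hu⟩ := exists_lead_prefix h
    have h1 : S.Lead t (u ++ false :: List.replicate (l.topRun t) true) :=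
      lead_append_of_subtree_node (hT.subtree hS) hu ⟨le_rfl, hlq⟩
    have h2 : S.Lead t (u ++ true :: p) :=
      lead_append_of_subtree_node (hT.subtree hS) hu ⟨le_rfl, hp⟩
    have h3 := facesLE_of_isDown hT hD hX hS h1 h2
      (append_lt_append_iff.2 (by simp [List.cons_lt_cons_iff]))
    refine h3.topWeight_le ha hT (hX.append (Nat.le_succ _) hS h2) ?_
      (hX.append (Nat.le_succ _) hS h1) ?_ hlt
    · rw [subtree_append_of_eq hS, subtree_append_of_eq hu]
      exact hR
    · rw [subtree_append_of_eq hS, subtree_append_of_eq hu]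
      exact hL
  · obtain ⟨h1, h2⟩ := hcore.2.2.2.2.2.1 i hgt
    rw [h2.topWeight_eq hrB hgt, (h1.subtree hL).topWeight_eq (hlB.subtree hL) hgt]

/-- A tree with all local properties whose family is closed under colex descent is a
representation. -/
theorem isGenMacaulayRep_of_core (ha : ∀ i, 0 < a i) (hT : T.Core fun i => (a i : ℤ))
    (hR : T.Reduced fun i => (a i : ℤ)) (hD : T.IsDown fun i => (a i : ℤ)) :
    T.IsGenMacaulayRep a
      (T.leaves.map fun u => tupleChoose (T.leftWeight u) (T.nu a u)).sum where
  macaulay := isMacaulayTree_of_core hT hR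
  condensed := isCondensed_of_core hT hR
  compressedLike :=
    { path := fun t y _ hy x _ hx hxy z hz hxz hzy => path_of_core hT t y hy x hx hxy z hz hxz hzy
      runEnd_ge := fun t y _ hy i hi => runEnd_ge_of_isDown ha hT hD t y hy i hi }
  compatible := isCompatible_of_isDown hT hD

end CompatibleOfDown

/-! ### Construction of a tree from a family closed under colex descent -/

section Construction

variable {n : ℕ}

/-- The entries of `A` in the first `j` colors have the sizes prescribed by `c`. -/
def HasType (j : ℕ) (c : Fin n → ℤ) (A : Fin n → Finset ℕ) : Prop :=
  ∀ i : Fin n, i.val < j → ((A i).card : ℤ) = c i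

/-- A non-empty finite family of tuples of type `c` in the first `j` colors, closed under replacing
an entry by an earlier set in colex order. -/
structure DownFamily (j : ℕ) (c : Fin n → ℤ) (D : (Fin n → Finset ℕ) → Prop) : Prop where
  congr : ∀ A A', (∀ i : Fin n, i.val < j → A i = A' i) → D A → D A'
  down : ∀ A, HasType j c A → D A → ∀ i : Fin n, i.val < j → ∀ B, B.card = (A i).card →
    toColex B ≤ toColex (A i) → D (update A i B)
  nonempty : ∃ A, HasType j c A ∧ D A
  bounded : ∃ m, ∀ A, HasType j c A → D A → ∀ i : Fin n, i.val < j → A i ⊆ range m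

theorem HasType.update {j : ℕ} {c c' : Fin n → ℤ} {A : Fin n → Finset ℕ} {t : Fin n}
    {B : Finset ℕ} (hA : HasType j c A) (hB : (B.card : ℤ) = c' t) (hc : ∀ i, i ≠ t → c' i = c i) :
    HasType j c' (update A t B) := by
  intro i hi
  rcases eq_or_ne i t with rfl | h
  · rwa [update_self]
  · rw [update_of_ne h, hc i h]; exact hA i hi

theorem Below.full {t : Fin n} {S : ColorTree n} (h : S.Below t) : S.Full t := by
  rcases S with w | ⟨s, l, r⟩
  · trivial
  · rintro rfl
    exact absurd h.1 (lt_irrefl _)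

theorem Core.constAt {t : Fin n} {S : ColorTree n} {c : Fin n → ℤ} (hS : S.Core c)
    (hB : S.Below t) : S.ConstAt t (S.topWeight t) := by
  rcases S with w | ⟨s, l, r⟩
  · rfl
  · have hne : t ≠ s := by rintro rfl; exact absurd hB.1 (lt_irrefl _)
    rw [topWeight_node_of_ne hne]
    exact hS.2.2.2.2.2.1 t hB.1

/-- What is needed of a tree describing the family `D` in the first `j` colors, with prescribed
terminal labels `u` in the other colors. -/
structure Describes (S : ColorTree n) (j : ℕ) (c : Fin n → ℤ) (u : Fin n → ℕ)
    (D : (Fin n → Finset ℕ) → Prop) : Prop where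
  core : S.Core c
  reduced : S.Reduced c
  below : S.Below j
  const : ∀ i : Fin n, j ≤ i.val → S.ConstAt i (u i)
  iff : ∀ A, HasType j c A → (S.HasFace j A ↔ D A)

/-- Every family in the first `j` colors is described by a tree. The last hypothesis keeps the
splitting labels of terminal vertices from vanishing. -/
def Describable (n j : ℕ) : Prop :=
  ∀ (c : Fin n → ℤ) (u : Fin n → ℕ) (D : (Fin n → Finset ℕ) → Prop), DownFamily j c D →
    (∀ i : Fin n, i.val < j → 1 ≤ c i) →
    (∀ i : Fin n, j ≤ i.val → 0 ≤ c i ∧ c i ≤ u i ∧ 0 < u i) → (j = 0 → c ≠ 0) →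
    ∃ S : ColorTree n, S.Describes j c u D

theorem describable_zero : Describable n 0 := by
  intro c u D hD _ hu hc
  obtain ⟨A₀, -, hA₀⟩ := hD.nonempty
  refine ⟨leaf u, ⟨fun i => (hu i (Nat.zero_le _)).2.2, fun i => (hu i (Nat.zero_le _)).1, hc rfl,
    fun i => (hu i (Nat.zero_le _)).2.1⟩, trivial, trivial, fun i _ => rfl, fun A _ => ?_⟩
  exact iff_of_true (fun i hi => absurd hi (Nat.not_lt_zero _))
    (hD.congr A₀ A (fun i hi => absurd hi (Nat.not_lt_zero _)) hA₀)

section Level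

variable {t : Fin n} {w k : ℕ} {c : Fin n → ℤ} {u : Fin n → ℕ}
  {D : (Fin n → Finset ℕ) → Prop}

/-- Some member of the family has the entry `B` in color `t`, for every `k`-subset `B` of
`{0, …, w - 1}`. -/
def IsFull (t : Fin n) (w k : ℕ) (c : Fin n → ℤ) (D : (Fin n → Finset ℕ) → Prop) : Prop :=
  ∀ B ⊆ range w, B.card = k → ∃ A, HasType (t + 1) c A ∧ A t = B ∧ D A

/-- The strengthening of `Describes` needed in the recursion on the largest vertex of color `t`. -/
structure DescribesLevel (S : ColorTree n) (t : Fin n) (w k : ℕ) (c : Fin n → ℤ) (u : Fin n → ℕ)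
    (D : (Fin n → Finset ℕ) → Prop) : Prop extends S.Describes (t + 1) c u D where
  top_le : S.topWeight t ≤ w
  full : IsFull t w k c D → S.topWeight t = w ∧ S.Full t
  const_self : k = 0 → S.ConstAt t w

/-- A family which does not depend on the set of color `t` is described without splitting that
color. -/
theorem describesLevel_of_const (ih : Describable n t) (hD : DownFamily (t + 1) c D)
    (hk : c t = k) (hw : 0 < w) (hkw : k ≤ w) (ht : t.val = 0 → 1 ≤ k)
    (hsub : ∀ A, HasType (t + 1) c A → D A → A t ⊆ range w)
    (hc : ∀ i : Fin n, i.val < t.val → 1 ≤ c i)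
    (hu : ∀ i : Fin n, t.val + 1 ≤ i.val → 0 ≤ c i ∧ c i ≤ u i ∧ 0 < u i)
    (hconst : ∀ A, HasType (t + 1) c A → D A → ∀ B ⊆ range w, B.card = k → D (update A t B)) :
    ∃ S : ColorTree n, S.DescribesLevel t w k c u D := by
  obtain ⟨A₀, hA₀, hDA₀⟩ := hD.nonempty
  obtain ⟨m, hm⟩ := hD.bounded
  have hB₀ := hA₀ t (Nat.lt_succ_self _)
  have hcard : ∀ A, HasType t c A → HasType (t + 1) c (update A t (A₀ t)) := fun A hA i hi => by
    rcases eq_or_ne i t with rfl | h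
    · rwa [update_self]
    · rw [update_of_ne h]
      have : i.val ≠ t.val := fun e => h (Fin.ext e)
      exact hA i (by omega)
  have hlt : ∀ A A' : Fin n → Finset ℕ, (∀ i : Fin n, i.val < t.val → A i = A' i) → ∀ B,
      ∀ i : Fin n, i.val < t.val + 1 → update A t B i = update A' t B i := fun A A' h B i hi => by
    rcases eq_or_ne i t with rfl | hne
    · rw [update_self, update_self]
    · have : i.val ≠ t.val := fun e => hne (Fin.ext e)
      rw [update_of_ne hne, update_of_ne hne, h i (by omega)]
  have hD₀ : DownFamily t c fun A => D (update A t (A₀ t)) :=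
    { congr := fun A A' h hA => hD.congr _ _ (hlt A A' h _) hA
      down := fun A hA h i hi B hB hle => by
        have hne : i ≠ t := Fin.ne_of_lt hi
        have := hD.down _ (hcard A hA) h i (Nat.lt_succ_of_lt hi) B
          (by rw [update_of_ne hne, hB]) (by rwa [update_of_ne hne])
        rwa [update_comm hne.symm] at this
      nonempty := ⟨A₀, fun i hi => hA₀ i (Nat.lt_succ_of_lt hi), by rwa [update_eq_self]⟩
      bounded := ⟨m, fun A hA h i hi => by
        have := hm _ (hcard A hA) h i (Nat.lt_succ_of_lt hi)
        rwa [update_of_ne (Fin.ne_of_lt hi)] at this⟩ }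
  obtain ⟨S, hS⟩ := ih c (update u t w) _ hD₀ hc (fun i hi => by
    rcases eq_or_ne i t with rfl | hne
    · rw [update_self, hk]
      exact ⟨Int.natCast_nonneg _, by exact_mod_cast hkw, hw⟩
    · have : i.val ≠ t.val := fun e => hne (Fin.ext e)
      rw [update_of_ne hne]
      exact hu i (by omega)) (fun h0 h => by
    have := ht h0
    rw [h] at hk
    simp at hk
    omega)
  have hCt : S.ConstAt t w := by simpa using hS.const t le_rfl
  refine ⟨S, ⟨hS.core, hS.reduced, hS.below.mono (Nat.le_succ _), fun i hi => ?_, fun A hA => ?_⟩,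
    (hCt.topWeight_eq hS.below le_rfl).le,
    fun _ => ⟨hCt.topWeight_eq hS.below le_rfl, hS.below.full⟩, fun _ => hCt⟩
  · have hne : i ≠ t := by rintro rfl; omega
    simpa [hne] using hS.const i (by omega)
  · have hA' : HasType t c A := fun i hi => hA i (Nat.lt_succ_of_lt hi)
    rw [hasFace_succ_of_below hS.below hCt, hS.iff A hA']
    constructor
    · rintro ⟨h1, h2⟩
      have := hconst _ (hcard A hA') h2 (A t) h1
        (by have := hA t (Nat.lt_succ_self _); rw [hk] at this; exact_mod_cast this)
      rwa [update_idem, update_eq_self] at this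
    · intro h
      exact ⟨hsub A hA h, hconst A hA h (A₀ t) (hsub A₀ hA₀ hDA₀)
        (by rw [hk] at hB₀; exact_mod_cast hB₀)⟩

/-- Splitting off the largest vertex of color `t` joins a tree for the sets avoiding it and a tree
for the sets containing it. -/
theorem describesLevel_node (hD : DownFamily (t + 1) c D) (hk : c t = (k + 1 : ℕ))
    (hkw : k + 1 ≤ w) (hsub : ∀ A, HasType (t + 1) c A → D A → A t ⊆ range (w + 1))
    (hc : ∀ i : Fin n, i.val < t.val → 1 ≤ c i)
    {A₁ : Fin n → Finset ℕ} (hA₁ : HasType (t + 1) c A₁) (hDA₁ : D A₁) (hwA₁ : w ∈ A₁ t)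
    (hconst : ¬ ∀ A, HasType (t + 1) c A → D A → ∀ B ⊆ range (w + 1), B.card = k + 1 →
      D (update A t B))
    {l r : ColorTree n}
    (hl : l.DescribesLevel t w (k + 1) c u fun A => A t ⊆ range w ∧ D A)
    (hr : r.DescribesLevel t w k (c - Pi.single t 1) u
      fun A => A t ⊆ range w ∧ D (update A t (insert w (A t)))) :
    (node t l r).DescribesLevel t (w + 1) (k + 1) c u D := by
  have hct : (c - (Pi.single t 1 : Fin n → ℤ)) t = k := by simp [hk]
  have hcne : ∀ i, i ≠ t → (c - (Pi.single t 1 : Fin n → ℤ)) i = c i := fun i hi => by simp [hi]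
  have htt : t.val < t.val + 1 := Nat.lt_succ_self _
  -- all sets without `w` occur
  have hDl : ∀ A, HasType (t + 1) c A → D A → w ∈ A t → ∀ B ⊆ range w, B.card = k + 1 →
      D (update A t B) := fun A hA h hw B hB hBc =>
    hD.down A hA h t htt B (by
      have := hA t htt
      rw [hk] at this
      rw [hBc]
      exact_mod_cast this.symm) (lt_of_subset_range_of_mem hB hw).le
  obtain ⟨hlw, hlF⟩ := hl.full fun B hB hBc =>
    ⟨update A₁ t B, hA₁.update (by rw [hBc, hk]) fun _ _ => rfl, update_self _ _ _,
      by rwa [update_self], hDl A₁ hA₁ hDA₁ hwA₁ B hB hBc⟩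
  have herase : ∀ A, HasType (t + 1) c A → w ∈ A t →
      HasType (t + 1) (c - Pi.single t 1) (update A t ((A t).erase w)) := fun A hA hw =>
    hA.update (by
      have h1 := hA t htt
      have h2 := card_erase_add_one hw
      rw [hct]
      rw [hk] at h1
      push_cast at h1
      omega) hcne
  have hsubE : ∀ A, HasType (t + 1) c A → D A → (A t).erase w ⊆ range w := fun A hA h b hb => by
    rw [mem_erase] at hb
    have := mem_range.1 (hsub A hA h hb.2)
    rw [mem_range]; omega
  have hiff : ∀ A, HasType (t + 1) c A → ((node t l r).HasFace (t + 1) A ↔ D A) := by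
    intro A hA
    simp only [HasFace, hlw]
    split_ifs with hw
    · rw [hr.iff _ (herase A hA hw), update_self, update_idem, insert_erase hw, update_eq_self]
      exact ⟨fun h => h.2, fun h => ⟨hsubE A hA h, h⟩⟩
    · rw [hl.iff A hA]
      refine ⟨fun h => h.2, fun h => ⟨fun b hb => ?_, h⟩⟩
      have h1 := mem_range.1 (hsub A hA h hb)
      have h2 : b ≠ w := fun e => hw (e ▸ hb)
      rw [mem_range]; omega
  have htop : r.topWeight ≤ l.topWeight := by
    intro i
    rcases lt_trichotomy i.val t.val with hi | hi | hi
    · have hne : i ≠ t := Fin.ne_of_lt hi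
      obtain ⟨A, hA, hf, hm, -⟩ := exists_hasFace_mem hr.core (i := i)
        (by rw [hcne i hne]; exact hc i hi) (t + 1)
      obtain ⟨h1, h2⟩ := (hr.iff A fun i _ => hA i).1 hf
      have hwA : w ∉ A t := fun h => by simpa using h1 h
      have hA' : HasType (t + 1) c (update A t (insert w (A t))) := fun i _ => by
        have := hA i
        rcases eq_or_ne i t with rfl | h
        · rw [update_self, card_insert_of_notMem hwA, hk]
          rw [hct] at this
          push_cast
          omega
        · rw [update_of_ne h, ← hcne i h, this]
      have h3 := hDl _ hA' h2 (by simp) (range (k + 1)) (range_mono hkw) (card_range _)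
      rw [update_idem] at h3
      have h4 : HasType (t + 1) c (update A t (range (k + 1))) := by
        have := hA'.update (t := t) (B := range (k + 1)) (c' := c) (by rw [card_range, hk])
          fun _ _ => rfl
        rwa [update_idem] at this
      have h5 := (hl.iff _ h4).2 ⟨by rw [update_self]; exact range_mono hkw, h3⟩
      have h6 := hasFace_subset hl.core h5 (Nat.lt_succ_of_lt hi)
      rw [update_of_ne hne] at h6
      have h7 : r.topWeight i - 1 < l.topWeight i := mem_range.1 (h6 hm)
      change r.topWeight i ≤ l.topWeight i
      omega
    · obtain rfl : i = t := Fin.ext hi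
      rw [hlw]; exact hr.top_le
    · rw [(hr.const i hi).topWeight_eq hr.below hi, (hl.const i hi).topWeight_eq hl.below hi]
  refine
    { core := ⟨hl.core, hr.core, htop, hl.below, hr.below, fun i hi => ?_, hlF⟩
      reduced := ⟨hl.reduced, hr.reduced, fun h1 => ?_, fun h1 h2 => ?_⟩
      below := ⟨htt, hl.below, hr.below⟩
      const := fun i hi => ⟨hl.const i hi, hr.const i hi⟩
      iff := hiff
      top_le := by rw [topWeight_node_self, hlw]
      full := fun hF => ⟨by rw [topWeight_node_self, hlw], fun _ => ?_⟩
      const_self := fun h => absurd h (Nat.succ_ne_zero _) }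
  · rw [(hl.const i hi).topWeight_eq hl.below hi]
    exact ⟨hl.const i hi, hr.const i hi⟩
  · rw [hlw]
    refine hr.const_self ?_
    rw [hk] at h1
    push_cast at h1
    omega
  · -- equal subtrees without the color `t` describe a family not depending on that color
    subst h1
    have hCt := hl.core.constAt h2
    rw [hlw] at hCt
    have key : ∀ A, HasType (t + 1) c A → (D A ↔ A t ⊆ range (w + 1) ∧ l.HasFace t A) := by
      intro A hA
      have hAA : A t ⊆ range (w + 1) → w ∉ A t → A t ⊆ range w := fun h hw b hb => by
        have h1 := mem_range.1 (h hb)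
        have h2 : b ≠ w := fun e => hw (e ▸ hb)
        rw [mem_range]; omega
      rw [← hiff A hA]
      simp only [HasFace, hlw]
      split_ifs with hw
      · rw [hasFace_succ_of_below h2 hCt, update_self, hasFace_congr h2 (A' := A) fun i hi => by
          simp [Fin.ne_of_lt hi]]
        refine and_congr_left fun _ => ⟨fun h b hb => ?_, fun h b hb => ?_⟩
        · by_cases hbw : b = w
          · simp [hbw]
          · have := mem_range.1 (h (mem_erase.2 ⟨hbw, hb⟩))
            rw [mem_range]; omega
        · rw [mem_erase] at hb
          have := mem_range.1 (h hb.2)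
          rw [mem_range]; omega
      · rw [hasFace_succ_of_below h2 hCt]
        exact and_congr_left fun _ => ⟨fun h => h.trans (range_mono (Nat.le_succ _)),
          fun h => hAA h hw⟩
    refine hconst fun A hA h B hB hBc => ?_
    rw [key _ (hA.update (by rw [hBc, hk]) fun _ _ => rfl), update_self,
      hasFace_congr h2 (A' := A) fun i hi => by simp [Fin.ne_of_lt hi]]
    exact ⟨hB, ((key A hA).1 h).2⟩
  · obtain ⟨h1, h2⟩ := hr.full fun B hB hBc => by
      have hwB : w ∉ B := fun h => by simpa using hB h
      obtain ⟨A, hA, hAB, h⟩ := hF (insert w B)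
        (insert_subset (by simp) (hB.trans (range_mono (Nat.le_succ _))))
        (by rw [card_insert_of_notMem hwB, hBc])
      refine ⟨update A t B, hA.update (by rw [hBc, hct]) hcne, update_self _ _ _,
        by rwa [update_self], ?_⟩
      rwa [update_self, update_idem, ← hAB, update_eq_self]
    exact ⟨hlF, h2, h1.trans hlw.symm⟩

/-- Induction on the bound `w` for the vertices of color `t`: a family independent of the set of
color `t` is left to the lower colors, an unused largest vertex is dropped, and otherwise the
largest vertex is split off. -/
theorem exists_describesLevel (ih : Describable n t) (w : ℕ) :
    ∀ (k : ℕ) (c : Fin n → ℤ) (D : (Fin n → Finset ℕ) → Prop), DownFamily (t + 1) c D →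
      c t = k → 0 < w → (t.val = 0 → 1 ≤ k) →
      (∀ A, HasType (t + 1) c A → D A → A t ⊆ range w) →
      (∀ i : Fin n, i.val < t.val → 1 ≤ c i) →
      (∀ i : Fin n, t.val + 1 ≤ i.val → 0 ≤ c i ∧ c i ≤ u i ∧ 0 < u i) →
      ∃ S : ColorTree n, S.DescribesLevel t w k c u D := by
  induction w with
  | zero => exact fun _ _ _ _ _ h => absurd h (lt_irrefl _)
  | succ w IH =>
    intro k c D hD hk hw ht hsub hc hu
    have htt : t.val < t.val + 1 := Nat.lt_succ_self _
    have hcardt : ∀ A, HasType (t + 1) c A → (A t).card = k := fun A hA => by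
      have := hA t htt
      rw [hk] at this
      exact_mod_cast this
    obtain ⟨A₀, hA₀, hDA₀⟩ := hD.nonempty
    obtain ⟨m, hm⟩ := hD.bounded
    have hkw : k ≤ w + 1 := by
      have := card_le_card (hsub A₀ hA₀ hDA₀)
      rwa [hcardt A₀ hA₀, card_range] at this
    by_cases hconst : ∀ A, HasType (t + 1) c A → D A → ∀ B ⊆ range (w + 1), B.card = k →
        D (update A t B)
    · exact describesLevel_of_const ih hD hk hw hkw ht hsub hc hu hconst
    have hk0 : k ≠ 0 := by
      rintro rfl
      refine hconst fun A hA h B _ hBc => ?_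
      rw [card_eq_zero.1 hBc, ← card_eq_zero.1 (hcardt A hA), update_eq_self]
      exact h
    have hkw' : k ≠ w + 1 := by
      rintro rfl
      refine hconst fun A hA h B hB hBc => ?_
      rw [eq_of_subset_of_card_le hB (by rw [hBc, card_range]),
        ← eq_of_subset_of_card_le (hsub A hA h) (by rw [hcardt A hA, card_range]), update_eq_self]
      exact h
    have hw' : 0 < w := by omega
    by_cases hused : ∀ A, HasType (t + 1) c A → D A → w ∉ A t
    · -- the largest vertex does not occur
      obtain ⟨S, hS⟩ := IH k c D hD hk hw' ht (fun A hA h b hb => by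
        have h1 := mem_range.1 (hsub A hA h hb)
        have h2 : b ≠ w := fun e => hused A hA h (e ▸ hb)
        rw [mem_range]; omega) hc hu
      refine ⟨S, hS.toDescribes, hS.top_le.trans (Nat.le_succ _), fun hF => ?_,
        fun h => absurd h hk0⟩
      have hwr : w ∉ range (k - 1) := by rw [mem_range]; omega
      obtain ⟨A, hA, hAB, h⟩ := hF (insert w (range (k - 1)))
        (insert_subset (by simp) (range_mono (by omega)))
        (by rw [card_insert_of_notMem hwr, card_range]; omega)
      exact absurd (by rw [hAB]; exact mem_insert_self _ _) (hused A hA h)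
    push Not at hused
    obtain ⟨A₁, hA₁, hDA₁, hwA₁⟩ := hused
    obtain ⟨k, rfl⟩ : ∃ k', k = k' + 1 := ⟨k - 1, by omega⟩
    have hct : (c - (Pi.single t 1 : Fin n → ℤ)) t = k := by simp [hk]
    have hcne : ∀ i, i ≠ t → (c - (Pi.single t 1 : Fin n → ℤ)) i = c i := fun i hi => by simp [hi]
    have ht' : t.val = 0 → 1 ≤ k := by
      intro h0
      by_contra hk1
      obtain rfl : k = 0 := by omega
      -- with one color and single vertices, the family would consist of all single vertices
      refine hconst fun A hA h B hB hBc => ?_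
      obtain ⟨b, rfl⟩ := card_eq_one.1 hBc
      obtain ⟨b₁, hb₁⟩ := card_eq_one.1 (hcardt A₁ hA₁)
      have hbw : b ≤ w := Nat.lt_succ_iff.1 (mem_range.1 (singleton_subset_iff.1 hB))
      rw [hb₁, mem_singleton] at hwA₁
      subst hwA₁
      refine hD.congr _ _ (fun i hi => ?_) (hD.down A₁ hA₁ hDA₁ t htt {b} (by rw [hb₁]; rfl)
        (by rw [hb₁]; exact singleton_le_singleton.2 hbw))
      obtain rfl : i = t := Fin.ext (by omega)
      rw [update_self, update_self]
    have hins : ∀ A : Fin n → Finset ℕ, HasType (t + 1) (c - Pi.single t 1) A → A t ⊆ range w →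
        HasType (t + 1) c (update A t (insert w (A t))) := fun A hA hAt =>
      hA.update (by
        have h1 := hA t htt
        rw [hct] at h1
        rw [card_insert_of_notMem (fun h => by simpa using hAt h), hk]
        push_cast
        omega) fun i hi => (hcne i hi).symm
    have hcongr : ∀ A A' : Fin n → Finset ℕ, (∀ i : Fin n, i.val < t.val + 1 → A i = A' i) →
        D (update A t (insert w (A t))) → D (update A' t (insert w (A' t))) :=
      fun A A' h hA => hD.congr _ _ (fun i hi => by
        rcases eq_or_ne i t with rfl | hne
        · rw [update_self, update_self, h i hi]
        · rw [update_of_ne hne, update_of_ne hne, h i hi]) hA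
    have hDl : DownFamily (t + 1) c fun A => A t ⊆ range w ∧ D A :=
      { congr := fun A A' h hA => ⟨h t htt ▸ hA.1, hD.congr A A' h hA.2⟩
        down := fun A hA h i hi B hB hle => by
          refine ⟨?_, hD.down A hA h.2 i hi B hB hle⟩
          rcases eq_or_ne t i with rfl | hne
          · rw [update_self]; exact subset_range_of_le hle h.1
          · rw [update_of_ne hne]; exact h.1
        nonempty := ⟨update A₁ t (range (k + 1)),
          hA₁.update (by rw [card_range, hk]) fun _ _ => rfl,
          by rw [update_self]; exact range_mono (by omega),
          hD.down A₁ hA₁ hDA₁ t htt _ (by rw [card_range, hcardt A₁ hA₁])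
            (lt_of_subset_range_of_mem (range_mono (by omega)) hwA₁).le⟩
        bounded := ⟨m, fun A hA h => hm A hA h.2⟩ }
    have hDr : DownFamily (t + 1) (c - Pi.single t 1)
        fun A => A t ⊆ range w ∧ D (update A t (insert w (A t))) :=
      { congr := fun A A' h hA => ⟨h t htt ▸ hA.1, hcongr A A' h hA.2⟩
        down := fun A hA h i hi B hB hle => by
          have hA' := hins A hA h.1
          have hwA : w ∉ A t := fun h' => by simpa using h.1 h'
          rcases eq_or_ne i t with rfl | hne
          · have hBw := subset_range_of_le hle h.1
            have hwB : w ∉ B := fun h' => by simpa using hBw h'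
            rw [update_self]
            refine ⟨hBw, ?_⟩
            have := hD.down _ hA' h.2 i htt (insert w B)
              (by rw [update_self, card_insert_of_notMem hwA, card_insert_of_notMem hwB, hB])
              (by rw [update_self]; exact insert_mono_of_notMem hwB hwA hle)
            rwa [update_idem] at this ⊢
          · have := hD.down _ hA' h.2 i hi B (by rw [update_of_ne hne, hB])
              (by rwa [update_of_ne hne])
            rw [update_of_ne hne.symm]
            refine ⟨h.1, ?_⟩
            rwa [update_comm hne]
        nonempty := ⟨update A₁ t ((A₁ t).erase w), hA₁.update (by
            rw [card_erase_of_mem hwA₁, hcardt A₁ hA₁, hct]; rfl) hcne, by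
            rw [update_self]
            intro b hb
            rw [mem_erase] at hb
            have := mem_range.1 (hsub A₁ hA₁ hDA₁ hb.2)
            rw [mem_range]; omega, by
            rwa [update_self, update_idem, insert_erase hwA₁, update_eq_self]⟩
        bounded := ⟨m, fun A hA h i hi => by
          refine Subset.trans ?_ (hm _ (hins A hA h.1) h.2 i hi)
          rcases eq_or_ne i t with rfl | hne
          · rw [update_self]; exact subset_insert _ _
          · rw [update_of_ne hne]⟩ }
    obtain ⟨l, hl⟩ := IH (k + 1) c _ hDl hk hw' ht (fun A _ h => h.1) hc hu
    obtain ⟨r, hr⟩ := IH k (c - Pi.single t 1) _ hDr hct hw' ht' (fun A _ h => h.1)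
      (fun i hi => by rw [hcne i (Fin.ne_of_lt hi)]; exact hc i hi)
      (fun i hi => by
        have hne : i ≠ t := by rintro rfl; omega
        rw [hcne i hne]; exact hu i hi)
    exact ⟨node t l r,
      describesLevel_node hD hk (by omega) hsub hc hA₁ hDA₁ hwA₁ hconst hl hr⟩

end Level

/-- Induction on the number of colors, from the lowest color up. -/
theorem describable (j : ℕ) (hj : j ≤ n) : Describable n j := by
  induction j with
  | zero => exact describable_zero
  | succ j ih =>
    intro c u D hD hc hu _
    obtain ⟨t, rfl⟩ : ∃ t : Fin n, t.val = j := ⟨⟨j, hj⟩, rfl⟩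
    have htt : t.val < t.val + 1 := Nat.lt_succ_self _
    obtain ⟨m, hm⟩ := hD.bounded
    obtain ⟨A₀, hA₀, hDA₀⟩ := hD.nonempty
    have h1 := hc t htt
    have h2 := hA₀ t htt
    have h3 := card_le_card (hm A₀ hA₀ hDA₀ t htt)
    rw [card_range] at h3
    obtain ⟨S, hS⟩ := exists_describesLevel (ih (by omega)) m (c t).toNat c D hD
      (Int.toNat_of_nonneg (by omega)).symm (by omega) (fun _ => by omega)
      (fun A hA h => hm A hA h t htt) (fun i hi => hc i (Nat.lt_succ_of_lt hi)) hu
    exact ⟨S, hS.toDescribes⟩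

end Construction

end ColorTree

/-! ### Complexes and tuples of sets of natural numbers -/

section Ranking

set_option linter.unusedSectionVars false

open Finset Colex Function

variable {n : ℕ} {V : Type} [Fintype V] [LinearOrder V]

/-- The rank function `r` numbers the vertices of each color class `i` by `0, …, m i - 1` in
increasing order. -/
structure IsRanking (color : V → Fin n) (r : V → ℕ) (m : Fin n → ℕ) : Prop where
  lt_iff : ∀ u v, color u = color v → (r u < r v ↔ u < v)
  exists_iff : ∀ i e, e < m i ↔ ∃ v, color v = i ∧ r v = e

/-- The ranks of the vertices of a set in each of the color classes. -/
def traces (color : V → Fin n) (r : V → ℕ) (F : Finset V) (i : Fin n) : Finset ℕ :=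
  (F.filter fun v => color v = i).image r

/-- The set of vertices with given ranks in each of the color classes. -/
def ofTraces (color : V → Fin n) (r : V → ℕ) (A : Fin n → Finset ℕ) : Finset V :=
  univ.filter fun v => r v ∈ A (color v)

variable {color : V → Fin n} {r : V → ℕ} {m : Fin n → ℕ}

theorem mem_ofTraces {A : Fin n → Finset ℕ} {v : V} :
    v ∈ ofTraces color r A ↔ r v ∈ A (color v) := by simp [ofTraces]

theorem IsRanking.injOn (h : IsRanking color r m) {u v : V} (hc : color u = color v)
    (hr : r u = r v) : u = v := by
  rcases lt_trichotomy u v with hlt | heq | hgt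
  · have := (h.lt_iff u v hc).2 hlt; omega
  · exact heq
  · have := (h.lt_iff v u hc.symm).2 hgt; omega

theorem IsRanking.mem_traces (h : IsRanking color r m) {F : Finset V} {v : V} :
    r v ∈ traces color r F (color v) ↔ v ∈ F := by
  simp only [traces, mem_image, mem_filter]
  refine ⟨?_, fun hv => ⟨v, ⟨hv, rfl⟩, rfl⟩⟩
  rintro ⟨u, ⟨hu, hc⟩, hr⟩
  rwa [← h.injOn hc hr]

theorem IsRanking.ofTraces_traces (h : IsRanking color r m) (F : Finset V) :
    ofTraces color r (traces color r F) = F := by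
  ext v; rw [mem_ofTraces, h.mem_traces]

theorem IsRanking.traces_subset_range (h : IsRanking color r m) (F : Finset V) (i : Fin n) :
    traces color r F i ⊆ range (m i) := by
  intro e he
  simp only [traces, mem_image, mem_filter] at he
  obtain ⟨v, ⟨-, hc⟩, hr⟩ := he
  exact mem_range.2 ((h.exists_iff i e).2 ⟨v, hc, hr⟩)

theorem IsRanking.traces_ofTraces (h : IsRanking color r m) {A : Fin n → Finset ℕ}
    (hA : ∀ i, A i ⊆ range (m i)) : traces color r (ofTraces color r A) = A := by
  funext i
  ext e
  simp only [traces, mem_image, mem_filter, mem_ofTraces]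
  constructor
  · rintro ⟨v, ⟨hv, rfl⟩, rfl⟩
    exact hv
  · intro he
    obtain ⟨v, rfl, rfl⟩ := (h.exists_iff i e).1 (mem_range.1 (hA i he))
    exact ⟨v, ⟨he, rfl⟩, rfl⟩

theorem IsRanking.card_traces (h : IsRanking color r m) (F : Finset V) (i : Fin n) :
    (traces color r F i).card = (F.filter fun v => color v = i).card := by
  refine card_image_of_injOn fun u hu v hv hr => ?_
  simp only [coe_filter, Set.mem_ofPred_eq] at hu hv
  exact h.injOn (hu.2.trans hv.2.symm) hr

theorem IsRanking.sum_card_traces (h : IsRanking color r m) (F : Finset V) :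
    ∑ i, (traces color r F i).card = F.card := by
  simp only [h.card_traces]
  exact (card_eq_sum_card_fiberwise fun _ _ => mem_coe.2 (mem_univ _)).symm

theorem traces_mono {F G : Finset V} (hFG : F ⊆ G) (i : Fin n) :
    traces color r F i ⊆ traces color r G i :=
  image_subset_image (filter_subset_filter _ hFG)

theorem IsRanking.subset_iff (h : IsRanking color r m) {F G : Finset V} :
    F ⊆ G ↔ ∀ i, traces color r F i ⊆ traces color r G i := by
  refine ⟨fun hFG i => traces_mono hFG i, fun hFG v hv => ?_⟩
  rw [← h.mem_traces] at hv ⊢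
  exact hFG _ hv

/-- Rankings preserve and reflect the colex order of sets within one class. -/
theorem IsRanking.toColex_image_le (h : IsRanking color r m) {i : Fin n} {A B : Finset V}
    (hA : ∀ v ∈ A, color v = i) (hB : ∀ v ∈ B, color v = i) :
    toColex (A.image r) ≤ toColex (B.image r) ↔ toColex A ≤ toColex B := by
  have hmem : ∀ C : Finset V, (∀ v ∈ C, color v = i) → ∀ v, color v = i →
      (r v ∈ C.image r ↔ v ∈ C) := fun C hC v hv => by
    rw [mem_image]
    refine ⟨?_, fun h => ⟨v, h, rfl⟩⟩
    rintro ⟨u, hu, hr⟩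
    rwa [← h.injOn ((hC u hu).trans hv.symm) hr]
  have hle : ∀ u v, color u = i → color v = i → (r u ≤ r v ↔ u ≤ v) := fun u v hu hv => by
    rw [← not_lt, ← not_lt, h.lt_iff v u (hv.trans hu.symm)]
  rw [toColex_le_toColex, toColex_le_toColex]
  constructor
  · intro H v hv hvB
    obtain ⟨b, hb, hbA, hvb⟩ := H (mem_image_of_mem r hv) (by rwa [hmem B hB v (hA v hv)])
    obtain ⟨u, hu, rfl⟩ := mem_image.1 hb
    exact ⟨u, hu, by rwa [hmem A hA u (hB u hu)] at hbA, (hle v u (hA v hv) (hB u hu)).1 hvb⟩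
  · intro H b hb hbB
    obtain ⟨v, hv, rfl⟩ := mem_image.1 hb
    obtain ⟨u, hu, huA, hvu⟩ := H hv (by rwa [hmem B hB v (hA v hv)] at hbB)
    exact ⟨r u, mem_image_of_mem r hu, by rwa [hmem A hA u (hB u hu)],
      (hle v u (hA v hv) (hB u hu)).2 hvu⟩

/-- Numbering each color class in increasing order is a ranking. -/
theorem exists_isRanking (color : V → Fin n) : ∃ r m, IsRanking color r m := by
  let r : V → ℕ := fun v => (univ.filter fun u => color u = color v ∧ u < v).card
  have hlt : ∀ u v, color u = color v → u < v → r u < r v := fun u v hc huv => by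
    refine card_lt_card ((ssubset_iff_of_subset fun x hx => ?_).2 ⟨u, ?_, ?_⟩)
    · simp only [mem_filter, mem_univ, true_and] at hx ⊢
      exact ⟨hx.1.trans hc, hx.2.trans huv⟩
    · simp [hc, huv]
    · simp
  have hiff : ∀ u v, color u = color v → (r u < r v ↔ u < v) := fun u v hc => by
    refine ⟨fun h => ?_, hlt u v hc⟩
    by_contra hnot
    rcases (not_lt.1 hnot).lt_or_eq with h' | h'
    · exact lt_asymm h (hlt v u hc.symm h')
    · subst h'; exact lt_irrefl _ h
  let P : Fin n → Finset V := fun i => univ.filter fun v => color v = i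
  have himg : ∀ i, (P i).image r = range (P i).card := fun i => by
    refine eq_of_subset_of_card_le (fun e he => ?_) ?_
    · obtain ⟨v, hv, rfl⟩ := mem_image.1 he
      simp only [P, mem_filter, mem_univ, true_and] at hv
      refine mem_range.2 (card_lt_card ((ssubset_iff_of_subset fun x hx => ?_).2 ⟨v, ?_, ?_⟩))
      · simp only [P, mem_filter, mem_univ, true_and] at hx ⊢
        exact hx.1.trans hv
      · simp [P, hv]
      · simp
    · rw [card_range, card_image_of_injOn]
      intro u hu v hv huv
      simp only [P, coe_filter, mem_univ, true_and, Set.mem_ofPred_eq] at hu hv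
      have hc := hu.trans hv.symm
      rcases lt_trichotomy u v with h | h | h
      · exact absurd huv (hlt u v hc h).ne
      · exact h
      · exact absurd huv (hlt v u hc.symm h).ne'
  refine ⟨r, fun i => (P i).card, hiff, fun i e => ?_⟩
  rw [← mem_range, ← himg, mem_image]
  simp [P]

theorem ColoredComplex.inter_part (K : ColoredComplex n V) (F : Finset V) (i : Fin n) :
    F ∩ K.part i = F.filter fun v => K.color v = i := by
  ext v; simp [ColoredComplex.part]

theorem ColoredComplex.mem_part {K : ColoredComplex n V} {i : Fin n} {v : V} :
    v ∈ K.part i ↔ K.color v = i := by simp [ColoredComplex.part]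

theorem ColoredComplex.traces_eq (K : ColoredComplex n V) (F : Finset V) (i : Fin n) :
    traces K.color r F i = (F ∩ K.part i).image r := by rw [traces, K.inter_part]

theorem ColoredComplex.card_inter_part (K : ColoredComplex n V) (h : IsRanking K.color r m)
    (F : Finset V) (i : Fin n) : (F ∩ K.part i).card = (traces K.color r F i).card := by
  rw [h.card_traces, K.inter_part]

/-- If the facets of the complex are the tuples described by a tree whose family is closed under
colex descent, then the differential gives the fine `f`-vector. -/
theorem ColoredComplex.fineF_eq_card_tuples (K : ColoredComplex n V) (h : IsRanking K.color r m)
    {T : ColorTree n} {c : Fin n → ℤ} (hT : T.Core c) (hD : T.IsDown c)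
    (hsub : ∀ A ∈ T.tuples c, ∀ i, A i ⊆ range (m i))
    (hK : ∀ F, F ∈ K.faces ↔ ∃ A ∈ T.tuples c, ∀ i, traces K.color r F i ⊆ A i)
    {b : Fin n → ℤ} (hb : b ≤ c) : K.fineF b = (T.tuples b).card := by
  refine card_nbij' (traces K.color r) (ofTraces K.color r) (fun F hF => ?_) (fun B hB => ?_)
    (fun F _ => h.ofTraces_traces F) fun B hB => ?_
  · rw [mem_coe, mem_filter] at hF
    rw [mem_coe, ColorTree.mem_tuples_iff_exists hT hD hb, ← hK]
    refine ⟨hF.1, fun i => ?_⟩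
    rw [← hF.2 i, K.card_inter_part h]
  · rw [mem_coe, ColorTree.mem_tuples_iff_exists hT hD hb] at hB
    obtain ⟨⟨A, hA, hBA⟩, hBb⟩ := hB
    have htr := h.traces_ofTraces fun i => (hBA i).trans (hsub A hA i)
    rw [mem_coe, mem_filter, hK]
    refine ⟨⟨A, hA, fun i => by rw [htr]; exact hBA i⟩, fun i => ?_⟩
    rw [K.card_inter_part h, htr, hBb]
  · rw [mem_coe, ColorTree.mem_tuples_iff_exists hT hD hb] at hB
    obtain ⟨⟨A, hA, hBA⟩, -⟩ := hB
    exact h.traces_ofTraces fun i => (hBA i).trans (hsub A hA i)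

namespace ColoredComplex

variable {K : ColoredComplex n V} {a : Fin n → ℕ}

theorem card_traces_eq_of_card (h : IsRanking K.color r m) (hK : K.IsColored a) {F : Finset V}
    (hF : F ∈ K.faces) (hc : F.card = ∑ i, a i) (i : Fin n) :
    (traces K.color r F i).card = a i := by
  have hle : ∀ i ∈ univ, (traces K.color r F i).card ≤ a i := fun i _ => by
    rw [← K.card_inter_part h]; exact hK F hF i
  exact (sum_eq_sum_iff_of_le hle).1 (by rw [h.sum_card_traces, hc]) i (mem_univ i)

/-- Every face of a pure balanced complex lies in a face of the full type. -/
theorem exists_facet (hP : K.IsPure) (hK : K.IsBalanced a) {F : Finset V} (hF : F ∈ K.faces) :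
    ∃ G ∈ K.faces, F ⊆ G ∧ G.card = ∑ i, a i := by
  obtain ⟨G, hFG, hG⟩ := K.faces.exists_le_maximal hF
  obtain ⟨⟨G₀, hG₀, hc⟩, hub⟩ := hK.2
  refine ⟨G, hG.1, hFG, ?_⟩
  rw [← hc]
  refine hP G G₀ hG ⟨hG₀, fun H hH hle => ?_⟩
  have h1 : H.card ≤ G₀.card := by rw [hc]; exact hub ⟨H, hH, rfl⟩
  exact (eq_of_subset_of_card_le hle h1).symm.le

/-- The facets of a color-compressed balanced complex form a family closed under colex descent. -/
theorem IsColorCompressed.downFamily (hC : K.IsColorCompressed) (hK : K.IsBalanced a)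
    (h : IsRanking K.color r m) :
    ColorTree.DownFamily n (fun i => (a i : ℤ))
      fun A => (∀ i, A i ⊆ range (m i)) ∧ ofTraces K.color r A ∈ K.faces where
  congr A A' hAA hA := by
    obtain rfl : A = A' := funext fun i => hAA i i.isLt
    exact hA
  down A _ hA i _ B hBc hBle := by
    have hBm := subset_range_of_le hBle (hA.1 i)
    have hsub : ∀ k, update A i B k ⊆ range (m k) := fun k => by
      rcases eq_or_ne k i with rfl | hk
      · rwa [update_self]
      · rw [update_of_ne hk]; exact hA.1 k
    refine ⟨hsub, ?_⟩
    have htr := h.traces_ofTraces hA.1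
    have htr' := h.traces_ofTraces hsub
    have h1 : ((ofTraces K.color r A) ∩ K.part i).image r = A i := by rw [← K.traces_eq, htr]
    have h2 : ((ofTraces K.color r (update A i B)) ∩ K.part i).image r = B := by
      rw [← K.traces_eq, htr', update_self]
    have h3 := K.card_inter_part h (ofTraces K.color r A) i
    have h4 := K.card_inter_part h (ofTraces K.color r (update A i B)) i
    rw [htr] at h3
    rw [htr', update_self] at h4
    have hpart : ∀ F : Finset V, ∀ v ∈ F ∩ K.part i, K.color v = i := fun F v hv =>
      mem_part.1 (mem_inter.1 hv).2
    obtain ⟨F', hF', -, hF'2, hF'3⟩ := (hC _ hA.2 i).2 _ ⟨_, hA.2, rfl, rfl, rfl⟩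
      (ofTraces K.color r (update A i B) ∩ K.part i)
      (mem_powersetCard.2 ⟨inter_subset_right, by rw [h4, h3, hBc]⟩)
      ((h.toColex_image_le (hpart _) (hpart _)).1 (by rwa [h1, h2]))
    have : ofTraces K.color r (update A i B) = F' := by
      ext v
      by_cases hv : K.color v = i
      · have := Finset.ext_iff.1 hF'3 v
        simpa [mem_part, hv] using this
      · have := Finset.ext_iff.1 hF'2 v
        simp only [mem_sdiff, mem_part, hv, not_false_eq_true, and_true] at this
        rw [this, mem_ofTraces, mem_ofTraces, update_of_ne hv]
    rwa [this]
  nonempty := by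
    obtain ⟨F, hF, hc⟩ := hK.2.1
    refine ⟨traces K.color r F, fun i _ => ?_, h.traces_subset_range F, ?_⟩
    · rw [card_traces_eq_of_card h hK.1 hF hc]
    · rwa [h.ofTraces_traces]
  bounded := ⟨∑ i, m i, fun A _ hA i _ => (hA.1 i).trans
    (range_mono (single_le_sum (fun _ _ => Nat.zero_le _) (mem_univ i)))⟩

end ColoredComplex

/-- The numbers of faces of a pure color-compressed balanced complex are given by the tree which
describes its facets. -/
theorem exists_representation {K : ColoredComplex n V} {a : Fin n → ℕ} (hn : 0 < n)
    (ha : ∀ i, 0 < a i) (hP : K.IsPure) (hK : K.IsBalanced a) (hC : K.IsColorCompressed) :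
    ∃ T : ColorTree n, T.IsGenMacaulayRep a (K.fineF fun i => (a i : ℤ)) ∧
      0 < K.fineF (fun i => (a i : ℤ)) ∧ ∀ b : Fin n → ℤ, (∀ i, b i ≤ a i) →
        K.fineF b = T.differential a fun i => b i - a i := by
  obtain ⟨r, m, h⟩ := exists_isRanking K.color
  have hD := hC.downFamily hK h
  obtain ⟨T, hT⟩ := ColorTree.describable n le_rfl (fun i => (a i : ℤ)) 0 _ hD
    (fun i _ => by exact_mod_cast ha i) (fun i hi => absurd i.isLt (not_lt.2 hi))
    fun h0 => absurd h0 hn.ne'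
  have hmem : ∀ A, A ∈ T.tuples (fun i => (a i : ℤ)) ↔
      (∀ i, ((A i).card : ℤ) = a i) ∧ (∀ i, A i ⊆ range (m i)) ∧
        ofTraces K.color r A ∈ K.faces := fun A => by
    rw [ColorTree.mem_tuples hT.core, and_comm]
    exact and_congr_right fun hA => hT.iff A fun i _ => hA i
  have hdown : T.IsDown fun i => (a i : ℤ) := fun A hA hf i B hBc hBle => by
    have hA' : ColorTree.HasType n (fun i => (a i : ℤ)) A := fun i _ => hA i
    have := hD.down A hA' ((hT.iff A hA').1 hf) i i.isLt B hBc hBle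
    exact (hT.iff _ (hA'.update (by rw [hBc]; exact hA i) fun _ _ => rfl)).2 this
  have hfaces : ∀ F, F ∈ K.faces ↔
      ∃ A ∈ T.tuples (fun i => (a i : ℤ)), ∀ i, traces K.color r F i ⊆ A i := fun F => by
    constructor
    · intro hF
      obtain ⟨G, hG, hFG, hc⟩ := ColoredComplex.exists_facet hP hK hF
      refine ⟨traces K.color r G, (hmem _).2 ⟨fun i => ?_, h.traces_subset_range G, ?_⟩,
        h.subset_iff.1 hFG⟩
      · rw [ColoredComplex.card_traces_eq_of_card h hK.1 hG hc]
      · rwa [h.ofTraces_traces]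
    · rintro ⟨A, hA, hFA⟩
      obtain ⟨-, h1, h2⟩ := (hmem A).1 hA
      refine K.down_closed _ h2 F (h.subset_iff.2 fun i => ?_)
      rw [h.traces_ofTraces h1]
      exact hFA i
  have hcount : ∀ b : Fin n → ℤ, (∀ i, b i ≤ a i) →
      K.fineF b = T.differential a fun i => b i - a i := fun b hb => by
    rw [K.fineF_eq_card_tuples h hT.core hdown (fun A hA => ((hmem A).1 hA).2.1) hfaces hb,
      ColorTree.card_tuples_eq_differential hT.core]
  refine ⟨T, ?_, ?_, hcount⟩
  · have := ColorTree.isGenMacaulayRep_of_core ha hT.core hT.reduced hdown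
    convert this using 1
    rw [K.fineF_eq_card_tuples h hT.core hdown (fun A hA => ((hmem A).1 hA).2.1) hfaces le_rfl,
      ColorTree.card_tuples hT.core]
    rfl
  · rw [K.fineF_eq_card_tuples h hT.core hdown (fun A hA => ((hmem A).1 hA).2.1) hfaces le_rfl,
      card_pos]
    obtain ⟨A, hA, hDA⟩ := hD.nonempty
    exact ⟨A, (hmem A).2 ⟨fun i => hA i i.isLt, hDA⟩⟩

end Ranking

/-! ### The complex of a representation -/

section Realization

open Finset Colex Function

variable {n : ℕ}

/-- The vertices `0, …, m i - 1` of the color classes `i`, ordered lexicographically. -/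
instance sigmaFinLinearOrder (m : Fin n → ℕ) : LinearOrder (Σ i, Fin (m i)) :=
  inferInstanceAs (LinearOrder (Σₗ i, Fin (m i)))

/-- The vertices are named by their ranks. -/
theorem isRanking_sigma (m : Fin n → ℕ) :
    IsRanking (V := Σ i, Fin (m i)) Sigma.fst (fun v => v.2.val) m where
  lt_iff := by
    rintro ⟨i, e⟩ ⟨j, e'⟩ (rfl : i = j)
    change e < e' ↔ (toLex (⟨i, e⟩ : Σ i, Fin (m i))) < toLex ⟨i, e'⟩
    rw [Sigma.Lex.lt_def]
    refine ⟨fun h => Or.inr ⟨rfl, h⟩, ?_⟩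
    rintro (h | ⟨_, h⟩)
    · exact absurd h (lt_irrefl _)
    · exact h
  exists_iff i e := ⟨fun h => ⟨⟨i, e, h⟩, rfl, rfl⟩, by
    rintro ⟨⟨j, e'⟩, rfl, rfl⟩
    exact e'.isLt⟩

/-- Closure under colex descent, for the finite set of tuples of full type. -/
theorem ColorTree.IsDown.update_mem {T : ColorTree n} {c : Fin n → ℤ} (hT : T.Core c)
    (hD : T.IsDown c) {A : Fin n → Finset ℕ} (hA : A ∈ T.tuples c) {i : Fin n} {B : Finset ℕ}
    (hBc : B.card = (A i).card) (hBle : toColex B ≤ toColex (A i)) :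
    update A i B ∈ T.tuples c := by
  rw [mem_tuples hT] at hA ⊢
  refine ⟨hD A hA.2 hA.1 i B hBc hBle, fun k => ?_⟩
  rcases eq_or_ne k i with rfl | hk
  · rw [update_self, hBc]; exact hA.2 k
  · rw [update_of_ne hk]; exact hA.2 k

open Classical in
/-- The complex whose facets are the tuples of sets described by a tree with all local properties
whose family is closed under colex descent. -/
noncomputable def ColorTree.complex (T : ColorTree n) {a : Fin n → ℕ} (ha : ∀ i, 0 < a i)
    (hT : T.Core fun i => (a i : ℤ)) (hD : T.IsDown fun i => (a i : ℤ)) :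
    ColoredComplex n (Σ i, Fin (T.topWeight i)) where
  faces := univ.filter fun F => ∃ A ∈ T.tuples fun i => (a i : ℤ),
    ∀ i, traces Sigma.fst (fun v => v.2.val) F i ⊆ A i
  empty_mem := by
    obtain ⟨A, h1, -, h3⟩ := exists_hasFace hT n
    simp only [mem_filter, mem_univ, true_and]
    exact ⟨A, (mem_tuples hT).2 ⟨h3, h1⟩, fun i => by simp [traces]⟩
  down_closed F hF G hGF := by
    simp only [mem_filter, mem_univ, true_and] at hF ⊢
    obtain ⟨A, hA, hFA⟩ := hF
    exact ⟨A, hA, fun i => (traces_mono hGF i).trans (hFA i)⟩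
  singleton_mem := by
    rintro ⟨i, e⟩
    simp only [mem_filter, mem_univ, true_and]
    obtain ⟨A, h1, h2, h3, -⟩ := exists_hasFace_mem hT (i := i) (by exact_mod_cast ha i) n
    have hA := (mem_tuples hT).2 ⟨h2, h1⟩
    have htr : ∀ B : Fin n → Finset ℕ, e.val ∈ B i →
        ∀ k, traces (V := Σ i, Fin (T.topWeight i)) Sigma.fst (fun v => v.2.val) {⟨i, e⟩} k ⊆
          B k := fun B he k => by
      by_cases hk : i = k
      · subst hk; simpa [traces, filter_singleton] using he
      · simp [traces, filter_singleton, hk]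
    by_cases he : e.val ∈ A i
    · exact ⟨A, hA, htr A he⟩
    · -- exchange the largest vertex of the class for `e`
      have hne : e.val ∉ (A i).erase (T.topWeight i - 1) := fun h => he (mem_of_mem_erase h)
      refine ⟨update A i (insert e.val ((A i).erase (T.topWeight i - 1))),
        hD.update_mem hT hA ?_ ?_, htr _ (by simp)⟩
      · rw [card_insert_of_notMem hne, card_erase_add_one h3]
      · have := (insert_le_insert hne (notMem_erase (T.topWeight i - 1) (A i))).2
          (by have := e.isLt; omega)
        rwa [insert_erase h3] at this
  color := Sigma.fst
  color_surjective i := ⟨⟨i, 0, hT.pos i⟩, rfl⟩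

theorem ColorTree.mem_complex_faces {T : ColorTree n} {a : Fin n → ℕ} (ha : ∀ i, 0 < a i)
    (hT : T.Core fun i => (a i : ℤ)) (hD : T.IsDown fun i => (a i : ℤ))
    {F : Finset (Σ i, Fin (T.topWeight i))} :
    F ∈ (T.complex ha hT hD).faces ↔ ∃ A ∈ T.tuples fun i => (a i : ℤ),
      ∀ i, traces Sigma.fst (fun v => v.2.val) F i ⊆ A i := by
  simp [complex]

theorem ColorTree.subset_range_of_mem_tuples {T : ColorTree n} {c : Fin n → ℤ} (hT : T.Core c)
    {A : Fin n → Finset ℕ} (hA : A ∈ T.tuples c) (i : Fin n) : A i ⊆ range (T.topWeight i) :=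
  hasFace_subset hT ((mem_tuples hT).1 hA).1 i.isLt

/-- A family of facets closed under colex descent generates a pure color-compressed balanced
complex. -/
theorem exists_complex {T : ColorTree n} {a : Fin n → ℕ} (ha : ∀ i, 0 < a i)
    (hT : T.Core fun i => (a i : ℤ)) (hD : T.IsDown fun i => (a i : ℤ)) :
    ∃ (V : Type) (_ : Fintype V) (_ : LinearOrder V) (K : ColoredComplex n V),
      K.IsPure ∧ K.IsBalanced a ∧ K.IsColorCompressed ∧ ∀ b : Fin n → ℤ, (∀ i, b i ≤ a i) →
        K.fineF b = T.differential a fun i => b i - a i := by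
  refine ⟨Σ i, Fin (T.topWeight i), inferInstance, inferInstance, T.complex ha hT hD, ?_⟩
  have hmem := fun F => ColorTree.mem_complex_faces ha hT hD (F := F)
  have h : IsRanking (T.complex ha hT hD).color (fun v => v.2.val) T.topWeight :=
    isRanking_sigma _
  change ∀ F, F ∈ (T.complex ha hT hD).faces ↔ ∃ A ∈ T.tuples fun i => (a i : ℤ),
    ∀ i, traces (T.complex ha hT hD).color (fun v => v.2.val) F i ⊆ A i at hmem
  generalize T.complex ha hT hD = K at h hmem
  generalize (fun v : Σ i, Fin (T.topWeight i) => v.2.val) = r at h hmem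
  have hcard : ∀ A ∈ T.tuples (fun i => (a i : ℤ)), ∀ i, (A i).card = a i := fun A hA i => by
    exact_mod_cast ((ColorTree.mem_tuples hT).1 hA).2 i
  have htr : ∀ A ∈ T.tuples (fun i => (a i : ℤ)), traces K.color r (ofTraces K.color r A) = A :=
    fun A hA => h.traces_ofTraces (ColorTree.subset_range_of_mem_tuples hT hA)
  have hfacet : ∀ A ∈ T.tuples (fun i => (a i : ℤ)), ofTraces K.color r A ∈ K.faces :=
    fun A hA => (hmem _).2 ⟨A, hA, fun i => by rw [htr A hA]⟩
  have hsum : ∀ A ∈ T.tuples (fun i => (a i : ℤ)), (ofTraces K.color r A).card = ∑ i, a i :=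
    fun A hA => by
      rw [← h.sum_card_traces, htr A hA]
      exact sum_congr rfl fun i _ => hcard A hA i
  have hmax : ∀ F, Maximal (· ∈ K.faces) F → F.card = ∑ i, a i := fun F hF => by
    obtain ⟨A, hA, hFA⟩ := (hmem F).1 hF.1
    have hle : F ⊆ ofTraces K.color r A := h.subset_iff.2 fun i => by rw [htr A hA]; exact hFA i
    rw [Subset.antisymm hle (hF.2 (hfacet A hA) hle), hsum A hA]
  have hcol : K.IsColored a := fun F hF i => by
    obtain ⟨A, hA, hFA⟩ := (hmem F).1 hF
    rw [K.card_inter_part h, ← hcard A hA i]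
    exact card_le_card (hFA i)
  obtain ⟨A₀, h1, -, h3⟩ := ColorTree.exists_hasFace hT n
  have hA₀ := (ColorTree.mem_tuples hT).2 ⟨h3, h1⟩
  refine ⟨fun F G hF hG => (hmax F hF).trans (hmax G hG).symm,
    ⟨hcol, ⟨_, hfacet A₀ hA₀, hsum A₀ hA₀⟩, ?_⟩, fun F _ t => ⟨?_, ?_⟩, fun b hb => ?_⟩
  · rintro _ ⟨F, hF, rfl⟩
    rw [← h.sum_card_traces]
    refine sum_le_sum fun i _ => ?_
    rw [← K.card_inter_part h]
    exact hcol F hF i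
  · rintro _ ⟨F', -, hc, -, rfl⟩
    exact mem_powersetCard.2 ⟨inter_subset_right, hc⟩
  · rintro _ ⟨F', hF', hc, hd, rfl⟩ B hB hle
    obtain ⟨hBt, hBc⟩ := mem_powersetCard.1 hB
    obtain ⟨A, hA, hFA⟩ := (hmem F').1 hF'
    have hBcol : ∀ v ∈ B, K.color v = t := fun v hv => ColoredComplex.mem_part.1 (hBt hv)
    have hinj : ∀ C : Finset (Σ i, Fin (T.topWeight i)), (∀ v ∈ C, K.color v = t) →
        (C.image r).card = C.card := fun C hC => card_image_of_injOn fun u hu v hv huv =>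
      h.injOn ((hC u hu).trans (hC v hv).symm) huv
    have hFcol : ∀ v ∈ F' ∩ K.part t, K.color v = t := fun v hv =>
      ColoredComplex.mem_part.1 (mem_inter.1 hv).2
    -- enlarge the earlier set to an entry of an earlier facet
    obtain ⟨R, hBR, hRc, hRA⟩ := exists_superset_le ((h.toColex_image_le hBcol hFcol).2 hle)
      (by rw [hinj B hBcol, hinj _ hFcol, hBc, hc])
      (by rw [← K.traces_eq]; exact hFA t : (F' ∩ K.part t).image r ⊆ A t)
    have hdisj : (F' \ K.part t ∪ B) ∩ K.part t = B := by
      ext v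
      simp only [mem_inter, mem_union, mem_sdiff]
      exact ⟨fun hv => hv.1.resolve_left fun h => h.2 hv.2, fun hv => ⟨Or.inr hv, hBt hv⟩⟩
    refine ⟨F' \ K.part t ∪ B, (hmem _).2 ⟨update A t R, hD.update_mem hT hA hRc hRA, fun i => ?_⟩,
      by rw [hdisj, hBc], ?_, hdisj.symm⟩
    · rcases eq_or_ne i t with rfl | hi
      · rw [update_self, K.traces_eq, hdisj]
        exact hBR
      · rw [update_of_ne hi]
        refine Subset.trans ?_ (hFA i)
        refine image_subset_image fun v hv => ?_
        rw [mem_filter, mem_union, mem_sdiff] at hv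
        rw [mem_filter]
        refine ⟨?_, hv.2⟩
        rcases hv.1 with hv' | hv'
        · exact hv'.1
        · exact absurd ((hBcol v hv').symm.trans hv.2) hi.symm
    · rw [← hd]
      ext v
      simp only [mem_sdiff, mem_union]
      exact ⟨fun hv => ⟨(hv.1.resolve_right fun h => hv.2 (hBt h)).1, hv.2⟩,
        fun hv => ⟨Or.inl hv, hv.2⟩⟩
  · rw [K.fineF_eq_card_tuples h hT hD
      (fun A hA => ColorTree.subset_range_of_mem_tuples hT hA) hmem hb,
      ColorTree.card_tuples_eq_differential hT]

end Realization

theorem mainTheorem5 (n : ℕ) (hn : 0 < n) (a : Fin n → ℕ) (ha : ∀ i, 0 < a i)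
    (f : (Fin n → ℤ) → ℤ) :
    (∃ (V : Type) (_ : Fintype V) (_ : LinearOrder V) (K : ColoredComplex n V),
      K.IsPure ∧ K.IsBalanced a ∧ K.IsColorCompressed ∧
        ∀ b : Fin n → ℤ, (∀ i, b i ≤ a i) → f b = K.fineF b) ↔
    (0 < f (fun i => (a i : ℤ)) ∧
      ∃ T : ColorTree n, T.IsGenMacaulayRep a (f (fun i => (a i : ℤ))).toNat ∧
        ∀ b : Fin n → ℤ, (∀ i, b i ≤ a i) →
          f b = T.differential a (fun i => b i - a i)) := by
  constructor
  · rintro ⟨V, _, _, K, hP, hB, hC, hf⟩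
    obtain ⟨T, hT, hpos, hd⟩ := exists_representation hn ha hP hB hC
    have hfa := hf (fun i => (a i : ℤ)) fun _ => le_rfl
    refine ⟨by rw [hfa]; exact_mod_cast hpos, T, ?_, fun b hb => ?_⟩
    · rwa [hfa, Int.toNat_natCast]
    · rw [hf b hb, hd b hb]
  · rintro ⟨-, T, hT, hf⟩
    have hcore := hT.macaulay.core hT.compressedLike
    obtain ⟨V, _, _, K, hP, hB, hC, hd⟩ :=
      exists_complex ha hcore (ColorTree.isDown_of_isCompatible hcore hT.compatible)
    exact ⟨V, _, _, K, hP, hB, hC, fun b hb => by rw [hf b hb, hd b hb]⟩
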